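/- **Problem.** Let $n\ge 1$, $A\in\mathbb R^{n\times d}$, $b\in\mathbb R^n$, $\bar A\in\mathbb R^{m\times d}$, $\bar b\in\mathbb R^m$, $f_0:\mathbb R^d\to\mathbb R$ and $g:\mathbb R^m\to\mathbb R\cup\{+\infty\}$, and consider $$\text{(P)}\qquad \min_x\ F_0(x):=f_0(x)+g(\bar A x+\bar b)\quad\text{s.t. } Ax+b=0 .$$ Put $F(x,y)=f_0(x)+g(y)$ and $H=[\bar A;A]\in\mathbb R^{(m+n)\times d}$. Assume: $f_0$ is differentiable and $\nabla f_0$ is $L_f$-Lipschitz; $\inf F_0>-\infty$; $g$ is proper, lower semicontinuous, convex, and $l_g$-Lipschitz on $\operatorname{dom} g$ with $l_g>0$; $A$ has full row rank; some $x$ satisfies $Ax+b=0$ and $\bar Ax+\bar b\in\operatorname{ri}(\operatorname{dom} g)$. A point $x^*$ is an $\varepsilon$-KKT point of (P) if for some $\gamma\in\mathbb R^n$, $\operatorname{dist}(0,\nabla f_0(x^*)+A^\top\gamma+\bar A^\top\partial g(\bar Ax^*+\bar b))\le\varepsilon$ and $\|Ax^*+b\|\le\varepsilon$; $x$ is a $(\delta,\varepsilon)$-KKT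 point of (P) if $\|x-x^*\|\le\delta$ for some $\varepsilon$-KKT point $x^*$. **Method (PG-RPD with restarted APG).** Input: $\sigma>0$, $x^{(0)}$ with $Ax^{(0)}+b=0$ and $F_0(x^{(0)})<\infty$, $y^{(0)}=\bar Ax^{(0)}+\bar b$, and $z^{\rm ini}=(z^{\rm ini}_1,z^{\rm ini}_2)\in\mathbb R^m\times\mathbb R^n$ with $z^{\rm ini}_1\in\operatorname{dom}g^\star$. Let $\tau=2L_f$, and for $z=(z_1,z_2)$ let $$\mathcal D_k(z)=\tfrac1{2\tau}\|H^\top z+\nabla f_0(x^{(k)})-\tau x^{(k)}\|^2+g^\star(z_1)-z_1^\top\bar b-z_2^\top b,\qquad \Omega^{(k+1)}=\operatorname{Argmin}\mathcal D_k,\quad \mathcal D_k^*=\min\mathcal D_k,$$ $G_k=\mathcal D_k(z^{\rm ini})-\mathcal D_k^*$, and let $\nu^{(k)}$ be the common value of $H^\top z+\nabla f_0(x^{(k)})-\tau x^{(k)}$ over $z\in\Omega^{(k+1)}$. Let $\lambda_{\max}$, $\lambda^+_{\min}$ be the largest and the smallest positive eigenvalue of $HH^\top$, $\kappa(H)=\sqrt{\lambda_{\max}/\lambda_{\min}^+}$,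 and $L_{\mathcal D}=\lambda_{\max}/\tau$. Outer iteration $k$ computes $z^{(k+1)}$ by $i_k$ rounds of $j_k$ APG (FISTA) steps on $\mathcal D_k$ with step size $1/L_{\mathcal D}$: the first round starts at $z^{\rm ini}$, each later one at the last iterate of the previous round, always with momentum reset ($\alpha_0=1$, $\hat z=z$). One APG step is $$\begin{aligned} z^+_1&=\operatorname{prox}_{L_{\mathcal D}^{-1}g^\star}\big(\hat z_1-\tfrac1{L_{\mathcal D}}\hat{\mathcal G}_1\big),\qquad z^+_2=\hat z_2-\tfrac1{L_{\mathcal D}}\hat{\mathcal G}_2,\\ \alpha^+&=\tfrac12\big(1+\sqrt{1+4\alpha^2}\big),\qquad \hat z^+=z^++\tfrac{\alpha-1}{\alpha^+}(z^+-z),\end{aligned}$$ where $(\hat{\mathcal G}_1,\hat{\mathcal G}_2)$ is the gradient of $\mathcal D_k(z)-g^\star(z_1)$ at $\hat z$. Then $$x^{(k+1)}=x^{(k)}-\tfrac1\tau\big(H^\top z^{(k+1)}+\nabla f_0(x^{(k)})\big),\qquad y^{(k+1)}=\operatorname{prox}_{\sigma^{-1}g}\big(\sigma^{-1}z_1^{(k+1)}+\bar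 Ax^{(k+1)}+\bar b\big).$$ The required accuracy is $$(\ast)\qquad z_1^{(k+1)}\in\operatorname{dom}g^\star,\qquad \operatorname{dist}(z^{(k+1)},\Omega^{(k+1)})\le\mu_k .$$ With spectral norms, put $a=\|(AA^\top)^{-1}A\|$, $B_1=\frac1\tau\|\bar A\|\|H\|+\sigma^{-1}+\frac1\tau(\|\bar A\|+\|A\|)\|H\|$, $B_2=1+a\|H\|$, $B_3^k=a(\|\nabla f_0(x^{(k)})\|+\|\bar A\|l_g)$, $B_4^k=\frac1\tau(\|\nabla f_0(x^{(k)})\|+\|H\|(l_g+B_3^k))$, and $$\bar\mu_k=\min\Big\{\tfrac{\varepsilon^2}{480B_1l_gL_f},\tfrac{\tau\delta}{\|H\|},\tfrac{\varepsilon}{6\|H\|},\tfrac{\varepsilon}{B_1\sigma},\tfrac{\varepsilon}{B_1},\tfrac{\varepsilon^2}{12L_fB_1(B_3^k+\sigma\|\bar A\|B_4^k+l_g)},\sqrt{\tfrac{\varepsilon^2}{12L_fB_1B_2(1+\frac1\tau\sigma\|\bar A\|\|H\|)}}\Big\}.$$ Let $\Delta_{F_0}=F_0(x^{(0)})-\inf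 F_0$ and $\overline K_\varepsilon=\lceil120L_f\Delta_{F_0}\varepsilon^{-2}\rceil$. The total number of APG steps is $N=\sum_{k<\overline K_\varepsilon}i_kj_k$. We say that *the method finds a $(\delta,\varepsilon)$-KKT point* if $(\ast)$ holds for all $k\ge0$ and, for each minimizer $k'$ of $\|x^{(k+1)}-x^{(k)}\|$ over $0\le k<\overline K_\varepsilon$, $x^{(k'+1)}$ is a $(\delta,\varepsilon)$-KKT point of (P) (and $x^{(0)}$ is one if $\overline K_\varepsilon=0$). For $Q>0$ and $B$ not depending on $\varepsilon,\delta$, we say that $N=\mathcal O\big(Q\log(\tfrac B{\delta\varepsilon})\tfrac{L_f\Delta_{F_0}}{\varepsilon^2}\big)$ if, with an absolute constant $C$ and with $\delta_1=\min\{\delta,1\}$: (i) there is $\varepsilon_0>0$ such that $N\le C\,Q\log(\tfrac B{\delta_1\varepsilon})\tfrac{L_f\Delta_{F_0}}{\varepsilon^2}$ for all admissible $\varepsilon<\varepsilon_0$ and all $\delta>0$; (ii) there is $M$ such that $N\le C\,Q\,\big(\log(\tfrac B{\delta_1\varepsilon})+M\big)\lceil\tfrac{L_f\Delta_{F_0}}{\varepsilon^2}\rceil$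 for all admissible $\varepsilon$ and all $\delta>0$. Here $\varepsilon$ is admissible if $0<\varepsilon<\min\{\sqrt{3L_f},1\}$, and $\varepsilon_0,M$ may depend on the problem, the input, and the constants $\theta,B_5,B_6$ below, but not on $\varepsilon,\delta$. (If $B=0$, the logarithm is read as $0$.) **Theorem.** There is an absolute constant $C>0$ for which the following holds. (a) Let $H$ have full row rank, $\mu_k=\bar\mu_k$, $j_k=\lceil2\sqrt2\,\kappa(H)\rceil$, and $i_k$ be the least nonnegative integer that is at least $\log_2\frac{2G_k}{\kappa_{\mathcal D}\mu_k^2}$, where $\kappa_{\mathcal D}=\lambda^+_{\min}/\tau$ (and $i_k=0$ if $G_k=0$). Then for all admissible $\varepsilon$ and all $\delta>0$ the method finds a $(\delta,\varepsilon)$-KKT point of (P), and $$N=\mathcal O\Big(\kappa(H)\log\big(\tfrac1{\delta\varepsilon}\big)\tfrac{L_f\Delta_{F_0}}{\varepsilon^2}\Big).$$ In (b) and (c) let $g(y)=\max\{u^\top y: C_gu\le r\}$ for some matrix $C_g$ and vector $r$; for a constant $\theta$ put $\rho_k=[\theta^2\tau]^{-1}$ if $\bar b=0$ and $b=0$, and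 $\rho_k=\big[\theta^2\big(\tau+G_k+2\tau\|\nu^{(k)}/\tau\|^2\big)\big]^{-1}$ otherwise; let $j_k=\lceil2\sqrt{2L_{\mathcal D}/\rho_k}\rceil$, and let $i_k$ be the least nonnegative integer that is at least $\log_2\frac{2G_k}{\rho_k\mu_k^2}$ ($i_k=0$ if $G_k=0$). (b) Let $\bar b=0$, $b=0$, $\mu_k=\bar\mu_k$, and let $\theta=\theta(\bar A,A,C_g)$ be a Hoffman constant of the systems $H^\top z=s$, $C_gz_1\le t$, i.e. for all right-hand sides $(s,t)$ for which the solution set is nonempty, the distance of any $z$ to it is at most $\theta\,\|(H^\top z-s,(C_gz_1-t)_+)\|$. Then for all admissible $\varepsilon$ and all $\delta>0$ the method finds a $(\delta,\varepsilon)$-KKT point of (P), and $$N=\mathcal O\Big(\sqrt{\lambda_{\max}\theta^2}\,\log\big(\tfrac1{\delta\varepsilon}\big)\tfrac{L_f\Delta_{F_0}}{\varepsilon^2}\Big).$$ (c) Let $\{(x,y):F(x,y)\le F(x^{(0)},y^{(0)})+1\}$ be compact, $\mu_k=\bar\mu_k/(k+1)^2$, and let $\theta=\theta(\bar A,A,\bar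 b,b,C_g)$ be a Hoffman constant, in the same sense, of the systems $H^\top z=s$, $-z_1^\top\bar b-z_2^\top b=q$, $C_gz_1\le t$. Then for all admissible $\varepsilon$ and all $\delta>0$ the method finds a $(\delta,\varepsilon)$-KKT point of (P); there are constants $B_5,B_6$ independent of $\varepsilon$ and $\delta$ with $$\|\nu^{(k)}\|^2\le B_5,\qquad G_k\le B_6\qquad\text{for all }0\le k<\overline K_\varepsilon ;$$ and for all such constants $$N=\mathcal O\Big(\sqrt{\lambda_{\max}\theta^2\big(1+B_6/\tau+2B_5/\tau^2\big)}\,\log\big(\tfrac{B_6}{\delta\varepsilon}\big)\tfrac{L_f\Delta_{F_0}}{\varepsilon^2}\Big).$$ -/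

import Mathlib

open scoped RealInnerProductSpace

noncomputable section

namespace PGRPD

/-- Euclidean space `ℝ^d`. -/
abbrev E (d : ℕ) := EuclideanSpace ℝ (Fin d)

/-- Dual vectors `z = (z₁, z₂) ∈ ℝ^m × ℝ^n`, with the Euclidean norm of the stacked vector. -/
abbrev Z (m n : ℕ) := WithLp 2 (E m × E n)

section Convex

variable {m : ℕ}

/-- Effective domain of an extended-real-valued function. -/
def dom (h : E m → EReal) : Set (E m) := {y | h y ≠ ⊤}

/-- Proper: never `-∞`, and finite somewhere. -/
def Proper (h : E m → EReal) : Prop := (∀ y, h y ≠ ⊥) ∧ (dom h).Nonempty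

/-- Convexity of an extended-real-valued function: its epigraph is convex. -/
def ConvexFun (h : E m → EReal) : Prop :=
  Convex ℝ {p : E m × ℝ | h p.1 ≤ (p.2 : EReal)}

/-- Convex conjugate `h⋆(z) = sup_y (⟨z, y⟩ - h y)`. -/
def conj (h : E m → EReal) (z : E m) : EReal := ⨆ y, ((⟪z, y⟫ : ℝ) : EReal) - h y

/-- Subdifferential (of a proper convex function). -/
def subdiff (h : E m → EReal) (y : E m) : Set (E m) :=
  {ξ | ∀ y', h y + ((⟪ξ, y' - y⟫ : ℝ) : EReal) ≤ h y'}

/-- `prox_{η h}(y) = argmin_p { h p + ‖p - y‖² / (2η) }`. -/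
def prox (η : ℝ) (h : E m → EReal) (y : E m) : E m :=
  Classical.epsilon fun p => ∀ p',
    h p + ((‖p - y‖ ^ 2 / (2 * η) : ℝ) : EReal) ≤ h p' + ((‖p' - y‖ ^ 2 / (2 * η) : ℝ) : EReal)

end Convex

section MatrixNotions

/-- The matrix-vector product, on Euclidean spaces. -/
def mv {a c : ℕ} (M : Matrix (Fin a) (Fin c) ℝ) (x : E c) : E a := Matrix.toEuclideanLin M x

section
open scoped Matrix.Norms.L2Operator

/-- Spectral norm of a matrix. -/
def specNorm {ι κ : Type} [Fintype ι] [Fintype κ] [DecidableEq κ]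
    (M : Matrix ι κ ℝ) : ℝ := ‖M‖

end

variable {ι : Type} [Fintype ι] [DecidableEq ι] {d : ℕ}

/-- Largest eigenvalue of `M Mᵀ`. -/
def lamMax (M : Matrix ι (Fin d) ℝ) : ℝ := sSup (spectrum ℝ (M * M.transpose))

/-- Smallest positive eigenvalue of `M Mᵀ`. -/
def lamMinPos (M : Matrix ι (Fin d) ℝ) : ℝ :=
  sInf {t | 0 < t ∧ t ∈ spectrum ℝ (M * M.transpose)}

/-- Condition number `κ(M)`. -/
def condNum (M : Matrix ι (Fin d) ℝ) : ℝ := √(lamMax M / lamMinPos M)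

end MatrixNotions

/-- Data of the problem `min f₀(x) + g(Ā x + b̄)` subject to `A x + b = 0`. -/
structure Problem (d m n : ℕ) where
  f0 : E d → ℝ
  g : E m → EReal
  Abar : Matrix (Fin m) (Fin d) ℝ
  bbar : E m
  A : Matrix (Fin n) (Fin d) ℝ
  b : E n

namespace Problem

variable {d m n : ℕ} (P : Problem d m n)

/-- Objective `F(x, y) = f₀(x) + g(y)` of the splitting problem. -/
def F (x : E d) (y : E m) : EReal := (P.f0 x : EReal) + P.g y

/-- Objective `F₀(x) = f₀(x) + g(Ā x + b̄)`. -/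
def F0 (x : E d) : EReal := P.F x (mv P.Abar x + P.bbar)

/-- The stacked matrix `H = [Ā; A]`. -/
def H : Matrix (Fin m ⊕ Fin n) (Fin d) ℝ := Matrix.fromRows P.Abar P.A

/-- `Hᵀ z = Āᵀ z₁ + Aᵀ z₂`. -/
def HT (z : Z m n) : E d := mv P.Abar.transpose z.fst + mv P.A.transpose z.snd

/-- Standing assumptions on the problem, with Lipschitz constants `Lf` and `lg`. -/
structure Standing (Lf lg : ℝ) : Prop where
  diff : Differentiable ℝ P.f0
  lip : ∀ x x', ‖gradient P.f0 x - gradient P.f0 x'‖ ≤ Lf * ‖x - x'‖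
  bddBelow : ⊥ < ⨅ x, P.F0 x
  proper : Proper P.g
  lsc : LowerSemicontinuous P.g
  convex : ConvexFun P.g
  rank : P.A.rank = n
  slater : ∃ x, mv P.A x + P.b = 0 ∧ mv P.Abar x + P.bbar ∈ intrinsicInterior ℝ (dom P.g)
  lg_pos : 0 < lg
  lipg : ∀ y ∈ dom P.g, ∀ y' ∈ dom P.g, |(P.g y).toReal - (P.g y').toReal| ≤ lg * ‖y - y'‖

/-- `g(y) = max { ⟨u, y⟩ : C u ≤ r }`. -/
def Polyhedral {p : ℕ} (C : Matrix (Fin p) (Fin m) ℝ) (r : E p) : Prop :=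
  ∀ y, P.g y = ⨆ u ∈ {u : E m | ∀ i, mv C u i ≤ r i}, ((⟪u, y⟫ : ℝ) : EReal)

/-- `ε`-KKT points; the distance to an empty set is `+∞`. -/
def IsKKT (ε : ℝ) (x : E d) : Prop :=
  ∃ γ : E n,
    Metric.infEDist (0 : E d)
      ((fun ξ => gradient P.f0 x + mv P.A.transpose γ + mv P.Abar.transpose ξ) ''
        subdiff P.g (mv P.Abar x + P.bbar)) ≤ ENNReal.ofReal ε ∧
    ‖mv P.A x + P.b‖ ≤ ε

/-- `(δ, ε)`-KKT points: points that are `δ`-close to an `ε`-KKT point. -/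
def IsNearKKT (δ ε : ℝ) (x : E d) : Prop := ∃ x', P.IsKKT ε x' ∧ ‖x - x'‖ ≤ δ

/-- The shift `∇f₀(x) - τ x` in the dual objective of the subproblem at `x`. -/
def shift (τ : ℝ) (x : E d) : E d := gradient P.f0 x - τ • x

/-- Negative Lagrangian dual function of the proximal subproblem at `x`. -/
def D (τ : ℝ) (x : E d) (z : Z m n) : EReal :=
  ((1 / (2 * τ) * ‖P.HT z + P.shift τ x‖ ^ 2 : ℝ) : EReal) + conj P.g z.fst
    + ((- ⟪z.fst, P.bbar⟫ - ⟪z.snd, P.b⟫ : ℝ) : EReal)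

/-- Solution set of the dual problem at `x`. -/
def Omega (τ : ℝ) (x : E d) : Set (Z m n) := {z | ∀ z', P.D τ x z ≤ P.D τ x z'}

/-- Dual optimality gap of `z`. -/
def gap (τ : ℝ) (x : E d) (z : Z m n) : ℝ :=
  (P.D τ x z).toReal - (⨅ z', P.D τ x z').toReal

/-- The common value of `Hᵀ z + ∇f₀(x) - τ x` over all dual solutions `z`. -/
def nu (τ : ℝ) (x : E d) : E d :=
  Classical.epsilon fun ν => ∀ z ∈ P.Omega τ x, P.HT z + P.shift τ x = ν

/-- Lipschitz constant of the gradient of the smooth part of the dual objective. -/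
def LD (τ : ℝ) : ℝ := lamMax P.H / τ

/-- Iterate, auxiliary iterate, and momentum parameter of the inner method. -/
structure ApgState (m n : ℕ) where
  z : Z m n
  zh : Z m n
  α : ℝ

/-- One accelerated proximal gradient (APG) step on the dual problem at `x`. -/
def apgStep (τ : ℝ) (x : E d) (s : ApgState m n) : ApgState m n :=
  let G1 := (1 / τ) • mv P.Abar (P.HT s.zh + P.shift τ x) - P.bbar
  let G2 := (1 / τ) • mv P.A (P.HT s.zh + P.shift τ x) - P.b
  let z' : Z m n := WithLp.toLp 2
    (prox (P.LD τ)⁻¹ (conj P.g) (s.zh.fst - (1 / P.LD τ) • G1), s.zh.snd - (1 / P.LD τ) • G2)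
  let α' := (1 + √(1 + 4 * s.α ^ 2)) / 2
  ⟨z', z' + ((s.α - 1) / α') • (z' - s.z), α'⟩

/-- `j` APG steps, freshly started at `z`. -/
def apgRun (τ : ℝ) (x : E d) (j : ℕ) (z : Z m n) : Z m n :=
  ((P.apgStep τ x)^[j] ⟨z, z, 1⟩).z

/-- Restarted APG: `i` rounds of `j` APG steps each, hence `i * j` APG steps. -/
def restartedAPG (τ : ℝ) (x : E d) (i j : ℕ) (z : Z m n) : Z m n :=
  (P.apgRun τ x j)^[i] z

/-- `θ` is a Hoffman constant of the systems `Hᵀ z = r`, `C z₁ ≤ t`: it bounds the distance to the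
solution set by the residual, for all right-hand sides with a solution. -/
def IsHoffmanSmall {p : ℕ} (C : Matrix (Fin p) (Fin m) ℝ) (θ : ℝ) : Prop :=
  ∀ (r : E d) (t : E p),
    let S : Set (Z m n) := {z | P.HT z = r ∧ ∀ i, mv C z.fst i ≤ t i}
    S.Nonempty → ∀ z, Metric.infDist z S ≤
      θ * √(‖P.HT z - r‖ ^ 2 + ∑ i, max (mv C z.fst i - t i) 0 ^ 2)

/-- `θ` is a Hoffman constant of the systems
`Hᵀ z = r`, `-⟨z₁, b̄⟩ - ⟨z₂, b⟩ = q`, `C z₁ ≤ t`. -/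
def IsHoffman {p : ℕ} (C : Matrix (Fin p) (Fin m) ℝ) (θ : ℝ) : Prop :=
  ∀ (r : E d) (q : ℝ) (t : E p),
    let S : Set (Z m n) :=
      {z | P.HT z = r ∧ - ⟪z.fst, P.bbar⟫ - ⟪z.snd, P.b⟫ = q ∧ ∀ i, mv C z.fst i ≤ t i}
    S.Nonempty → ∀ z, Metric.infDist z S ≤
      θ * √(‖P.HT z - r‖ ^ 2 + (- ⟪z.fst, P.bbar⟫ - ⟪z.snd, P.b⟫ - q) ^ 2
        + ∑ i, max (mv C z.fst i - t i) 0 ^ 2)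

end Problem

/-- A problem together with the input of the method: Lipschitz constants, the parameter `σ`,
the initial point `x⁰` (with `y⁰ = Ā x⁰ + b̄`) and the initial dual point of the inner solver. -/
structure Input (d m n : ℕ) extends Problem d m n where
  Lf : ℝ
  lg : ℝ
  σ : ℝ
  x0 : E d
  zini : Z m n

namespace Input

variable {d m n : ℕ} (I : Input d m n)

/-- `y⁰ = Ā x⁰ + b̄`. -/
def y0 : E m := mv I.Abar I.x0 + I.bbar

/-- Assumptions on the problem, and admissibility of the input. -/
structure Valid : Prop where
  standing : I.Standing I.Lf I.lg
  σ_pos : 0 < I.σ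
  feasible : mv I.A I.x0 + I.b = 0
  finite : I.F0 I.x0 ≠ ⊤
  zini_dom : I.zini.fst ∈ dom (conj I.g)

/-- The proximal parameter `τ = 2 L_f`. -/
def τ : ℝ := 2 * I.Lf

/-- `Δ = F₀(x⁰) - inf F₀`. -/
def Δ : ℝ := (I.F0 I.x0).toReal - (⨅ x, I.F0 x).toReal

def B1 : ℝ :=
  1 / I.τ * specNorm I.Abar * specNorm I.H + I.σ⁻¹
    + 1 / I.τ * (specNorm I.Abar + specNorm I.A) * specNorm I.H

/-- `‖(A Aᵀ)⁻¹ A‖`. -/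
def pinvNorm : ℝ := specNorm ((I.A * I.A.transpose)⁻¹ * I.A)

def B2 : ℝ := 1 + I.pinvNorm * specNorm I.H

def B3 (x : E d) : ℝ := I.pinvNorm * (‖gradient I.f0 x‖ + specNorm I.Abar * I.lg)

def B4 (x : E d) : ℝ :=
  1 / I.τ * (‖gradient I.f0 x‖ + specNorm I.H * (I.lg + I.B3 x))

/-- The tolerance `μ̄_k`; it depends on `k` through the current iterate `x = x^k` only. -/
def muBar (ε δ : ℝ) (x : E d) : ℝ :=
  min (ε ^ 2 / (480 * I.B1 * I.lg * I.Lf)) <|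
  min (I.τ * δ / specNorm I.H) <|
  min (ε / (6 * specNorm I.H)) <|
  min (ε / (I.B1 * I.σ)) <|
  min (ε / I.B1) <|
  min (ε ^ 2 / (12 * I.Lf * I.B1 * (I.B3 x + I.σ * specNorm I.Abar * I.B4 x + I.lg)))
    (√(ε ^ 2 / (12 * I.Lf * I.B1 * I.B2 *
      (1 + 1 / I.τ * I.σ * specNorm I.Abar * specNorm I.H))))

/-- The parameters in outer iteration `k` as functions of `k` and `x^k`: tolerance `μ_k`, number
`i_k` of rounds and number `j_k` of APG steps in each round of the inner method. -/
structure Schedule (d : ℕ) where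
  μ : ℕ → E d → ℝ
  rounds : ℕ → E d → ℕ
  steps : ℕ → E d → ℕ

/-- State of the outer method. -/
structure State (d m n : ℕ) where
  x : E d
  y : E m
  z : Z m n

/-- The iterates `(x^k, y^k, z^k)` of PG-RPD with restarted APG as inner solver. (The entry `z^0`
is not used.) -/
def iter (S : Schedule d) : ℕ → State d m n
  | 0 => ⟨I.x0, I.y0, I.zini⟩
  | k + 1 =>
    let x := (iter S k).x
    let z := I.restartedAPG I.τ x (S.rounds k x) (S.steps k x) I.zini
    let x' := x - (1 / I.τ) • (I.HT z + gradient I.f0 x)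
    ⟨x', prox I.σ⁻¹ I.g (I.σ⁻¹ • z.fst + mv I.Abar x' + I.bbar), z⟩

/-- Number of outer iterations, `⌈120 L_f Δ ε⁻²⌉`. -/
def outer (ε : ℝ) : ℕ := ⌈120 * I.Lf * I.Δ / ε ^ 2⌉₊

/-- Total number of APG steps in all outer iterations. -/
def total (S : Schedule d) (ε : ℝ) : ℕ :=
  ∑ k ∈ Finset.range (I.outer ε), S.rounds k (I.iter S k).x * S.steps k (I.iter S k).x

/-- Number of rounds `⌈log₂(2 (D_k(z) - D_k*) / (ρ μ²))⌉` for a growth modulus `ρ` and a tolerance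
`μ`, where `z` is the initial dual point. -/
def roundsFor (ρ μ : ℝ) (x : E d) : ℕ :=
  ⌈Real.logb 2 (2 * I.gap I.τ x I.zini / (ρ * μ ^ 2))⌉₊

/-- The schedule when `[Ā; A]` has full row rank. -/
def schedFull (ε δ : ℝ) : Schedule d where
  μ _ x := I.muBar ε δ x
  rounds _ x := I.roundsFor (lamMinPos I.H / I.τ) (I.muBar ε δ x) x
  steps _ _ := ⌈2 * √2 * condNum I.H⌉₊

open Classical in
/-- Quadratic growth modulus of the dual objective for polyhedral `g`. -/
def rho (θ : ℝ) (x : E d) : ℝ :=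
  if I.bbar = 0 ∧ I.b = 0 then (θ ^ 2 * I.τ)⁻¹
  else (θ ^ 2 * (I.τ + I.gap I.τ x I.zini + 2 * I.τ * ‖(1 / I.τ) • I.nu I.τ x‖ ^ 2))⁻¹

/-- The schedule for polyhedral `g`, with Hoffman constant `θ` and tolerance
`μ_k = w_k μ̄_k`. -/
def schedPoly (θ : ℝ) (w : ℕ → ℝ) (ε δ : ℝ) : Schedule d where
  μ k x := w k * I.muBar ε δ x
  rounds k x := I.roundsFor (I.rho θ x) (w k * I.muBar ε δ x) x
  steps _ x := ⌈2 * √(2 * I.LD I.τ / I.rho θ x)⌉₊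

/-- The admissible accuracies `0 < ε < min {√(3 L_f), 1}`. -/
def Adm (ε : ℝ) : Prop := 0 < ε ∧ ε < min (√(3 * I.Lf)) 1

/-- The method finds a `(δ, ε)`-KKT point: every inner call meets the required inexactness
criterion, and the iterate following the shortest of the first `outer ε` steps is a `(δ, ε)`-KKT
point (`x⁰` itself if no iteration is required). -/
def Finds (S : Schedule d) (ε δ : ℝ) : Prop :=
  (∀ k, (I.iter S (k + 1)).z.fst ∈ dom (conj I.g) ∧
    Metric.infEDist (I.iter S (k + 1)).z (I.Omega I.τ (I.iter S k).x)
      ≤ ENNReal.ofReal (S.μ k (I.iter S k).x)) ∧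
  (I.outer ε = 0 → I.IsNearKKT δ ε I.x0) ∧
  (∀ k' < I.outer ε,
    (∀ k < I.outer ε, ‖(I.iter S (k' + 1)).x - (I.iter S k').x‖
      ≤ ‖(I.iter S (k + 1)).x - (I.iter S k).x‖) →
    I.IsNearKKT δ ε (I.iter S (k' + 1)).x)

/-- The bound `N(ε, δ) = O(c · log (B / (δ ε)) · L_f Δ / ε²)`: the multiplicative constant `C` is
given from outside, and lower-order terms in the logarithm may depend on the input but not on
`ε` and `δ`. The second part is the bound itself for all small `ε`, the first one is a version for
all admissible `ε`. -/
def Complexity (C c B : ℝ) (N : ℝ → ℝ → ℕ) : Prop :=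
  (∃ M : ℝ, ∀ ε δ, I.Adm ε → 0 < δ →
    (N ε δ : ℝ) ≤ C * c * (Real.log (B / (min δ 1 * ε)) + M) * ⌈I.Lf * I.Δ / ε ^ 2⌉₊) ∧
  (∃ ε₀ : ℝ, 0 < ε₀ ∧ ∀ ε δ, I.Adm ε → ε < ε₀ → 0 < δ →
    (N ε δ : ℝ) ≤ C * c * Real.log (B / (min δ 1 * ε)) * (I.Lf * I.Δ / ε ^ 2))

end Input

end PGRPD

end

open PGRPD

/-! Outer loop. A minimizer `zs` of the dual objective at `x` yields the exact solution `primal τ x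
zs` of the linearized proximal subproblem: stationarity in the free block makes it feasible, and
stationarity in the first block, with Fenchel–Moreau, makes `zs.fst` a subgradient of `g` there.
Hence it is a KKT point with residual at most `3 L_f` times its distance to `x` (`primal_isKKT`).
Comparing each exact point with the previous exact point, which is feasible while the computed
iterate need not be, gives descent up to the inner errors (`obj_primal_le`). Telescoped, this bounds
the sum of the squared exact steps by `Δ` plus the accumulated errors. Since a dual error `μ`
displaces the primal point by at most `‖H‖ μ / τ`, some exact step among `120 L_f Δ / ε²` is short
enough, and the shortest computed step finds one (`InnerAccurate.finds`).

Inner loop. Everything rests on quadratic growth of the dual objective on the level set of the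
starting point (`Growth`). The smooth part controls only `‖Hᵀ(z - zs)‖²`. With full row rank of `H`
this controls `z - zs` itself. For polyhedral `g` the conjugate vanishes on a polyhedron and is
infinite elsewhere, so the dual solutions contain all points of that polyhedron with the optimal
values of `Hᵀz` and of the linear term; a Hoffman bound then gives growth (`Polyhedral.growth`). The
FISTA estimate of order `L_𝒟 / j²` combined with growth halves the gap in each round, and growth
once more turns a small gap into a small distance.

Counting. The steps per round are at most `4 Q`, where `Q` bounds `√(L_𝒟 / ρ)`; the rounding is
absorbed by `ρ ≤ L_𝒟` (`Growth.le_LD`). The number of rounds is logarithmic provided its argument is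
polynomial in `1 / (δ₁ ε)`. This needs no compactness: each outer step has bounded length and there
are `O(ε⁻²)` of them, so iterates, gradients, initial gaps and inverse tolerances all grow
polynomially. Compactness in (c) only serves to bound `Q` uniformly: the weights `1 / (k + 1)²` make
the accumulated error at most `1`, which keeps the exact points in the compact level set.

If `L_f ≤ 0` there is no admissible `ε`, so that case is vacuous throughout. -/

namespace PGRPD

/-! ### Conjugates, their proximal points, and biconjugation -/

section Convex

variable {m : ℕ} {h : E m → EReal}

theorem Proper.coe_toReal (hp : Proper h) {y : E m} (hy : y ∈ dom h) :
    ((h y).toReal : EReal) = h y :=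
  EReal.coe_toReal hy (hp.1 y)

theorem conj_ne_bot (hp : Proper h) (u : E m) : conj h u ≠ ⊥ := by
  obtain ⟨y, hy⟩ := hp.2
  have h1 : ((⟪u, y⟫ : ℝ) : EReal) - h y ≤ conj h u :=
    le_iSup (fun y => ((⟪u, y⟫ : ℝ) : EReal) - h y) y
  rw [← hp.coe_toReal hy, ← EReal.coe_sub] at h1
  exact ((EReal.bot_lt_coe _).trans_le h1).ne'

theorem conj_le_coe_iff (hp : Proper h) (u : E m) (c : ℝ) :
    conj h u ≤ (c : EReal) ↔ ∀ y ∈ dom h, ⟪u, y⟫ - (h y).toReal ≤ c := by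
  unfold conj
  rw [iSup_le_iff]
  refine forall_congr' fun y => ?_
  by_cases hy : h y = ⊤
  · simp [dom, hy]
  · have hy' : y ∈ dom h := hy
    rw [← hp.coe_toReal hy', ← EReal.coe_sub, EReal.coe_le_coe_iff]
    simp [hy']

theorem coe_conj_toReal (hp : Proper h) {u : E m} (hu : u ∈ dom (conj h)) :
    ((conj h u).toReal : EReal) = conj h u :=
  EReal.coe_toReal hu (conj_ne_bot hp u)

theorem mem_dom_of_conj_le {u : E m} {c : ℝ} (hc : conj h u ≤ (c : EReal)) :
    u ∈ dom (conj h) :=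
  (hc.trans_lt (EReal.coe_lt_top c)).ne

theorem conj_toReal_le (hp : Proper h) {u : E m} {c : ℝ} (hc : conj h u ≤ (c : EReal)) :
    (conj h u).toReal ≤ c := by
  rwa [← EReal.coe_le_coe_iff, coe_conj_toReal hp (mem_dom_of_conj_le hc)]

/-- The Fenchel–Young inequality. -/
theorem inner_sub_le_conj (hp : Proper h) {u y : E m} (hu : u ∈ dom (conj h)) (hy : y ∈ dom h) :
    ⟪u, y⟫ - (h y).toReal ≤ (conj h u).toReal :=
  (conj_le_coe_iff hp u _).1 (coe_conj_toReal hp hu).ge y hy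

theorem conj_segment_le (hp : Proper h) {u v : E m} (hu : u ∈ dom (conj h))
    (hv : v ∈ dom (conj h)) {t : ℝ} (h0 : 0 ≤ t) (h1 : t ≤ 1) :
    conj h (u + t • (v - u)) ≤
      (((1 - t) * (conj h u).toReal + t * (conj h v).toReal : ℝ) : EReal) := by
  rw [conj_le_coe_iff hp]
  intro y hy
  have e1 := inner_sub_le_conj hp hu hy
  have e2 := inner_sub_le_conj hp hv hy
  rw [inner_add_left, real_inner_smul_left, inner_sub_left]
  nlinarith [mul_le_mul_of_nonneg_left e1 (sub_nonneg.2 h1), mul_le_mul_of_nonneg_left e2 h0]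

theorem nonneg_of_forall_le {a c : ℝ} (H : ∀ t : ℝ, 0 < t → t ≤ 1 → 0 ≤ t * a + t ^ 2 * c) :
    0 ≤ a := by
  by_contra ha
  push Not at ha
  have hc : 0 < |c| + 1 := by positivity
  -- A step so short that the quadratic term is at most half of the supposedly negative linear term.
  set t := min 1 (-a / (2 * (|c| + 1))) with ht
  have h0 : 0 < t := lt_min one_pos (div_pos (neg_pos.2 ha) (by positivity))
  have h2 : t * (2 * (|c| + 1)) ≤ -a := by
    rw [← le_div_iff₀ (by positivity)]; exact min_le_right _ _
  have h3 := H t h0 (min_le_left _ _)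
  have h4 : t * c ≤ t * |c| := mul_le_mul_of_nonneg_left (le_abs_self c) h0.le
  have h5 : 0 ≤ a + t * c := by
    by_contra hh
    push Not at hh
    nlinarith [mul_neg_of_pos_of_neg h0 hh]
  nlinarith

/-- First-order optimality for the sum of a conjugate and a quadratic, along a segment. -/
theorem conj_variational (hp : Proper h) {u v : E m} (hu : u ∈ dom (conj h))
    (hv : v ∈ dom (conj h)) {q : ℝ → ℝ} {a c : ℝ} (hq : ∀ t, q t = q 0 + t * a + t ^ 2 * c)
    (hmin : ∀ t, conj h u + (q 0 : EReal) ≤ conj h (u + t • (v - u)) + (q t : EReal)) :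
    0 ≤ a + ((conj h v).toReal - (conj h u).toReal) := by
  refine nonneg_of_forall_le (c := c) fun t h0 h1 => ?_
  have e := (hmin t).trans (add_le_add_left (conj_segment_le hp hu hv h0.le h1) _)
  rw [← coe_conj_toReal hp hu, ← EReal.coe_add, ← EReal.coe_add, EReal.coe_le_coe_iff, hq t,
    EReal.toReal_coe] at e
  linarith

/-- Each real sublevel set is an intersection, over `y ∈ dom h`, of closed sets cut out by
continuous inequalities; the sublevel set at `⊥` is empty because a conjugate of a proper function
is never `⊥`. -/
theorem lowerSemicontinuous_conj_add {X : Type*} [TopologicalSpace X] (hp : Proper h)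
    {T : X → E m} (hT : Continuous T) {ψ : X → ℝ} (hψ : Continuous ψ) :
    LowerSemicontinuous fun z => conj h (T z) + (ψ z : EReal) := by
  rw [lowerSemicontinuous_iff_isClosed_preimage]
  intro c
  induction c with
  | top => simp
  | bot =>
    convert isClosed_empty
    ext z
    simp only [Set.mem_preimage, Set.mem_Iic, le_bot_iff, Set.mem_empty_iff_false, iff_false]
    simp [EReal.add_eq_bot_iff, conj_ne_bot hp]
  | coe c =>
    have : (fun z => conj h (T z) + (ψ z : EReal)) ⁻¹' Set.Iic (c : EReal)
        = ⋂ y ∈ dom h, {z | ⟪T z, y⟫ - (h y).toReal ≤ c - ψ z} := by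
      ext z
      simp only [Set.mem_preimage, Set.mem_Iic, Set.mem_iInter, Set.mem_ofPred_eq]
      rw [← conj_le_coe_iff hp, EReal.coe_sub, EReal.le_sub_iff_add_le] <;> simp
    rw [this]
    exact isClosed_biInter fun y _ => isClosed_le (by fun_prop) (by fun_prop)

/-- Coercivity is replaced by a weaker condition: every competitor no worse than `z₀` may be
exchanged for one in a fixed ball without increasing the value. This form is needed because dual
level sets can be unbounded when `H` lacks full row rank. -/
theorem exists_minimizer {X : Type*} [NormedAddCommGroup X] [ProperSpace X] (hp : Proper h)
    {T : X → E m} (hT : Continuous T) {ψ : X → ℝ} (hψ : Continuous ψ) (z₀ : X) (R : ℝ)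
    (hR : ∀ z, conj h (T z) + (ψ z : EReal) ≤ conj h (T z₀) + (ψ z₀ : EReal) →
      ∃ z', conj h (T z') + (ψ z' : EReal) ≤ conj h (T z) + (ψ z : EReal) ∧ ‖z'‖ ≤ R) :
    ∃ z, ∀ z', conj h (T z) + (ψ z : EReal) ≤ conj h (T z') + (ψ z' : EReal) := by
  obtain ⟨w, _, hw⟩ := hR z₀ le_rfl
  obtain ⟨z, -, hz⟩ := LowerSemicontinuousOn.exists_isMinOn
    (s := Metric.closedBall (0 : X) R) ⟨w, by simpa using hw⟩ (isCompact_closedBall 0 R)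
    ((lowerSemicontinuous_conj_add hp hT hψ).lowerSemicontinuousOn _)
  have key : ∀ z', conj h (T z') + (ψ z' : EReal) ≤ conj h (T z₀) + (ψ z₀ : EReal) →
      conj h (T z) + (ψ z : EReal) ≤ conj h (T z') + (ψ z' : EReal) := fun z' hz' => by
    obtain ⟨v, h1, h2⟩ := hR z' hz'
    exact (hz (show v ∈ Metric.closedBall (0 : X) R by simpa using h2)).trans h1
  refine ⟨z, fun z' => ?_⟩
  rcases le_total (conj h (T z') + (ψ z' : EReal)) (conj h (T z₀) + (ψ z₀ : EReal)) with hh | hh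
  · exact key z' hh
  · exact (key z₀ le_rfl).trans hh

theorem exists_prox_conj (hp : Proper h) {v : E m} (hv : v ∈ dom (conj h)) {η : ℝ} (hη : 0 < η)
    (y : E m) : ∃ p, ∀ p', conj h p + ((‖p - y‖ ^ 2 / (2 * η) : ℝ) : EReal)
      ≤ conj h p' + ((‖p' - y‖ ^ 2 / (2 * η) : ℝ) : EReal) := by
  obtain ⟨y₀, hy₀⟩ := hp.2
  set c := (conj h v).toReal + ‖v - y‖ ^ 2 / (2 * η) with hc
  -- Any `y₀ ∈ dom h` gives the conjugate an affine minorant, so on a sublevel set `‖z - y‖²` is at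
  -- most linear in `‖z - y‖` plus this constant, which bounds `z`.
  set K := 2 * η * (c + (h y₀).toReal + ‖y‖ * ‖y₀‖) with hK
  refine exists_minimizer hp continuous_id (ψ := fun p => ‖p - y‖ ^ 2 / (2 * η)) (by fun_prop) v
    (‖y‖ + (2 * η * ‖y₀‖ + |K| + 1)) fun z hz => ⟨z, le_rfl, ?_⟩
  simp only [id] at hz
  rw [← coe_conj_toReal hp hv, ← EReal.coe_add, ← hc] at hz
  have hzd : conj h z ≤ ((c - ‖z - y‖ ^ 2 / (2 * η) : ℝ) : EReal) := by
    rw [EReal.coe_sub, EReal.le_sub_iff_add_le] <;> simp [hz]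
  have h1 := (conj_le_coe_iff hp z _).1 hzd y₀ hy₀
  have h2 : -(‖z - y‖ * ‖y₀‖ + ‖y‖ * ‖y₀‖) ≤ ⟪z, y₀⟫ := by
    have := abs_le.1 (abs_real_inner_le_norm z y₀)
    have h3 : ‖z‖ ≤ ‖z - y‖ + ‖y‖ := by simpa using norm_add_le (z - y) y
    nlinarith [norm_nonneg y₀]
  have h4 : ‖z - y‖ ^ 2 ≤ 2 * η * ‖y₀‖ * ‖z - y‖ + K := by
    have : ‖z - y‖ ^ 2 / (2 * η) ≤ c + (h y₀).toReal + ‖y‖ * ‖y₀‖ + ‖z - y‖ * ‖y₀‖ := by linarith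
    rw [div_le_iff₀ (by positivity)] at this
    rw [hK]; linarith
  have h5 : ‖z - y‖ ≤ 2 * η * ‖y₀‖ + |K| + 1 := by
    by_contra hcon
    push Not at hcon
    have hb : 0 ≤ 2 * η * ‖y₀‖ := by positivity
    nlinarith [le_abs_self K, abs_nonneg K, norm_nonneg (z - y)]
  have h6 : ‖z‖ ≤ ‖z - y‖ + ‖y‖ := by simpa using norm_add_le (z - y) y
  linarith

theorem prox_conj_spec (hp : Proper h) {v : E m} (hv : v ∈ dom (conj h)) {η : ℝ} (hη : 0 < η)
    (y p' : E m) : conj h (prox η (conj h) y) + ((‖prox η (conj h) y - y‖ ^ 2 / (2 * η) : ℝ) : EReal)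
      ≤ conj h p' + ((‖p' - y‖ ^ 2 / (2 * η) : ℝ) : EReal) :=
  Classical.epsilon_spec (exists_prox_conj hp hv hη y) p'

theorem prox_conj_mem_dom (hp : Proper h) {v : E m} (hv : v ∈ dom (conj h)) {η : ℝ} (hη : 0 < η)
    (y : E m) : prox η (conj h) y ∈ dom (conj h) := by
  intro htop
  have := prox_conj_spec hp hv hη y v
  rw [← coe_conj_toReal hp hv, ← EReal.coe_add] at this
  rw [htop, EReal.top_add_coe] at this
  exact (EReal.coe_lt_top _).not_ge this

theorem prox_conj_variational (hp : Proper h) {v : E m} (hv : v ∈ dom (conj h)) {η : ℝ}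
    (hη : 0 < η) (y : E m) :
    0 ≤ ⟪prox η (conj h) y - y, v - prox η (conj h) y⟫ / η
      + ((conj h v).toReal - (conj h (prox η (conj h) y)).toReal) := by
  set p := prox η (conj h) y with hpdef
  refine conj_variational hp (prox_conj_mem_dom hp hv hη y) hv
    (q := fun t => ‖p + t • (v - p) - y‖ ^ 2 / (2 * η)) (c := ‖v - p‖ ^ 2 / (2 * η))
    (fun t => ?_) fun t => ?_
  · have : p + t • (v - p) - y = (p - y) + t • (v - p) := by abel
    simp only [this, norm_add_sq_real, norm_smul, real_inner_smul_right, mul_pow, zero_smul,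
      add_zero, Real.norm_eq_abs, sq_abs]
    field_simp
  · simpa using prox_conj_spec hp hv hη y (p + t • (v - p))

/-- The nontrivial half of the Fenchel–Moreau theorem. -/
theorem le_of_conj_bound (hp : Proper h) (hl : LowerSemicontinuous h) (hc : ConvexFun h)
    {v₀ : E m} (hv₀ : v₀ ∈ dom (conj h)) {y : E m} {c : ℝ}
    (H : ∀ u ∈ dom (conj h), ⟪u, y⟫ - (conj h u).toReal ≤ c) : h y ≤ (c : EReal) := by
  by_contra hcon
  have hclosed : IsClosed {p : E m × ℝ | h p.1 ≤ (p.2 : EReal)} :=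
    hl.isClosed_epigraph.preimage (f := fun p : E m × ℝ => (p.1, (p.2 : EReal)))
      (continuous_fst.prodMk (continuous_coe_real_ereal.comp continuous_snd))
  obtain ⟨f, s, hf1, hf2⟩ := geometric_hahn_banach_point_closed (x := (y, c)) hc hclosed hcon
  set w := (InnerProductSpace.toDual ℝ (E m)).symm
    (f.comp (ContinuousLinearMap.inl ℝ (E m) ℝ)) with hw
  set β := f (0, 1) with hβ
  have hf : ∀ a r, f (a, r) = ⟪w, a⟫ + β * r := fun a r => by
    have h1 : ⟪w, a⟫ = f (a, 0) := by
      rw [hw, InnerProductSpace.toDual_symm_apply]; simp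
    have h2 : (a, r) = (a, 0) + r • ((0, 1) : E m × ℝ) := by simp
    rw [h1, h2, map_add, map_smul, hβ, smul_eq_mul, mul_comm]
  have hepi : ∀ a ∈ dom h, ∀ r, (h a).toReal ≤ r → s < ⟪w, a⟫ + β * r := fun a ha r hr => by
    rw [← hf]
    refine hf2 _ ?_
    simp only [Set.mem_ofPred_eq]
    rw [← hp.coe_toReal ha]
    exact_mod_cast hr
  rw [hf] at hf1
  obtain ⟨a₀, ha₀⟩ := hp.2
  have hβ0 : 0 ≤ β := by
    by_contra hneg
    push Not at hneg
    have := hepi a₀ ha₀ (max (h a₀).toReal ((s - ⟪w, a₀⟫) / β)) (le_max_left _ _)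
    have h2 : β * max (h a₀).toReal ((s - ⟪w, a₀⟫) / β) ≤ β * ((s - ⟪w, a₀⟫) / β) :=
      mul_le_mul_of_nonpos_left (le_max_right _ _) hneg.le
    rw [mul_div_cancel₀ _ hneg.ne] at h2
    linarith
  -- If the separating hyperplane is vertical, moving `v₀` far along `-w` violates the assumed bound
  -- at `y`. Otherwise rescaling the hyperplane gives an affine minorant of `h` that exceeds `c` at
  -- `y`, again contradicting that bound.
  rcases hβ0.eq_or_lt with h0 | hpos
  · rw [← h0] at hf1 hepi
    have hgap : 0 < s - ⟪w, y⟫ := by linarith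
    obtain ⟨t, ht0, ht⟩ : ∃ t : ℝ, 0 ≤ t ∧
        c - ⟪v₀, y⟫ + (conj h v₀).toReal < t * (s - ⟪w, y⟫) := by
      refine ⟨(|c - ⟪v₀, y⟫ + (conj h v₀).toReal| + 1) / (s - ⟪w, y⟫), by positivity, ?_⟩
      rw [div_mul_cancel₀ _ hgap.ne']
      linarith [le_abs_self (c - ⟪v₀, y⟫ + (conj h v₀).toReal)]
    have hle : conj h (v₀ - t • w) ≤ (((conj h v₀).toReal - t * s : ℝ) : EReal) := by
      rw [conj_le_coe_iff hp]
      intro a ha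
      have e1 := inner_sub_le_conj hp hv₀ ha
      have e2 := hepi a ha _ le_rfl
      rw [inner_sub_left, real_inner_smul_left]
      nlinarith
    have e3 := H _ (mem_dom_of_conj_le hle)
    have e4 := conj_toReal_le hp hle
    rw [inner_sub_left, real_inner_smul_left] at e3
    nlinarith
  · have hle : conj h (-(β⁻¹ • w)) ≤ ((-(β⁻¹ * s) : ℝ) : EReal) := by
      rw [conj_le_coe_iff hp]
      intro a ha
      have e2 := mul_lt_mul_of_pos_left (hepi a ha _ le_rfl) (inv_pos.2 hpos)
      rw [mul_add, inv_mul_cancel_left₀ hpos.ne'] at e2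
      rw [inner_neg_left, real_inner_smul_left]
      linarith
    have e3 := H _ (mem_dom_of_conj_le hle)
    have e4 := conj_toReal_le hp hle
    have e5 := mul_lt_mul_of_pos_left hf1 (inv_pos.2 hpos)
    rw [mul_add, inv_mul_cancel_left₀ hpos.ne'] at e5
    rw [inner_neg_left, real_inner_smul_left] at e3
    linarith

end Convex

/-- The descent lemma for functions with Lipschitz gradient. -/
theorem descent_lemma {d : ℕ} {f : E d → ℝ} {L : ℝ} (hf : Differentiable ℝ f)
    (hL : ∀ x x', ‖gradient f x - gradient f x'‖ ≤ L * ‖x - x'‖) (x x' : E d) :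
    f x' ≤ f x + ⟪gradient f x, x' - x⟫ + L / 2 * ‖x' - x‖ ^ 2 := by
  set v := x' - x with hv
  have hd : ∀ t : ℝ, HasDerivAt (fun t : ℝ => f (x + t • v) - t * ⟪gradient f x, v⟫
      - L / 2 * ‖v‖ ^ 2 * t ^ 2)
      (⟪gradient f (x + t • v), v⟫ - ⟪gradient f x, v⟫ - L / 2 * ‖v‖ ^ 2 * (2 * t)) t := fun t => by
    have h1 : HasDerivAt (fun t : ℝ => x + t • v) v t := by
      simpa using ((hasDerivAt_id t).smul_const v).const_add x
    have h2 := ((hf (x + t • v)).hasGradientAt.hasFDerivAt).comp_hasDerivAt t h1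
    have h3 : HasDerivAt (fun t : ℝ => t * ⟪gradient f x, v⟫) ⟪gradient f x, v⟫ t := by
      simpa using (hasDerivAt_id t).mul_const ⟪gradient f x, v⟫
    have h4 : HasDerivAt (fun t : ℝ => L / 2 * ‖v‖ ^ 2 * t ^ 2) (L / 2 * ‖v‖ ^ 2 * (2 * t)) t := by
      simpa using (hasDerivAt_pow 2 t).const_mul (L / 2 * ‖v‖ ^ 2)
    have h5 := (h2.sub h3).sub h4
    rw [InnerProductSpace.toDual_apply_apply] at h5
    exact h5.congr_of_eventuallyEq (Filter.Eventually.of_forall fun _ => rfl)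
  -- Along the segment, the function minus its quadratic model has nonpositive derivative by the
  -- Lipschitz bound; comparing the endpoints gives the claim.
  have hanti : AntitoneOn (fun t : ℝ => f (x + t • v) - t * ⟪gradient f x, v⟫
      - L / 2 * ‖v‖ ^ 2 * t ^ 2) (Set.Icc 0 1) := by
    refine antitoneOn_of_deriv_nonpos (convex_Icc 0 1)
      (fun t _ => (hd t).continuousAt.continuousWithinAt)
      (fun t _ => (hd t).differentiableAt.differentiableWithinAt) fun t ht => ?_
    rw [interior_Icc] at ht
    rw [(hd t).deriv, ← inner_sub_left]
    have h1 := real_inner_le_norm (gradient f (x + t • v) - gradient f x) v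
    have h2 := hL (x + t • v) x
    rw [add_sub_cancel_left, norm_smul, Real.norm_eq_abs, abs_of_pos ht.1] at h2
    nlinarith [mul_le_mul_of_nonneg_right h2 (norm_nonneg v)]
  have := hanti (Set.left_mem_Icc.2 zero_le_one) (Set.right_mem_Icc.2 zero_le_one) zero_le_one
  simp only [one_smul, zero_smul, add_zero, one_mul, zero_mul] at this
  rw [hv, add_sub_cancel] at this
  rw [← hv] at this
  linarith

/-! ### Eigenvalue bounds for a matrix and its transpose -/

section Spectral

theorem isHermitian_mul_transpose {ι : Type} {d : ℕ} (M : Matrix ι (Fin d) ℝ) :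
    (M * M.transpose).IsHermitian := by
  simpa using Matrix.isHermitian_mul_conjTranspose_self M

variable {ι κ : Type} [Fintype ι] [Fintype κ] [DecidableEq κ]

theorem norm_toEuclideanLin_le (M : Matrix ι κ ℝ) (x : EuclideanSpace ℝ κ) :
    ‖Matrix.toEuclideanLin M x‖ ≤ specNorm M * ‖x‖ := by
  open scoped Matrix.Norms.L2Operator in
  exact Matrix.l2_opNorm_mulVec M x

theorem specNorm_nonneg (M : Matrix ι κ ℝ) : 0 ≤ specNorm M := by
  open scoped Matrix.Norms.L2Operator in
  exact norm_nonneg M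

variable [DecidableEq ι]

theorem inner_toEuclideanLin_transpose (M : Matrix ι κ ℝ) (u : EuclideanSpace ℝ ι)
    (x : EuclideanSpace ℝ κ) :
    ⟪Matrix.toEuclideanLin M.transpose u, x⟫ = ⟪u, Matrix.toEuclideanLin M x⟫ := by
  rw [← Matrix.conjTranspose_eq_transpose_of_trivial, Matrix.toEuclideanLin_conjTranspose_eq_adjoint,
    LinearMap.adjoint_inner_left]

theorem specNorm_transpose (M : Matrix ι κ ℝ) : specNorm M.transpose = specNorm M := by
  open scoped Matrix.Norms.L2Operator in
  rw [← Matrix.conjTranspose_eq_transpose_of_trivial]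
  exact Matrix.l2_opNorm_conjTranspose M

theorem eq_zero_of_transpose_of_rank {κ : Type} [Fintype κ] {M : Matrix ι κ ℝ} (hM : M.rank = Fintype.card ι)
    {v : EuclideanSpace ℝ ι} (hv : Matrix.toEuclideanLin M.transpose v = 0) : v = 0 := by
  have h1 : Function.Injective M.transpose.mulVecLin := by
    rw [← LinearMap.ker_eq_bot]
    have h2 := LinearMap.finrank_range_add_finrank_ker M.transpose.mulVecLin
    have h3 : Module.finrank ℝ (LinearMap.range M.transpose.mulVecLin) = Fintype.card ι := by
      rw [← hM, ← Matrix.rank_transpose]; rfl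
    rw [h3, Module.finrank_fintype_fun_eq_card] at h2
    exact Submodule.finrank_eq_zero.1 (by omega)
  have h4 : M.transpose.mulVecLin v.ofLp = M.transpose.mulVecLin 0 := by
    rw [map_zero]
    exact congrArg WithLp.ofLp hv
  exact WithLp.ofLp_injective 2 (h1 h4)

/-- `‖Mᵀv‖² = ⟨v, M Mᵀ v⟩`, expanded in an orthonormal eigenbasis of `M Mᵀ`. Both extreme-eigenvalue
bounds are read off this sum. -/
theorem norm_sq_transpose_eq_sum {d : ℕ} (M : Matrix ι (Fin d) ℝ) (v : EuclideanSpace ℝ ι) :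
    ‖Matrix.toEuclideanLin M.transpose v‖ ^ 2 = ∑ i,
      (isHermitian_mul_transpose M).eigenvalues i
        * ⟪v, (isHermitian_mul_transpose M).eigenvectorBasis i⟫ ^ 2 := by
  set hM := isHermitian_mul_transpose M
  have hmul : ∀ w : EuclideanSpace ℝ ι, Matrix.toEuclideanLin (M * M.transpose) w
      = Matrix.toEuclideanLin M (Matrix.toEuclideanLin M.transpose w) := fun w => by
    simp [Matrix.toLpLin_apply]
  have h1 : ‖Matrix.toEuclideanLin M.transpose v‖ ^ 2
      = ⟪v, Matrix.toEuclideanLin (M * M.transpose) v⟫ := by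
    rw [hmul, ← inner_toEuclideanLin_transpose, real_inner_self_eq_norm_sq]
  rw [h1, ← hM.eigenvectorBasis.sum_inner_mul_inner]
  refine Finset.sum_congr rfl fun i _ => ?_
  have h2 : Matrix.toEuclideanLin (M * M.transpose) (hM.eigenvectorBasis i)
      = hM.eigenvalues i • hM.eigenvectorBasis i := by
    have := hM.mulVec_eigenvectorBasis i
    exact WithLp.ofLp_injective 2 (by simpa using this)
  have h3 : ⟪hM.eigenvectorBasis i, Matrix.toEuclideanLin (M * M.transpose) v⟫
      = hM.eigenvalues i * ⟪v, hM.eigenvectorBasis i⟫ := by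
    rw [← inner_toEuclideanLin_transpose, Matrix.transpose_mul, Matrix.transpose_transpose, h2,
      real_inner_smul_left, real_inner_comm]
  rw [h3]; ring

theorem sum_inner_eigenvectorBasis_sq {d : ℕ} (M : Matrix ι (Fin d) ℝ) (v : EuclideanSpace ℝ ι) :
    ∑ i, ⟪v, (isHermitian_mul_transpose M).eigenvectorBasis i⟫ ^ 2 = ‖v‖ ^ 2 := by
  rw [← real_inner_self_eq_norm_sq,
    ← (isHermitian_mul_transpose M).eigenvectorBasis.sum_inner_mul_inner]
  exact Finset.sum_congr rfl fun i _ => by rw [sq, real_inner_comm v]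

theorem norm_sq_transpose_le_lamMax {d : ℕ} (M : Matrix ι (Fin d) ℝ) (v : EuclideanSpace ℝ ι) :
    ‖Matrix.toEuclideanLin M.transpose v‖ ^ 2 ≤ lamMax M * ‖v‖ ^ 2 := by
  rw [norm_sq_transpose_eq_sum, ← sum_inner_eigenvectorBasis_sq M, Finset.mul_sum]
  refine Finset.sum_le_sum fun i _ => mul_le_mul_of_nonneg_right ?_ (sq_nonneg _)
  unfold lamMax
  rw [(isHermitian_mul_transpose M).spectrum_real_eq_range_eigenvalues]
  exact le_csSup (Set.finite_range _).bddAbove ⟨i, rfl⟩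

/-- Full row rank makes `Mᵀ` injective, so all eigenvalues of `M Mᵀ` are positive and the smallest
positive one is the smallest one. A nonempty index type makes the infimum an attained eigenvalue. -/
theorem lamMinPos_full_rank {d : ℕ} [Nonempty ι] {M : Matrix ι (Fin d) ℝ}
    (hM : M.rank = Fintype.card ι) :
    0 < lamMinPos M ∧ ∀ v : EuclideanSpace ℝ ι,
      lamMinPos M * ‖v‖ ^ 2 ≤ ‖Matrix.toEuclideanLin M.transpose v‖ ^ 2 := by
  set hH := isHermitian_mul_transpose M with hHdef
  have hpos : ∀ i, 0 < hH.eigenvalues i := fun i => by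
    have h1 : Matrix.toEuclideanLin M.transpose (hH.eigenvectorBasis i) ≠ 0 := fun h =>
      hH.eigenvectorBasis.orthonormal.ne_zero i (eq_zero_of_transpose_of_rank hM h)
    have h2 := norm_sq_transpose_eq_sum M (hH.eigenvectorBasis i)
    rw [Finset.sum_eq_single i (fun j _ hj => by
      rw [hH.eigenvectorBasis.orthonormal.2 hj.symm]; simp) (by simp)] at h2
    rw [real_inner_self_eq_norm_sq, hH.eigenvectorBasis.orthonormal.1 i] at h2
    have h3 : 0 < ‖Matrix.toEuclideanLin M.transpose (hH.eigenvectorBasis i)‖ ^ 2 := by positivity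
    rw [h2] at h3
    simpa using h3
  have hset : {t | 0 < t ∧ t ∈ spectrum ℝ (M * M.transpose)} = Set.range hH.eigenvalues := by
    rw [hH.spectrum_real_eq_range_eigenvalues]
    ext t
    refine ⟨fun h => h.2, ?_⟩
    rintro ⟨i, rfl⟩
    exact ⟨hpos i, i, rfl⟩
  unfold lamMinPos
  rw [hset]
  constructor
  · obtain ⟨i, hi⟩ := (Set.range_nonempty hH.eigenvalues).csInf_mem (Set.finite_range _)
    exact hi ▸ hpos i
  · intro v
    rw [norm_sq_transpose_eq_sum, ← sum_inner_eigenvectorBasis_sq M, Finset.mul_sum]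
    exact Finset.sum_le_sum fun i _ => mul_le_mul_of_nonneg_right
      (csInf_le (Set.finite_range _).bddBelow ⟨i, rfl⟩) (sq_nonneg _)

end Spectral

section MV

variable {a c : ℕ} (M : Matrix (Fin a) (Fin c) ℝ)

theorem mv_add (x y : E c) : mv M (x + y) = mv M x + mv M y := map_add _ x y

theorem mv_sub (x y : E c) : mv M (x - y) = mv M x - mv M y := map_sub _ x y

theorem mv_smul (t : ℝ) (x : E c) : mv M (t • x) = t • mv M x := map_smul _ t x

theorem inner_mv_transpose (u : E a) (x : E c) : ⟪mv M.transpose u, x⟫ = ⟪u, mv M x⟫ :=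
  inner_toEuclideanLin_transpose M u x

end MV

/-! ### The stacked operator -/

namespace Problem

variable {d m n : ℕ} (P : Problem d m n)

/-- The vector `z = (z₁, z₂)` as a single stacked vector. -/
def stack (z : Z m n) : EuclideanSpace ℝ (Fin m ⊕ Fin n) :=
  WithLp.toLp 2 (Sum.elim z.fst z.snd)

theorem norm_sq_Z (z : Z m n) : ‖z‖ ^ 2 = ‖z.fst‖ ^ 2 + ‖z.snd‖ ^ 2 :=
  WithLp.prod_norm_sq_eq_of_L2 z

theorem norm_stack (z : Z m n) : ‖stack z‖ = ‖z‖ := by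
  rw [← sq_eq_sq₀ (norm_nonneg _) (norm_nonneg _), norm_sq_Z, EuclideanSpace.real_norm_sq_eq,
    EuclideanSpace.real_norm_sq_eq, EuclideanSpace.real_norm_sq_eq, Fintype.sum_sum_type]
  rfl

theorem HT_eq_stack (z : Z m n) : P.HT z = Matrix.toEuclideanLin P.H.transpose (stack z) := by
  apply WithLp.ofLp_injective 2
  simp only [HT, mv, H, stack, Matrix.transpose_fromRows, Matrix.toLpLin_apply, WithLp.ofLp_add,
    Matrix.fromCols_mulVec_sumElim]

theorem HT_add (z w : Z m n) : P.HT (z + w) = P.HT z + P.HT w := by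
  simp only [HT, WithLp.add_fst, WithLp.add_snd, mv_add]; abel

theorem HT_sub (z w : Z m n) : P.HT (z - w) = P.HT z - P.HT w := by
  simp only [HT, WithLp.sub_fst, WithLp.sub_snd, mv_sub]; abel

theorem HT_smul (t : ℝ) (z : Z m n) : P.HT (t • z) = t • P.HT z := by
  simp only [HT, WithLp.smul_fst, WithLp.smul_snd, mv_smul, smul_add]

theorem continuous_HT : Continuous P.HT := by
  unfold HT mv
  have h1 := (Matrix.toEuclideanLin P.Abar.transpose).continuous_of_finiteDimensional
  have h2 := (Matrix.toEuclideanLin P.A.transpose).continuous_of_finiteDimensional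
  exact (h1.comp (WithLp.continuous_fst 2 _ _)).add (h2.comp (WithLp.continuous_snd 2 _ _))

theorem inner_HT (z : Z m n) (x : E d) :
    ⟪P.HT z, x⟫ = ⟪z.fst, mv P.Abar x⟫ + ⟪z.snd, mv P.A x⟫ := by
  simp only [HT, inner_add_left, inner_mv_transpose]

theorem norm_HT_le (z : Z m n) : ‖P.HT z‖ ≤ specNorm P.H * ‖z‖ := by
  rw [HT_eq_stack, ← norm_stack z, ← specNorm_transpose]
  exact norm_toEuclideanLin_le _ _

theorem norm_sq_HT_le (z : Z m n) : ‖P.HT z‖ ^ 2 ≤ lamMax P.H * ‖z‖ ^ 2 := by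
  rw [HT_eq_stack, ← norm_stack z]
  exact norm_sq_transpose_le_lamMax _ _

/-- The source of all strict positivity: since `n > 0` and `A` has full row rank, `H` is nonzero,
and hence so are its norm, its largest eigenvalue and every Hoffman constant. -/
theorem exists_HT_ne_zero (hn : 0 < n) (hA : P.A.rank = n) :
    ∃ v : E n, mv P.A.transpose v ≠ 0 := by
  have : Nonempty (Fin n) := ⟨⟨0, hn⟩⟩
  obtain ⟨v, hv⟩ := exists_ne (0 : E n)
  exact ⟨v, fun h => hv (eq_zero_of_transpose_of_rank (by simpa using hA) h)⟩

/-- The dual vector `(0, v)`. -/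
def sndZ (v : E n) : Z m n := WithLp.toLp 2 (0, v)

@[simp] theorem sndZ_fst (v : E n) : (sndZ v : Z m n).fst = 0 := rfl

@[simp] theorem sndZ_snd (v : E n) : (sndZ v : Z m n).snd = v := rfl

theorem HT_sndZ (v : E n) : P.HT (sndZ v) = mv P.A.transpose v := by
  simp [HT, mv]

theorem lamMax_H_pos (hn : 0 < n) (hA : P.A.rank = n) : 0 < lamMax P.H := by
  obtain ⟨v, hv⟩ := P.exists_HT_ne_zero hn hA
  have h1 := P.norm_sq_HT_le (sndZ v)
  rw [HT_sndZ] at h1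
  have h2 : 0 < ‖mv P.A.transpose v‖ ^ 2 := by positivity
  by_contra hcon
  push Not at hcon
  nlinarith [sq_nonneg ‖(sndZ v : Z m n)‖]

theorem specNorm_H_pos (hn : 0 < n) (hA : P.A.rank = n) : 0 < specNorm P.H := by
  obtain ⟨v, hv⟩ := P.exists_HT_ne_zero hn hA
  have h1 := P.norm_HT_le (sndZ v)
  rw [HT_sndZ] at h1
  have h2 : 0 < ‖mv P.A.transpose v‖ := by positivity
  by_contra hcon
  push Not at hcon
  nlinarith [norm_nonneg (sndZ v : Z m n)]

theorem lamMinPos_H (hn : 0 < n) (hH : P.H.rank = m + n) :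
    0 < lamMinPos P.H ∧ ∀ z : Z m n, lamMinPos P.H * ‖z‖ ^ 2 ≤ ‖P.HT z‖ ^ 2 := by
  have : Nonempty (Fin m ⊕ Fin n) := ⟨Sum.inr ⟨0, hn⟩⟩
  obtain ⟨h1, h2⟩ := lamMinPos_full_rank (M := P.H) (by simpa using hH)
  exact ⟨h1, fun z => by rw [HT_eq_stack, ← norm_stack z]; exact h2 _⟩

end Problem

theorem le_of_sq_le_mul_add {X a b : ℝ} (ha : 0 ≤ a) (hX : 0 ≤ X) (h : X ^ 2 ≤ a * X + b) :
    X ≤ a + |b| + 1 := by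
  by_contra hcon
  push Not at hcon
  nlinarith [le_abs_self b, abs_nonneg b]

/-! ### Dual subproblem: optimality, duality and quadratic growth -/

namespace Problem

variable {d m n : ℕ} (P : Problem d m n) {τ : ℝ} (x : E d)

/-- The pairing of a dual vector with the right-hand sides of the constraints. -/
noncomputable def rhs (z : Z m n) : ℝ := - ⟪z.fst, P.bbar⟫ - ⟪z.snd, P.b⟫

/-- The smooth part of the dual objective. -/
noncomputable def smooth (τ : ℝ) (x : E d) (z : Z m n) : ℝ :=
  1 / (2 * τ) * ‖P.HT z + P.shift τ x‖ ^ 2 + P.rhs z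

/-- The directional derivative at `z` in direction `v` of the smooth part. -/
noncomputable def dsmooth (τ : ℝ) (x : E d) (z v : Z m n) : ℝ :=
  1 / τ * ⟪P.HT z + P.shift τ x, P.HT v⟫ + P.rhs v

/-- The dual objective as a real number. -/
noncomputable def Dr (τ : ℝ) (x : E d) (z : Z m n) : ℝ :=
  (conj P.g z.fst).toReal + P.smooth τ x z

/-- The primal point belonging to a dual vector. -/
noncomputable def primal (τ : ℝ) (x : E d) (z : Z m n) : E d :=
  -((1 / τ) • (P.HT z + P.shift τ x))

theorem rhs_add (z v : Z m n) : P.rhs (z + v) = P.rhs z + P.rhs v := by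
  simp only [rhs, WithLp.add_fst, WithLp.add_snd, inner_add_left]; ring

theorem rhs_smul (t : ℝ) (v : Z m n) : P.rhs (t • v) = t * P.rhs v := by
  simp only [rhs, WithLp.smul_fst, WithLp.smul_snd, real_inner_smul_left]; ring

theorem continuous_rhs : Continuous P.rhs := by
  unfold rhs
  exact ((WithLp.continuous_fst 2 _ _).inner continuous_const).neg.sub
    ((WithLp.continuous_snd 2 _ _).inner continuous_const)

theorem continuous_smooth : Continuous (P.smooth τ x) := by
  unfold smooth
  exact (continuous_const.mul ((P.continuous_HT.add continuous_const).norm.pow 2)).add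
    P.continuous_rhs

theorem dsmooth_smul (z v : Z m n) (t : ℝ) :
    P.dsmooth τ x z (t • v) = t * P.dsmooth τ x z v := by
  simp only [dsmooth, HT_smul, real_inner_smul_right, rhs_smul]; ring

/-- The smooth part is a quadratic, so this expansion is exact: its remainder supplies growth,
convexity and the curvature bound at once. -/
theorem smooth_add (hτ : 0 < τ) (z v : Z m n) : P.smooth τ x (z + v)
    = P.smooth τ x z + P.dsmooth τ x z v + 1 / (2 * τ) * ‖P.HT v‖ ^ 2 := by
  have : P.HT (z + v) + P.shift τ x = (P.HT z + P.shift τ x) + P.HT v := by rw [HT_add]; abel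
  simp only [smooth, dsmooth, this, norm_add_sq_real, rhs_add]
  field_simp
  ring

/-- The gradient of the smooth dual part is minus the pair of affine images at the associated primal
point, so dual stationarity becomes a primal statement. -/
theorem dsmooth_eq_primal (z v : Z m n) : P.dsmooth τ x z v
    = - ⟪v.fst, mv P.Abar (P.primal τ x z) + P.bbar⟫ - ⟪v.snd, mv P.A (P.primal τ x z) + P.b⟫ := by
  have h := P.inner_HT v (P.primal τ x z)
  rw [inner_add_right, inner_add_right]
  rw [real_inner_comm, primal, inner_neg_left, real_inner_smul_left] at h
  simp only [dsmooth, rhs]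
  unfold primal
  linarith

theorem D_eq (z : Z m n) : P.D τ x z = conj P.g z.fst + (P.smooth τ x z : EReal) := by
  rw [D, smooth, rhs, EReal.coe_add, add_comm _ (conj P.g z.fst), add_assoc]

variable {P}

theorem D_eq_coe (hp : Proper P.g) {z : Z m n} (hz : z.fst ∈ dom (conj P.g)) :
    P.D τ x z = (P.Dr τ x z : EReal) := by
  rw [D_eq, Dr, EReal.coe_add, coe_conj_toReal hp hz]

variable {x}

theorem mem_dom_of_D_le (hp : Proper P.g) {z z₀ : Z m n} (hz₀ : z₀.fst ∈ dom (conj P.g))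
    (h : P.D τ x z ≤ P.D τ x z₀) : z.fst ∈ dom (conj P.g) := by
  intro htop
  rw [D_eq_coe x hp hz₀, D_eq, htop, EReal.top_add_coe] at h
  exact (EReal.coe_lt_top _).not_ge h

theorem Omega_dom (hp : Proper P.g) {z₀ zs : Z m n} (hz₀ : z₀.fst ∈ dom (conj P.g))
    (hs : zs ∈ P.Omega τ x) : zs.fst ∈ dom (conj P.g) :=
  mem_dom_of_D_le hp hz₀ (hs z₀)

theorem gap_eq (hp : Proper P.g) {z zs : Z m n} (hz : z.fst ∈ dom (conj P.g))
    (hs : zs ∈ P.Omega τ x) : P.gap τ x z = P.Dr τ x z - P.Dr τ x zs := by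
  have h1 : ⨅ z', P.D τ x z' = P.D τ x zs :=
    le_antisymm (iInf_le _ zs) (le_iInf hs)
  rw [gap, h1, D_eq_coe x hp hz, D_eq_coe x hp (Omega_dom hp hz hs), EReal.toReal_coe,
    EReal.toReal_coe]

theorem Omega_variational (hτ : 0 < τ) (hp : Proper P.g) {z zs : Z m n}
    (hz : z.fst ∈ dom (conj P.g)) (hs : zs ∈ P.Omega τ x) :
    0 ≤ P.dsmooth τ x zs (z - zs) + ((conj P.g z.fst).toReal - (conj P.g zs.fst).toReal) := by
  refine conj_variational hp (Omega_dom hp hz hs) hz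
    (q := fun t => P.smooth τ x (zs + t • (z - zs))) (c := 1 / (2 * τ) * ‖P.HT (z - zs)‖ ^ 2)
    (fun t => ?_) fun t => ?_
  · simp only [smooth_add P x hτ, dsmooth_smul, HT_smul, norm_smul, mul_pow, Real.norm_eq_abs,
      sq_abs]
    ring
  · have := hs (zs + t • (z - zs))
    rw [D_eq, D_eq] at this
    simpa using this

theorem Dr_sub (hτ : 0 < τ) (z zs : Z m n) : P.Dr τ x z - P.Dr τ x zs
    = P.dsmooth τ x zs (z - zs) + ((conj P.g z.fst).toReal - (conj P.g zs.fst).toReal)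
      + 1 / (2 * τ) * ‖P.HT (z - zs)‖ ^ 2 := by
  have := smooth_add P x hτ zs (z - zs)
  rw [add_sub_cancel] at this
  rw [Dr, Dr, this]; ring

/-- The first-order terms at a solution are nonnegative by optimality, so the gap dominates the
quadratic remainder. All growth estimates start from this inequality. -/
theorem norm_sq_HT_le_gap (hτ : 0 < τ) (hp : Proper P.g) {z zs : Z m n}
    (hz : z.fst ∈ dom (conj P.g)) (hs : zs ∈ P.Omega τ x) :
    1 / (2 * τ) * ‖P.HT (z - zs)‖ ^ 2 ≤ P.gap τ x z := by
  rw [gap_eq hp hz hs, Dr_sub hτ]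
  linarith [Omega_variational hτ hp hz hs]

theorem gap_nonneg (hp : Proper P.g) {z zs : Z m n}
    (hz : z.fst ∈ dom (conj P.g)) (hs : zs ∈ P.Omega τ x) : 0 ≤ P.gap τ x z := by
  have := hs z
  rw [D_eq_coe x hp hz, D_eq_coe x hp (Omega_dom hp hz hs), EReal.coe_le_coe_iff] at this
  rw [gap_eq hp hz hs]; linarith

/-- The gap between two solutions is zero, so the quadratic remainder vanishes. Hence the vector `ν`
of the algorithm is well defined. -/
theorem HT_eq_of_mem_Omega (hτ : 0 < τ) (hp : Proper P.g) {z₀ z zs : Z m n}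
    (hz₀ : z₀.fst ∈ dom (conj P.g)) (hz : z ∈ P.Omega τ x) (hs : zs ∈ P.Omega τ x) :
    P.HT z = P.HT zs := by
  have h0 := norm_sq_HT_le_gap hτ hp (Omega_dom hp hz₀ hz) hs
  have h1 : P.gap τ x z = 0 := by
    rw [gap_eq hp (Omega_dom hp hz₀ hz) hz, sub_self]
  rw [h1, HT_sub] at h0
  have h2 : ‖P.HT z - P.HT zs‖ ^ 2 ≤ 0 := by
    by_contra hcon
    push Not at hcon
    have : 0 < 1 / (2 * τ) * ‖P.HT z - P.HT zs‖ ^ 2 := by positivity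
    linarith
  have h3 : ‖P.HT z - P.HT zs‖ = 0 := by nlinarith [norm_nonneg (P.HT z - P.HT zs)]
  exact sub_eq_zero.1 (norm_eq_zero.1 h3)

theorem nu_eq (hτ : 0 < τ) (hp : Proper P.g) {z₀ zs : Z m n}
    (hz₀ : z₀.fst ∈ dom (conj P.g)) (hs : zs ∈ P.Omega τ x) :
    P.nu τ x = P.HT zs + P.shift τ x := by
  have h : ∃ ν, ∀ z ∈ P.Omega τ x, P.HT z + P.shift τ x = ν :=
    ⟨_, fun z hz => by rw [HT_eq_of_mem_Omega hτ hp hz₀ hz hs]⟩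
  exact (Classical.epsilon_spec h zs hs).symm

/-- A dual solution yields a primal point that is feasible. -/
theorem primal_feasible (hτ : 0 < τ) (hp : Proper P.g) {z₀ zs : Z m n}
    (hz₀ : z₀.fst ∈ dom (conj P.g)) (hs : zs ∈ P.Omega τ x) :
    mv P.A (P.primal τ x zs) + P.b = 0 := by
  set w := mv P.A (P.primal τ x zs) + P.b with hw
  -- The second block is unconstrained, so the residual `w` itself is an admissible direction; the
  -- directional derivative there is `-‖w‖²`, and optimality forces `w = 0`.
  have hz : (zs + sndZ w).fst ∈ dom (conj P.g) := by
    simpa using Omega_dom hp hz₀ hs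
  have := Omega_variational hτ hp hz hs
  rw [add_sub_cancel_left, dsmooth_eq_primal P x, ← hw] at this
  simp only [sndZ_fst, sndZ_snd, inner_zero_left, WithLp.add_fst, add_zero, sub_self,
    real_inner_self_eq_norm_sq, neg_zero, zero_sub] at this
  have h3 : ‖w‖ = 0 := by nlinarith [norm_nonneg w]
  exact norm_eq_zero.1 h3

theorem primal_subdiff (hτ : 0 < τ) (hp : Proper P.g) (hl : LowerSemicontinuous P.g)
    (hc : ConvexFun P.g) {z₀ zs : Z m n} (hz₀ : z₀.fst ∈ dom (conj P.g))
    (hs : zs ∈ P.Omega τ x) :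
    zs.fst ∈ subdiff P.g (mv P.Abar (P.primal τ x zs) + P.bbar) := by
  set y := mv P.Abar (P.primal τ x zs) + P.bbar with hy
  have hzs := Omega_dom hp hz₀ hs
  -- Varying only the first block shows that `zs.fst` maximizes `⟨u, y⟩ - g⋆(u)`. Biconjugation
  -- turns this into equality in Fenchel–Young, hence into a subgradient.
  have key : P.g y ≤ ((⟪zs.fst, y⟫ - (conj P.g zs.fst).toReal : ℝ) : EReal) := by
    refine le_of_conj_bound hp hl hc hz₀ fun u hu => ?_
    have := Omega_variational (z := WithLp.toLp 2 (u, zs.snd)) hτ hp hu hs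
    rw [dsmooth_eq_primal P x, ← hy] at this
    simp only [WithLp.sub_fst, WithLp.sub_snd, inner_sub_left] at this
    change 0 ≤ -(⟪u, y⟫ - ⟪zs.fst, y⟫) - (⟪zs.snd, _⟫ - ⟪zs.snd, _⟫)
      + ((conj P.g u).toReal - (conj P.g zs.fst).toReal) at this
    linarith
  intro y'
  by_cases hy' : P.g y' = ⊤
  · rw [hy']; exact le_top
  · have e1 := inner_sub_le_conj hp hzs (show y' ∈ dom P.g from hy')
    rw [← hp.coe_toReal (show y' ∈ dom P.g from hy')]
    refine (add_le_add_left key _).trans ?_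
    rw [← EReal.coe_add, EReal.coe_le_coe_iff, inner_sub_right]
    linarith

/-- Weak duality. -/
theorem weak_duality (hp : Proper P.g) {x₀ : E d} (hx₀ : mv P.A x₀ + P.b = 0)
    (hy₀ : mv P.Abar x₀ + P.bbar ∈ dom P.g) {z : Z m n} (hz : z.fst ∈ dom (conj P.g)) :
    1 / (2 * τ) * ‖P.HT z + P.shift τ x‖ ^ 2 + ⟪P.HT z, x₀⟫
      - (P.g (mv P.Abar x₀ + P.bbar)).toReal ≤ P.Dr τ x z := by
  have e1 := inner_sub_le_conj hp hz hy₀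
  have e2 : ⟪z.snd, mv P.A x₀ + P.b⟫ = 0 := by rw [hx₀, inner_zero_right]
  rw [inner_add_right] at e1 e2
  rw [Dr, smooth, rhs, inner_HT]
  linarith

/-- Weak duality at a feasible point, followed by completing the square in `‖Hᵀz + shift‖`. -/
theorem Dr_lower_bound (hτ : 0 < τ) (hp : Proper P.g) {x₀ : E d} (hx₀ : mv P.A x₀ + P.b = 0)
    (hy₀ : mv P.Abar x₀ + P.bbar ∈ dom P.g) {z : Z m n} (hz : z.fst ∈ dom (conj P.g)) :
    -(τ / 2 * ‖x₀‖ ^ 2 + ‖P.shift τ x‖ * ‖x₀‖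
      + (P.g (mv P.Abar x₀ + P.bbar)).toReal) ≤ P.Dr τ x z := by
  refine le_trans ?_ (weak_duality (x := x) hp hx₀ hy₀ hz)
  set w := P.HT z + P.shift τ x with hw
  have h1 : ⟪P.HT z, x₀⟫ = ⟪w, x₀⟫ - ⟪P.shift τ x, x₀⟫ := by rw [hw, inner_add_left]; ring
  have h2 := neg_le_of_abs_le (abs_real_inner_le_norm w x₀)
  have h3 := real_inner_le_norm (P.shift τ x) x₀
  have h4 : 0 ≤ 1 / (2 * τ) * (‖w‖ - τ * ‖x₀‖) ^ 2 := by positivity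
  have h5 : 1 / (2 * τ) * (‖w‖ - τ * ‖x₀‖) ^ 2
      = 1 / (2 * τ) * ‖w‖ ^ 2 - ‖w‖ * ‖x₀‖ + τ / 2 * ‖x₀‖ ^ 2 := by
    field_simp; ring
  linarith

/-- Weak duality pits a quadratic in `Hᵀz` against a linear term. Only `Hᵀz` and the dual value are
controlled; `z` may still run off along the kernel. -/
theorem sublevel_bounded (x : E d) (hτ : 0 < τ) (hp : Proper P.g) {x₀ : E d}
    (hx₀ : mv P.A x₀ + P.b = 0) (hy₀ : mv P.Abar x₀ + P.bbar ∈ dom P.g) {z₀ : Z m n}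
    (hz₀ : z₀.fst ∈ dom (conj P.g)) :
    ∃ R, ∀ z, P.D τ x z ≤ P.D τ x z₀ → ‖P.HT z‖ ≤ R ∧ |P.Dr τ x z| ≤ R := by
  set g₀ := (P.g (mv P.Abar x₀ + P.bbar)).toReal with hg₀
  set s := P.shift τ x with hs
  set b := 2 * τ * (P.Dr τ x z₀ + ‖s‖ * ‖x₀‖ + g₀) with hb
  set K := τ / 2 * ‖x₀‖ ^ 2 + ‖s‖ * ‖x₀‖ + g₀ with hK
  refine ⟨max (2 * τ * ‖x₀‖ + |b| + 1 + ‖s‖) (max K (P.Dr τ x z₀)), fun z hle => ?_⟩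
  have hz := mem_dom_of_D_le hp hz₀ hle
  rw [D_eq_coe x hp hz, D_eq_coe x hp hz₀, EReal.coe_le_coe_iff] at hle
  constructor
  · refine le_trans ?_ (le_max_left _ _)
    have h0 := weak_duality (τ := τ) (x := x) hp hx₀ hy₀ hz
    rw [← hg₀, ← hs] at h0
    set w := P.HT z + s with hw
    have h1 : ⟪P.HT z, x₀⟫ = ⟪w, x₀⟫ - ⟪s, x₀⟫ := by rw [hw, inner_add_left]; ring
    have h2 := neg_le_of_abs_le (abs_real_inner_le_norm w x₀)
    have h3 := real_inner_le_norm s x₀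
    have h4 : 1 / (2 * τ) * ‖w‖ ^ 2 ≤ ‖w‖ * ‖x₀‖ + (P.Dr τ x z₀ + ‖s‖ * ‖x₀‖ + g₀) := by linarith
    rw [one_div_mul_eq_div, div_le_iff₀ (by positivity)] at h4
    have h5 := le_of_sq_le_mul_add (X := ‖w‖) (a := 2 * τ * ‖x₀‖) (b := b) (by positivity)
      (norm_nonneg _) (by rw [hb]; linarith)
    have h6 : ‖P.HT z‖ ≤ ‖w‖ + ‖s‖ := by simpa [hw] using norm_sub_le w s
    linarith
  · rw [abs_le]
    refine ⟨?_, hle.trans ((le_max_right _ _).trans (le_max_right _ _))⟩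
    have h1 := Dr_lower_bound (x := x) hτ hp hx₀ hy₀ hz
    have h2 : K ≤ max (2 * τ * ‖x₀‖ + |b| + 1 + ‖s‖) (max K (P.Dr τ x z₀)) :=
      (le_max_left _ _).trans (le_max_right _ _)
    linarith

theorem Omega_nonempty_of_bounded (hp : Proper P.g) (z₀ : Z m n) (R : ℝ)
    (hR : ∀ z, P.D τ x z ≤ P.D τ x z₀ → ∃ z', P.D τ x z' ≤ P.D τ x z ∧ ‖z'‖ ≤ R) :
    (P.Omega τ x).Nonempty := by
  obtain ⟨z, hz⟩ := exists_minimizer hp (T := fun z : Z m n => z.fst) (WithLp.continuous_fst 2 _ _)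
    (P.continuous_smooth (τ := τ) x) z₀ R (by simpa only [D_eq] using hR)
  exact ⟨z, fun z' => by simpa only [D_eq] using hz z'⟩

variable (P) in
/-- The dual problem at `x` is solvable and its objective grows quadratically with modulus `ρ` on
the level set of `z₀`. -/
def Growth (τ : ℝ) (x : E d) (ρ : ℝ) (z₀ : Z m n) : Prop :=
  (P.Omega τ x).Nonempty ∧ ∀ z, z.fst ∈ dom (conj P.g) → P.gap τ x z ≤ P.gap τ x z₀ →
    ∃ zs ∈ P.Omega τ x, ρ / 2 * ‖z - zs‖ ^ 2 ≤ P.gap τ x z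

theorem growth_full_rank (x : E d) (hτ : 0 < τ) (hp : Proper P.g) {x₀ : E d}
    (hx₀ : mv P.A x₀ + P.b = 0) (hy₀ : mv P.Abar x₀ + P.bbar ∈ dom P.g) {z₀ : Z m n}
    (hz₀ : z₀.fst ∈ dom (conj P.g)) (hn : 0 < n) (hH : P.H.rank = m + n) :
    P.Growth τ x (lamMinPos P.H / τ) z₀ := by
  obtain ⟨hl, hlz⟩ := P.lamMinPos_H hn hH
  obtain ⟨R, hR⟩ := sublevel_bounded x hτ hp hx₀ hy₀ hz₀
  have hne : (P.Omega τ x).Nonempty := by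
    refine Omega_nonempty_of_bounded hp z₀ (√(R ^ 2 / lamMinPos P.H)) fun z hz =>
      ⟨z, le_rfl, Real.le_sqrt_of_sq_le ?_⟩
    rw [le_div_iff₀ hl, mul_comm]
    exact (hlz z).trans (pow_le_pow_left₀ (norm_nonneg _) (hR z hz).1 2)
  refine ⟨hne, fun z hz _ => ?_⟩
  obtain ⟨zs, hs⟩ := hne
  refine ⟨zs, hs, le_trans ?_ (norm_sq_HT_le_gap hτ hp hz hs)⟩
  have : lamMinPos P.H / τ / 2 * ‖z - zs‖ ^ 2
      = 1 / (2 * τ) * (lamMinPos P.H * ‖z - zs‖ ^ 2) := by field_simp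
  rw [this]
  exact mul_le_mul_of_nonneg_left (hlz _) (by positivity)

/-- The growth modulus does not exceed the Lipschitz constant of the gradient. -/
theorem Growth.le_LD (hτ : 0 < τ) (hp : Proper P.g) {z₀ : Z m n}
    (hz₀ : z₀.fst ∈ dom (conj P.g)) (hn : 0 < n) (hA : P.A.rank = n) {ρ : ℝ}
    (hG : P.Growth τ x ρ z₀) (hgap : 0 < P.gap τ x z₀) (hρ : 0 < ρ) : ρ ≤ P.LD τ := by
  obtain ⟨⟨zs, hs⟩, hgr⟩ := hG
  obtain ⟨v, hv⟩ := P.exists_HT_ne_zero hn hA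
  set N := ‖mv P.A.transpose v‖ ^ 2 with hN
  have hN0 : 0 < N := by positivity
  -- Moving from a solution in the direction `(0, v)` changes the dual value by the pure quadratic,
  -- because the primal point is feasible. This `t` makes the gap equal to that of `z₀`, the edge of
  -- the region where growth is assumed; growth and the curvature bound are then compared at one
  -- point.
  set t := √(P.gap τ x z₀ * (2 * τ) / N) with ht
  have ht2 : t ^ 2 = P.gap τ x z₀ * (2 * τ) / N := Real.sq_sqrt (by positivity)
  set z := zs + t • (sndZ v : Z m n) with hz
  have hzs := Omega_dom hp hz₀ hs
  have hfst : z.fst = zs.fst := by simp [hz]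
  have hzd : z.fst ∈ dom (conj P.g) := hfst ▸ hzs
  have hHT : ‖P.HT (z - zs)‖ ^ 2 = t ^ 2 * N := by
    rw [hz, add_sub_cancel_left, HT_smul, HT_sndZ, norm_smul, mul_pow, Real.norm_eq_abs, sq_abs]
  have hgz : P.gap τ x z = P.gap τ x z₀ := by
    rw [gap_eq hp hzd hs, Dr_sub hτ, hHT, hfst, ht2, hz, add_sub_cancel_left, dsmooth_smul,
      dsmooth_eq_primal P x, sndZ_snd, primal_feasible hτ hp hz₀ hs, sndZ_fst,
      inner_zero_left, inner_zero_right]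
    field_simp
    ring
  obtain ⟨zt, hzt, hle⟩ := hgr z hzd hgz.le
  have h1 := P.norm_sq_HT_le (z - zt)
  rw [HT_sub, HT_eq_of_mem_Omega hτ hp hz₀ hzt hs, ← HT_sub, hHT, ht2] at h1
  rw [hgz] at hle
  have hN1 : P.gap τ x z₀ * (2 * τ) / N * N = P.gap τ x z₀ * (2 * τ) := by field_simp
  rw [hN1] at h1
  have hlam := P.lamMax_H_pos hn hA
  rw [LD, le_div_iff₀ hτ]
  have h2 := mul_le_mul_of_nonneg_left hle hlam.le
  have h3 := mul_le_mul_of_nonneg_left h1 (half_pos hρ).le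
  have h4 : P.gap τ x z₀ * (ρ * τ) ≤ P.gap τ x z₀ * lamMax P.H := by nlinarith
  exact le_of_mul_le_mul_left h4 hgap

/-! ### Growth from Hoffman bounds for polyhedral regularizers -/

section Polyhedral

variable {p : ℕ} {C : Matrix (Fin p) (Fin m) ℝ} {r : E p}

theorem Polyhedral.nonempty (hP : P.Polyhedral C r) (hp : Proper P.g) :
    ∃ u : E m, ∀ i, mv C u i ≤ r i := by
  by_contra hcon
  push Not at hcon
  refine hp.1 0 ?_
  rw [hP 0, eq_bot_iff]
  refine iSup₂_le fun u hu => ?_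
  obtain ⟨i, hi⟩ := hcon u
  exact absurd (hu i) hi.not_ge

theorem Polyhedral.inner_le (hP : P.Polyhedral C r) {u : E m} (hu : ∀ i, mv C u i ≤ r i)
    (y : E m) : ((⟪u, y⟫ : ℝ) : EReal) ≤ P.g y := by
  rw [hP y]
  exact le_iSup₂ (f := fun (u : E m) (_ : u ∈ {u : E m | ∀ i, mv C u i ≤ r i}) =>
    ((⟪u, y⟫ : ℝ) : EReal)) u hu

theorem Polyhedral.zero (hP : P.Polyhedral C r) (hp : Proper P.g) : P.g 0 = 0 := by
  obtain ⟨u, hu⟩ := hP.nonempty hp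
  refine le_antisymm ?_ (by simpa using hP.inner_le hu 0)
  rw [hP 0]
  exact iSup₂_le fun v _ => by simp

theorem Polyhedral.conj_le_zero (hP : P.Polyhedral C r) (hp : Proper P.g) {u : E m}
    (hu : ∀ i, mv C u i ≤ r i) : conj P.g u ≤ ((0 : ℝ) : EReal) := by
  rw [conj_le_coe_iff hp]
  intro y hy
  have := hP.inner_le hu y
  rw [← hp.coe_toReal hy, EReal.coe_le_coe_iff] at this
  linarith

theorem Polyhedral.mem_dom (hP : P.Polyhedral C r) (hp : Proper P.g) {u : E m}
    (hu : ∀ i, mv C u i ≤ r i) : u ∈ dom (conj P.g) :=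
  mem_dom_of_conj_le (hP.conj_le_zero hp hu)

theorem Polyhedral.conj_toReal (hP : P.Polyhedral C r) (hp : Proper P.g) {u : E m}
    (hu : ∀ i, mv C u i ≤ r i) : (conj P.g u).toReal = 0 := by
  refine le_antisymm (conj_toReal_le hp (hP.conj_le_zero hp hu)) ?_
  have := inner_sub_le_conj hp (hP.mem_dom hp hu) (y := 0) (by simp [dom, hP.zero hp])
  simpa [hP.zero hp] using this

/-- A point outside the closed polyhedron is strictly separated from it by some `y`; along the ray
of `y` the support function `g` falls short of the pairing by an unbounded amount, so the conjugate
is infinite. -/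
theorem Polyhedral.mem_of_dom (hP : P.Polyhedral C r) (hp : Proper P.g) {u : E m}
    (hu : u ∈ dom (conj P.g)) : ∀ i, mv C u i ≤ r i := by
  by_contra hcon
  have hcont : ∀ i, Continuous fun u : E m => mv C u i := fun i => by
    have := (Matrix.toEuclideanLin C).continuous_of_finiteDimensional
    exact (EuclideanSpace.proj (𝕜 := ℝ) i).continuous.comp this
  have hcl : IsClosed {u : E m | ∀ i, mv C u i ≤ r i} := by
    rw [Set.ofPred_forall]
    exact isClosed_iInter fun i => isClosed_le (hcont i) continuous_const
  have hcv : Convex ℝ {u : E m | ∀ i, mv C u i ≤ r i} := by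
    intro v hv w hw a b ha hb hab i
    rw [mv_add, mv_smul, mv_smul]
    have h1 := mul_le_mul_of_nonneg_left (hv i) ha
    have h2 := mul_le_mul_of_nonneg_left (hw i) hb
    have h3 : r i = a * r i + b * r i := by rw [← add_mul, hab, one_mul]
    simp only [PiLp.add_apply, PiLp.smul_apply, smul_eq_mul]
    linarith
  obtain ⟨f, c, hf1, hf2⟩ := geometric_hahn_banach_closed_point hcv hcl hcon
  set y := (InnerProductSpace.toDual ℝ (E m)).symm f with hy
  have hfy : ∀ a, f a = ⟪a, y⟫ := fun a => by
    rw [hy, real_inner_comm, InnerProductSpace.toDual_symm_apply]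
  have hgy : ∀ t : ℝ, 0 ≤ t → P.g (t • y) ≤ ((t * c : ℝ) : EReal) := fun t ht => by
    rw [hP]
    refine iSup₂_le fun v hv => ?_
    rw [EReal.coe_le_coe_iff, real_inner_smul_right, ← hfy]
    exact mul_le_mul_of_nonneg_left (hf1 v hv).le ht
  have hgap : 0 < f u - c := sub_pos.2 hf2
  set t := (|(conj P.g u).toReal| + 1) / (f u - c) with ht
  have ht0 : 0 ≤ t := by positivity
  have hdom : t • y ∈ dom P.g := ((hgy t ht0).trans_lt (EReal.coe_lt_top _)).ne
  have e1 := inner_sub_le_conj hp hu hdom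
  have e2 := hgy t ht0
  rw [← hp.coe_toReal hdom, EReal.coe_le_coe_iff] at e2
  rw [real_inner_smul_right, ← hfy] at e1
  have e3 : t * (f u - c) = |(conj P.g u).toReal| + 1 := by rw [ht]; field_simp
  linarith [le_abs_self (conj P.g u).toReal]

/-- With vanishing right-hand sides the extra equation reads `0 = q`; solvability forces `q = 0` and
its residual is zero, so the two notions coincide and (b) reduces to the common argument. -/
theorem IsHoffmanSmall.isHoffman {θ : ℝ} (h : P.IsHoffmanSmall C θ) (hb : P.bbar = 0)
    (hb' : P.b = 0) : P.IsHoffman C θ := by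
  intro r q t S hS z
  have hq : q = 0 := by
    obtain ⟨w, hw⟩ := hS
    have := hw.2.1
    rw [hb, hb', inner_zero_right, inner_zero_right] at this
    linarith
  subst hq
  have hSS : S = {z | P.HT z = r ∧ ∀ i, mv C z.fst i ≤ t i} := by
    ext w
    simp [S, hb, hb']
  rw [hSS] at hS ⊢
  simpa [hb, hb'] using h r t hS z

variable (P C) in
/-- The polyhedra to which a Hoffman constant applies. -/
def slice (w : E d) (q : ℝ) (t : E p) : Set (Z m n) :=
  {z | P.HT z = w ∧ P.rhs z = q ∧ ∀ i, mv C z.fst i ≤ t i}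

theorem isClosed_slice (w : E d) (q : ℝ) (t : E p) : IsClosed (P.slice C w q t) := by
  have hcont : ∀ i, Continuous fun z : Z m n => mv C z.fst i := fun i => by
    have := (Matrix.toEuclideanLin C).continuous_of_finiteDimensional.comp
      (WithLp.continuous_fst 2 (E m) (E n))
    exact (EuclideanSpace.proj (𝕜 := ℝ) i).continuous.comp this
  have : P.slice C w q t = {z | P.HT z = w} ∩ ({z | P.rhs z = q} ∩
      ⋂ i, {z | mv C z.fst i ≤ t i}) := by
    ext z; simp [slice]
  rw [this]
  exact (isClosed_eq P.continuous_HT continuous_const).inter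
    ((isClosed_eq P.continuous_rhs continuous_const).inter
      (isClosed_iInter fun i => isClosed_le (hcont i) continuous_const))

theorem IsHoffman.exists_near {θ : ℝ} (h : P.IsHoffman C θ) {w : E d} {q : ℝ} {t : E p}
    (hS : (P.slice C w q t).Nonempty) (z : Z m n) : ∃ z' ∈ P.slice C w q t, ‖z - z'‖ ≤
      θ * √(‖P.HT z - w‖ ^ 2 + (P.rhs z - q) ^ 2 + ∑ i, max (mv C z.fst i - t i) 0 ^ 2) := by
  obtain ⟨z', hz', hd⟩ := (isClosed_slice w q t).exists_infDist_eq_dist hS z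
  refine ⟨z', hz', ?_⟩
  rw [← dist_eq_norm, ← hd]
  exact h w q t hS z

theorem IsHoffman.pos {θ : ℝ} (h : P.IsHoffman C θ) (hn : 0 < n) (hA : P.A.rank = n) :
    0 < θ := by
  obtain ⟨v, hv⟩ := P.exists_HT_ne_zero hn hA
  have h0 : (0 : Z m n) ∈ P.slice C 0 0 0 := by
    simp [slice, HT, mv, rhs]
  obtain ⟨z', hz', hle⟩ := h.exists_near ⟨0, h0⟩ (sndZ v)
  by_contra hcon
  push Not at hcon
  have h1 : ‖sndZ v - z'‖ ≤ 0 :=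
    hle.trans (mul_nonpos_of_nonpos_of_nonneg hcon (Real.sqrt_nonneg _))
  have h2 : sndZ v = z' := sub_eq_zero.1 (norm_le_zero_iff.1 h1)
  rw [← h2] at hz'
  exact hv (by rw [← P.HT_sndZ (m := m)]; exact hz'.1)

/-- The dual objective depends on an admissible `z` only through `Hᵀz` and the linear term. Both are
bounded on the level set, so Hoffman's bound applied at `0` produces an equivalent point of bounded
norm. -/
theorem Polyhedral.Omega_nonempty (hP : P.Polyhedral C r) (x : E d) (hτ : 0 < τ)
    (hp : Proper P.g) {x₀ : E d} (hx₀ : mv P.A x₀ + P.b = 0)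
    (hy₀ : mv P.Abar x₀ + P.bbar ∈ dom P.g) {z₀ : Z m n} (hz₀ : z₀.fst ∈ dom (conj P.g))
    {θ : ℝ} (hθ : 0 ≤ θ) (h : P.IsHoffman C θ) : (P.Omega τ x).Nonempty := by
  obtain ⟨R, hR⟩ := sublevel_bounded x hτ hp hx₀ hy₀ hz₀
  set Q := R + 1 / (2 * τ) * (R + ‖P.shift τ x‖) ^ 2 with hQ
  refine Omega_nonempty_of_bounded hp z₀
    (θ * √(R ^ 2 + Q ^ 2 + ∑ i, max (mv C (0 : Z m n).fst i - r i) 0 ^ 2)) fun z hz => ?_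
  obtain ⟨h1, h2⟩ := hR z hz
  have hzd := mem_dom_of_D_le hp hz₀ hz
  have hzC := hP.mem_of_dom hp hzd
  obtain ⟨z', hz', hle⟩ := h.exists_near (w := P.HT z) (q := P.rhs z) (t := r)
    ⟨z, rfl, rfl, hzC⟩ 0
  refine ⟨z', ?_, ?_⟩
  · rw [D_eq_coe x hp hzd, D_eq_coe x hp (hP.mem_dom hp hz'.2.2), Dr, Dr, smooth, smooth,
      hP.conj_toReal hp hzC, hP.conj_toReal hp hz'.2.2, hz'.1, hz'.2.1]
  · rw [zero_sub, norm_neg] at hle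
    refine hle.trans (mul_le_mul_of_nonneg_left (Real.sqrt_le_sqrt ?_) hθ)
    have e1 : P.HT (0 : Z m n) = 0 := by simp [HT, mv]
    have e2 : P.rhs (0 : Z m n) = 0 := by simp [rhs]
    rw [e1, e2, zero_sub, norm_neg, zero_sub, neg_sq]
    have hR0 : 0 ≤ R := (norm_nonneg _).trans h1
    have e3 : |P.rhs z| ≤ Q := by
      have e4 : P.rhs z = P.Dr τ x z - 1 / (2 * τ) * ‖P.HT z + P.shift τ x‖ ^ 2 := by
        rw [Dr, smooth, hP.conj_toReal hp hzC]; ring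
      rw [e4]
      refine (abs_sub _ _).trans (add_le_add h2 ?_)
      rw [abs_of_nonneg (by positivity)]
      have := norm_add_le (P.HT z) (P.shift τ x)
      gcongr
      linarith
    gcongr ?_ + ?_ + _
    · gcongr
    · exact sq_le_sq' (by linarith [(abs_le.1 e3).1]) (abs_le.1 e3).2

/-- The linear term vanishes identically, so the Hoffman residual of an admissible `z` is just
`‖Hᵀ(z - zs)‖`, which the gap controls. -/
theorem Polyhedral.growth_homogeneous (hP : P.Polyhedral C r) (x : E d) (hτ : 0 < τ)
    (hp : Proper P.g) {x₀ : E d} (hx₀ : mv P.A x₀ + P.b = 0)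
    (hy₀ : mv P.Abar x₀ + P.bbar ∈ dom P.g) {z₀ : Z m n} (hz₀ : z₀.fst ∈ dom (conj P.g))
    {θ : ℝ} (hθ : 0 < θ) (h : P.IsHoffman C θ) (hb : P.bbar = 0) (hb' : P.b = 0) :
    P.Growth τ x (θ ^ 2 * τ)⁻¹ z₀ := by
  have hne := hP.Omega_nonempty x hτ hp hx₀ hy₀ hz₀ hθ.le h
  refine ⟨hne, fun z hz _ => ?_⟩
  obtain ⟨zs, hs⟩ := hne
  have hzC := hP.mem_of_dom hp hz
  have hsC := hP.mem_of_dom hp (Omega_dom hp hz hs)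
  have hrhs : ∀ z, P.rhs z = 0 := fun z => by simp [rhs, hb, hb']
  obtain ⟨z', hz', hle⟩ := h.exists_near (w := P.HT zs) (q := P.rhs zs) (t := r)
    ⟨zs, rfl, rfl, hsC⟩ z
  refine ⟨z', fun v => ?_, ?_⟩
  · refine le_trans (le_of_eq ?_) (hs v)
    rw [D_eq_coe x hp (Omega_dom hp hz hs), D_eq_coe x hp (hP.mem_dom hp hz'.2.2), Dr, Dr, smooth,
      smooth, hP.conj_toReal hp hsC, hP.conj_toReal hp hz'.2.2, hz'.1, hz'.2.1]
  · have hsum : ∑ i, max (mv C z.fst i - r i) 0 ^ 2 = 0 :=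
      Finset.sum_eq_zero fun i _ => by rw [max_eq_right (sub_nonpos.2 (hzC i))]; simp
    rw [hsum, hrhs, hrhs, sub_zero, zero_pow two_ne_zero, add_zero, add_zero,
      Real.sqrt_sq (norm_nonneg _), ← HT_sub] at hle
    refine le_trans ?_ (norm_sq_HT_le_gap hτ hp hz hs)
    have h2 := pow_le_pow_left₀ (norm_nonneg _) hle 2
    rw [mul_pow] at h2
    calc (θ ^ 2 * τ)⁻¹ / 2 * ‖z - z'‖ ^ 2
        ≤ (θ ^ 2 * τ)⁻¹ / 2 * (θ ^ 2 * ‖P.HT (z - zs)‖ ^ 2) := by gcongr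
      _ = 1 / (2 * τ) * ‖P.HT (z - zs)‖ ^ 2 := by field_simp

/-- The linear term adds a residual `q` that the quadratic remainder does not control; it is
recovered from the exact expansion of the gap, at the cost of the initial gap and `‖ν‖` in the
modulus. -/
theorem Polyhedral.growth (hP : P.Polyhedral C r) (x : E d) (hτ : 0 < τ)
    (hp : Proper P.g) {x₀ : E d} (hx₀ : mv P.A x₀ + P.b = 0)
    (hy₀ : mv P.Abar x₀ + P.bbar ∈ dom P.g) {z₀ : Z m n} (hz₀ : z₀.fst ∈ dom (conj P.g))
    {θ : ℝ} (hθ : 0 < θ) (h : P.IsHoffman C θ) :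
    P.Growth τ x
      (θ ^ 2 * (τ + P.gap τ x z₀ + 2 * τ * ‖(1 / τ) • P.nu τ x‖ ^ 2))⁻¹ z₀ := by
  have hne := hP.Omega_nonempty x hτ hp hx₀ hy₀ hz₀ hθ.le h
  refine ⟨hne, fun z hz hzgap => ?_⟩
  obtain ⟨zs, hs⟩ := hne
  have hzC := hP.mem_of_dom hp hz
  have hsC := hP.mem_of_dom hp (Omega_dom hp hz hs)
  obtain ⟨z', hz', hle⟩ := h.exists_near (w := P.HT zs) (q := P.rhs zs) (t := r)
    ⟨zs, rfl, rfl, hsC⟩ z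
  refine ⟨z', fun v => ?_, ?_⟩
  · refine le_trans (le_of_eq ?_) (hs v)
    rw [D_eq_coe x hp (Omega_dom hp hz hs), D_eq_coe x hp (hP.mem_dom hp hz'.2.2), Dr, Dr, smooth,
      smooth, hP.conj_toReal hp hsC, hP.conj_toReal hp hz'.2.2, hz'.1, hz'.2.1]
  · have hsum : ∑ i, max (mv C z.fst i - r i) 0 ^ 2 = 0 :=
      Finset.sum_eq_zero fun i _ => by rw [max_eq_right (sub_nonpos.2 (hzC i))]; simp
    have hG0 := gap_nonneg hp hz hs
    have hG1 := norm_sq_HT_le_gap hτ hp hz hs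
    have hG2 := gap_eq hp hz hs
    rw [Dr_sub hτ, dsmooth, ← nu_eq hτ hp hz hs, hP.conj_toReal hp hzC, hP.conj_toReal hp hsC]
      at hG2
    rw [hsum, add_zero, ← HT_sub] at hle
    have hrr : P.rhs z - P.rhs zs = P.rhs (z - zs) := by
      have := P.rhs_add zs (z - zs)
      rw [add_sub_cancel] at this
      linarith
    rw [hrr] at hle
    set G := P.gap τ x z
    set G₀ := P.gap τ x z₀
    set a := P.HT (z - zs)
    set q := P.rhs (z - zs)
    set ν := (1 / τ) • P.nu τ x with hν
    have hin : 1 / τ * ⟪P.nu τ x, a⟫ = ⟪ν, a⟫ := by rw [hν, real_inner_smul_left]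
    rw [hin] at hG2
    have ha : ‖a‖ ^ 2 ≤ 2 * τ * G := by
      rw [one_div_mul_eq_div, div_le_iff₀ (by positivity)] at hG1; linarith
    have hcs : ⟪ν, a⟫ ^ 2 ≤ ‖ν‖ ^ 2 * ‖a‖ ^ 2 := by
      rw [← sq_abs, ← mul_pow]
      exact pow_le_pow_left₀ (abs_nonneg _) (abs_real_inner_le_norm ν a) 2
    -- Solve the gap identity for `q`. Since `0 ≤ e ≤ G ≤ G₀`, one factor of `(G - e)²` is traded
    -- for `G₀`, so that the bound is linear in the gap `G`; the restriction to the level set is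
    -- used here.
    have hq : q ^ 2 ≤ 2 * G * G₀ + 2 * (‖ν‖ ^ 2 * (2 * τ * G)) := by
      set e := 1 / (2 * τ) * ‖a‖ ^ 2 with he
      have he0 : 0 ≤ e := by positivity
      have h1 : q = (G - e) - ⟪ν, a⟫ := by linarith
      have h2 : q ^ 2 ≤ 2 * (G - e) ^ 2 + 2 * ⟪ν, a⟫ ^ 2 := by
        rw [h1]; nlinarith [sq_nonneg ((G - e) + ⟪ν, a⟫)]
      have h3 : (G - e) ^ 2 ≤ G * G₀ := by nlinarith
      have h4 : ‖ν‖ ^ 2 * ‖a‖ ^ 2 ≤ ‖ν‖ ^ 2 * (2 * τ * G) := by gcongr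
      linarith
    have h5 : ‖z - z'‖ ^ 2 ≤ θ ^ 2 * (2 * G * (τ + G₀ + 2 * τ * ‖ν‖ ^ 2)) := by
      have h2 := pow_le_pow_left₀ (norm_nonneg _) hle 2
      rw [mul_pow, Real.sq_sqrt (by positivity)] at h2
      refine h2.trans (mul_le_mul_of_nonneg_left ?_ (sq_nonneg θ))
      linarith
    have hG₀ : 0 ≤ G₀ := hG0.trans hzgap
    have hpos : 0 < τ + G₀ + 2 * τ * ‖ν‖ ^ 2 := by positivity
    calc (θ ^ 2 * (τ + G₀ + 2 * τ * ‖ν‖ ^ 2))⁻¹ / 2 * ‖z - z'‖ ^ 2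
        ≤ (θ ^ 2 * (τ + G₀ + 2 * τ * ‖ν‖ ^ 2))⁻¹ / 2
          * (θ ^ 2 * (2 * G * (τ + G₀ + 2 * τ * ‖ν‖ ^ 2))) := by gcongr
      _ = G := by field_simp

end Polyhedral

end Problem

/-! ### Accelerated proximal gradient steps and restarts -/

theorem momentum_identity {V : Type*} [NormedAddCommGroup V] [InnerProductSpace ℝ V] (α : ℝ)
    (a z w : V) : α * ((α - 1) * ‖z - a‖ ^ 2 + ‖w - a‖ ^ 2)
      = ‖α • a - (α - 1) • z - w‖ ^ 2 + (α - 1) * ‖z - w‖ ^ 2 := by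
  simp only [norm_sub_sq_real, inner_sub_left, real_inner_smul_left, real_inner_smul_right,
    norm_smul, mul_pow, Real.norm_eq_abs, sq_abs, real_inner_comm a z, real_inner_comm a w]
  ring

namespace Problem

variable {d m n : ℕ} {P : Problem d m n} {τ : ℝ} {x : E d}

theorem dsmooth_add (z v w : Z m n) :
    P.dsmooth τ x z (v + w) = P.dsmooth τ x z v + P.dsmooth τ x z w := by
  simp only [dsmooth, HT_add, rhs_add, inner_add_right]; ring

theorem dsmooth_eq_gradient (z v : Z m n) : P.dsmooth τ x z v
    = ⟪(1 / τ) • mv P.Abar (P.HT z + P.shift τ x) - P.bbar, v.fst⟫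
      + ⟪(1 / τ) • mv P.A (P.HT z + P.shift τ x) - P.b, v.snd⟫ := by
  have h := P.inner_HT v (P.HT z + P.shift τ x)
  simp only [dsmooth, rhs, inner_sub_left, real_inner_smul_left]
  rw [real_inner_comm, h, real_inner_comm v.fst, real_inner_comm v.snd, real_inner_comm v.fst,
    real_inner_comm v.snd]
  ring

theorem apgStep_dom (hp : Proper P.g) (hL : 0 < P.LD τ) {z₀ : Z m n}
    (hz₀ : z₀.fst ∈ dom (conj P.g)) (s : ApgState m n) :
    (P.apgStep τ x s).z.fst ∈ dom (conj P.g) :=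
  prox_conj_mem_dom hp hz₀ (inv_pos.2 hL) _

/-- The basic inequality of one proximal gradient step. -/
theorem apgStep_descent (hτ : 0 < τ) (hp : Proper P.g) (hL : 0 < P.LD τ) (s : ApgState m n)
    {z : Z m n} (hz : z.fst ∈ dom (conj P.g)) :
    P.Dr τ x (P.apgStep τ x s).z + P.LD τ / 2 * ‖z - (P.apgStep τ x s).z‖ ^ 2
      ≤ P.Dr τ x z + P.LD τ / 2 * ‖z - s.zh‖ ^ 2 := by
  set L := P.LD τ with hLdef
  set G1 := (1 / τ) • mv P.Abar (P.HT s.zh + P.shift τ x) - P.bbar with hG1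
  set G2 := (1 / τ) • mv P.A (P.HT s.zh + P.shift τ x) - P.b with hG2
  set z' := (P.apgStep τ x s).z with hz'
  have hf : z'.fst = prox L⁻¹ (conj P.g) (s.zh.fst - (1 / L) • G1) := rfl
  have hs : z'.snd = s.zh.snd - (1 / L) • G2 := rfl
  have hvi := prox_conj_variational hp hz (inv_pos.2 hL) (s.zh.fst - (1 / L) • G1)
  rw [← hf] at hvi
  have e1 : ⟪z'.fst - (s.zh.fst - (1 / L) • G1), z.fst - z'.fst⟫ / L⁻¹
      = L * ⟪(z' - s.zh).fst, (z - z').fst⟫ + ⟪G1, (z - z').fst⟫ := by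
    have : z'.fst - (s.zh.fst - (1 / L) • G1) = (z' - s.zh).fst + (1 / L) • G1 := by
      rw [WithLp.sub_fst]; abel
    rw [this, inner_add_left, real_inner_smul_left, WithLp.sub_fst z z']
    field_simp
  have e2 : 0 = L * ⟪(z' - s.zh).snd, (z - z').snd⟫ + ⟪G2, (z - z').snd⟫ := by
    rw [WithLp.sub_snd z' s.zh, hs, sub_sub_cancel_left, inner_neg_left, real_inner_smul_left]
    field_simp
    ring
  have e3 : ⟪z' - s.zh, z - z'⟫ = ⟪(z' - s.zh).fst, (z - z').fst⟫
      + ⟪(z' - s.zh).snd, (z - z').snd⟫ := WithLp.prod_inner_apply _ _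
  have e4 := dsmooth_eq_gradient (P := P) (τ := τ) (x := x) s.zh (z - z')
  rw [← hG1, ← hG2] at e4
  have e5 := smooth_add P x hτ s.zh (z - s.zh)
  have e6 := smooth_add P x hτ s.zh (z' - s.zh)
  have e7 := dsmooth_add (P := P) (τ := τ) (x := x) s.zh (z - z') (z' - s.zh)
  rw [sub_add_sub_cancel] at e7
  rw [add_sub_cancel] at e5 e6
  -- The step size `1 / L_𝒟` dominates the curvature of the smooth part. The convexity lower bound
  -- is the dropped nonnegative square `e9`.
  have e8 : 1 / (2 * τ) * ‖P.HT (z' - s.zh)‖ ^ 2 ≤ L / 2 * ‖z' - s.zh‖ ^ 2 := by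
    have : L / 2 * ‖z' - s.zh‖ ^ 2 = 1 / (2 * τ) * (lamMax P.H * ‖z' - s.zh‖ ^ 2) := by
      rw [hLdef, LD]; field_simp
    rw [this]
    exact mul_le_mul_of_nonneg_left (P.norm_sq_HT_le _) (by positivity)
  have e9 : 0 ≤ 1 / (2 * τ) * ‖P.HT (z - s.zh)‖ ^ 2 := by positivity
  have e10 : ‖z - s.zh‖ ^ 2 = ‖z' - s.zh‖ ^ 2 + 2 * ⟪z' - s.zh, z - z'⟫ + ‖z - z'‖ ^ 2 := by
    rw [← norm_add_sq_real]; congr 2; abel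
  rw [e1] at hvi
  simp only [Dr]
  rw [e10]
  have e11 : L / 2 * (‖z' - s.zh‖ ^ 2 + 2 * ⟪z' - s.zh, z - z'⟫ + ‖z - z'‖ ^ 2)
      = L / 2 * ‖z' - s.zh‖ ^ 2 + (L * ⟪(z' - s.zh).fst, (z - z').fst⟫
        + L * ⟪(z' - s.zh).snd, (z - z').snd⟫) + L / 2 * ‖z - z'‖ ^ 2 := by
    rw [e3]; ring
  rw [e11]
  linarith

theorem apg_alpha {α : ℝ} (hα : 1 ≤ α) :
    α + 1 / 2 ≤ (1 + √(1 + 4 * α ^ 2)) / 2 ∧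
      ((1 + √(1 + 4 * α ^ 2)) / 2) ^ 2 - (1 + √(1 + 4 * α ^ 2)) / 2 = α ^ 2 := by
  have h1 : √(1 + 4 * α ^ 2) ^ 2 = 1 + 4 * α ^ 2 := Real.sq_sqrt (by positivity)
  constructor
  · have : 2 * α ≤ √(1 + 4 * α ^ 2) := Real.le_sqrt_of_sq_le (by nlinarith)
    linarith
  · nlinarith

/-- The Lyapunov function of the accelerated method. -/
theorem apg_invariant (hτ : 0 < τ) (hp : Proper P.g) (hL : 0 < P.LD τ) {z₀ zs : Z m n}
    (hz₀ : z₀.fst ∈ dom (conj P.g)) (hs : zs ∈ P.Omega τ x) (j : ℕ) :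
    let s := (P.apgStep τ x)^[j] ⟨z₀, z₀, 1⟩
    s.z.fst ∈ dom (conj P.g) ∧ ((j : ℝ) + 2) / 2 ≤ s.α ∧
      (s.α ^ 2 - s.α) * P.gap τ x s.z
        + P.LD τ / 2 * ‖s.α • s.zh - (s.α - 1) • s.z - zs‖ ^ 2
        ≤ P.LD τ / 2 * ‖z₀ - zs‖ ^ 2 := by
  induction j with
  | zero => simp [hz₀]
  | succ j ih =>
    simp only [Function.iterate_succ_apply']
    set s := (P.apgStep τ x)^[j] ⟨z₀, z₀, 1⟩
    obtain ⟨hd, hα, hinv⟩ := ih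
    have hα1 : 1 ≤ s.α := by
      have : (0 : ℝ) ≤ j := j.cast_nonneg
      linarith
    obtain ⟨ha1, ha2⟩ := apg_alpha hα1
    have hd' := apgStep_dom (x := x) hp hL hz₀ s
    have hA := apgStep_descent (x := x) hτ hp hL s hd
    have hB := apgStep_descent (x := x) hτ hp hL s (Omega_dom hp hz₀ hs)
    refine ⟨hd', ?_, le_trans ?_ hinv⟩
    · change _ ≤ (1 + √(1 + 4 * s.α ^ 2)) / 2
      push_cast
      linarith
    · have hα' : (P.apgStep τ x s).α = (1 + √(1 + 4 * s.α ^ 2)) / 2 := rfl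
      have hzh : (P.apgStep τ x s).zh = (P.apgStep τ x s).z
          + ((s.α - 1) / (P.apgStep τ x s).α) • ((P.apgStep τ x s).z - s.z) := rfl
      rw [← hα'] at ha1 ha2
      rw [gap_eq hp hd' hs, gap_eq hp hd hs, ha2]
      set z' := (P.apgStep τ x s).z
      set α' := (P.apgStep τ x s).α
      have hne : α' ≠ 0 := by linarith
      have e1 : α' • (P.apgStep τ x s).zh - (α' - 1) • z' - zs
          = s.α • z' - (s.α - 1) • s.z - zs := by
        rw [hzh, smul_add, smul_smul, mul_div_cancel₀ _ hne]
        module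
      rw [e1]
      -- The descent inequality at the previous iterate is weighted by `α - 1`, the one at the
      -- solution by `1`, and the sum is multiplied by `α`. The identity, applied to the new iterate
      -- and to the extrapolated point, collapses the weighted squares into the Lyapunov terms; the
      -- `‖z - w‖²` contributions cancel.
      have i1 := momentum_identity s.α z' s.z zs
      have i2 := momentum_identity s.α s.zh s.z zs
      have h1 := mul_le_mul_of_nonneg_left hA (sub_nonneg.2 hα1)
      have h2 := mul_le_mul_of_nonneg_left (add_le_add h1 hB) (zero_le_one.trans hα1)
      have i3 := congrArg (P.LD τ / 2 * ·) i1
      have i4 := congrArg (P.LD τ / 2 * ·) i2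
      linarith

theorem apgRun_dom (hτ : 0 < τ) (hp : Proper P.g) (hL : 0 < P.LD τ) {z₀ zs : Z m n}
    (hz₀ : z₀.fst ∈ dom (conj P.g)) (hs : zs ∈ P.Omega τ x) (j : ℕ) :
    (P.apgRun τ x j z₀).fst ∈ dom (conj P.g) :=
  (apg_invariant hτ hp hL hz₀ hs j).1

/-- The convergence rate of the accelerated proximal gradient method. -/
theorem apgRun_gap_le (hτ : 0 < τ) (hp : Proper P.g) (hL : 0 < P.LD τ) {z₀ zs : Z m n}
    (hz₀ : z₀.fst ∈ dom (conj P.g)) (hs : zs ∈ P.Omega τ x) (j : ℕ) :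
    (j : ℝ) ^ 2 / 4 * P.gap τ x (P.apgRun τ x j z₀) ≤ P.LD τ / 2 * ‖z₀ - zs‖ ^ 2 := by
  obtain ⟨hd, hα, hinv⟩ := apg_invariant hτ hp hL hz₀ hs j
  set s := (P.apgStep τ x)^[j] ⟨z₀, z₀, 1⟩
  have hg : 0 ≤ P.gap τ x s.z := gap_nonneg hp hd hs
  have hj : (0 : ℝ) ≤ j := j.cast_nonneg
  -- From `α ≥ (j + 2) / 2` one gets `α (α - 1) ≥ j (j + 2) / 4`.
  have h1 : (j : ℝ) ^ 2 / 4 ≤ s.α ^ 2 - s.α := by nlinarith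
  have h2 : 0 ≤ P.LD τ / 2 * ‖s.α • s.zh - (s.α - 1) • s.z - zs‖ ^ 2 := by positivity
  exact (mul_le_mul_of_nonneg_right h1 hg).trans (by linarith)

/-- Growth bounds the squared distance in the rate by the current gap, and the choice of `j` makes
the resulting factor `1 / 2`. -/
theorem Growth.apgRun_gap_le_half (hτ : 0 < τ) (hp : Proper P.g) (hL : 0 < P.LD τ) {ρ : ℝ}
    (hρ : 0 < ρ) {z₀ z : Z m n} (hG : P.Growth τ x ρ z₀) (hz : z.fst ∈ dom (conj P.g))
    (hle : P.gap τ x z ≤ P.gap τ x z₀) {j : ℕ} (hj : 2 * √(2 * P.LD τ / ρ) ≤ j) :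
    P.gap τ x (P.apgRun τ x j z) ≤ P.gap τ x z / 2 := by
  obtain ⟨zs, hs, hzs⟩ := hG.2 z hz hle
  have h1 := apgRun_gap_le hτ hp hL hz hs j
  have h2 : 8 * P.LD τ / ρ ≤ (j : ℝ) ^ 2 := by
    have := pow_le_pow_left₀ (by positivity) hj 2
    rw [mul_pow, Real.sq_sqrt (by positivity)] at this
    refine le_trans (le_of_eq ?_) this
    ring
  have hg := gap_nonneg hp (apgRun_dom hτ hp hL hz hs j) hs
  have h3 : 2 * P.LD τ / ρ * P.gap τ x (P.apgRun τ x j z)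
      ≤ (j : ℝ) ^ 2 / 4 * P.gap τ x (P.apgRun τ x j z) :=
    mul_le_mul_of_nonneg_right (by linarith [h2, show 8 * P.LD τ / ρ = 4 * (2 * P.LD τ / ρ) by ring])
      hg
  have h4 : P.LD τ / 2 * ‖z - zs‖ ^ 2 ≤ P.LD τ / ρ * P.gap τ x z := by
    have : P.LD τ / 2 * ‖z - zs‖ ^ 2 = P.LD τ / ρ * (ρ / 2 * ‖z - zs‖ ^ 2) := by field_simp
    rw [this]
    exact mul_le_mul_of_nonneg_left hzs (by positivity)
  have h5 : P.LD τ / ρ * (2 * P.gap τ x (P.apgRun τ x j z)) ≤ P.LD τ / ρ * P.gap τ x z := by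
    calc _ = 2 * P.LD τ / ρ * P.gap τ x (P.apgRun τ x j z) := by ring
      _ ≤ _ := h3.trans (h1.trans h4)
  linarith [le_of_mul_le_mul_left h5 (by positivity)]

theorem Growth.restartedAPG_gap_le (hτ : 0 < τ) (hp : Proper P.g) (hL : 0 < P.LD τ) {ρ : ℝ}
    (hρ : 0 < ρ) {z₀ : Z m n} (hG : P.Growth τ x ρ z₀) (hz₀ : z₀.fst ∈ dom (conj P.g))
    {j : ℕ} (hj : 2 * √(2 * P.LD τ / ρ) ≤ j) (i : ℕ) :
    (P.restartedAPG τ x i j z₀).fst ∈ dom (conj P.g) ∧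
      P.gap τ x (P.restartedAPG τ x i j z₀) ≤ P.gap τ x z₀ / 2 ^ i := by
  obtain ⟨zs, hs⟩ := hG.1
  have hg := gap_nonneg hp hz₀ hs
  induction i with
  | zero => simp [restartedAPG, hz₀]
  | succ i ih =>
    obtain ⟨hd, hle⟩ := ih
    unfold restartedAPG at hd hle ⊢
    rw [Function.iterate_succ_apply']
    refine ⟨apgRun_dom hτ hp hL hd hs j, ?_⟩
    have h1 := hG.apgRun_gap_le_half hτ hp hL hρ hd
      (hle.trans (div_le_self hg (one_le_pow₀ one_le_two))) hj
    rw [pow_succ, ← div_div]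
    linarith

/-- Gaps never rise between rounds, so growth stays applicable; a final use converts the reduced gap
into a distance. -/
theorem Growth.restartedAPG_dist_le (hτ : 0 < τ) (hp : Proper P.g) (hL : 0 < P.LD τ) {ρ : ℝ}
    (hρ : 0 < ρ) {z₀ : Z m n} (hG : P.Growth τ x ρ z₀) (hz₀ : z₀.fst ∈ dom (conj P.g))
    {i j : ℕ} (hj : 2 * √(2 * P.LD τ / ρ) ≤ j) {μ : ℝ} (hμ : 0 ≤ μ)
    (hi : 2 * P.gap τ x z₀ ≤ 2 ^ i * (ρ * μ ^ 2)) :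
    (P.restartedAPG τ x i j z₀).fst ∈ dom (conj P.g) ∧
      ∃ zs ∈ P.Omega τ x, ‖P.restartedAPG τ x i j z₀ - zs‖ ≤ μ := by
  obtain ⟨hd, hle⟩ := hG.restartedAPG_gap_le hτ hp hL hρ hz₀ hj i
  obtain ⟨zt, ht⟩ := hG.1
  have hg := gap_nonneg hp hz₀ ht
  refine ⟨hd, ?_⟩
  obtain ⟨zs, hs, hzs⟩ := hG.2 _ hd (hle.trans (div_le_self hg (one_le_pow₀ one_le_two)))
  refine ⟨zs, hs, ?_⟩
  have h2 : P.gap τ x z₀ / 2 ^ i ≤ ρ * μ ^ 2 / 2 := by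
    rw [div_le_iff₀ (by positivity)]; linarith
  have h3 : ρ / 2 * ‖P.restartedAPG τ x i j z₀ - zs‖ ^ 2 ≤ ρ / 2 * μ ^ 2 := by linarith
  exact (sq_le_sq₀ (norm_nonneg _) hμ).1 (le_of_mul_le_mul_left h3 (by positivity))

end Problem

/-! ### Exact proximal steps: descent and KKT residual -/

namespace Problem

variable {d m n : ℕ} {P : Problem d m n} {τ : ℝ} {x : E d}

variable (P) in
/-- The objective as a real number. -/
noncomputable def obj (x : E d) : ℝ := P.f0 x + (P.g (mv P.Abar x + P.bbar)).toReal

variable (P) in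
/-- Points satisfying the constraint at which the objective is finite. -/
def Feasible (x : E d) : Prop := mv P.A x + P.b = 0 ∧ mv P.Abar x + P.bbar ∈ dom P.g

theorem F0_eq_obj (hp : Proper P.g) (hx : mv P.Abar x + P.bbar ∈ dom P.g) :
    P.F0 x = (P.obj x : EReal) := by
  rw [F0, F, obj, EReal.coe_add, hp.coe_toReal hx]

theorem iInf_toReal_le_obj (hp : Proper P.g) (hb : ⊥ < ⨅ x, P.F0 x)
    (hx : mv P.Abar x + P.bbar ∈ dom P.g) : (⨅ x, P.F0 x).toReal ≤ P.obj x := by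
  have h := iInf_le P.F0 x
  rw [F0_eq_obj hp hx] at h
  rw [← EReal.coe_le_coe_iff, EReal.coe_toReal (h.trans_lt (EReal.coe_lt_top _)).ne hb.ne']
  exact h

theorem HT_eq_primal (hτ : 0 < τ) (z : Z m n) :
    P.HT z = -(gradient P.f0 x + τ • (P.primal τ x z - x)) := by
  have : τ • P.primal τ x z = -(P.HT z + P.shift τ x) := by
    rw [primal, smul_neg, smul_smul, mul_one_div_cancel hτ.ne', one_smul]
  rw [smul_sub, this, shift]; abel

theorem norm_primal_sub (hτ : 0 < τ) (z z' : Z m n) :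
    ‖P.primal τ x z - P.primal τ x z'‖ ≤ specNorm P.H / τ * ‖z - z'‖ := by
  have : P.primal τ x z - P.primal τ x z' = -((1 / τ) • P.HT (z - z')) := by
    rw [primal, primal, HT_sub, ← sub_add_sub_cancel (P.HT z) 0]
    module
  rw [this, norm_neg, norm_smul, Real.norm_of_nonneg (by positivity), one_div_mul_eq_div,
    div_mul_eq_mul_div]
  gcongr
  exact P.norm_HT_le _

theorem mem_dom_of_subdiff (hp : Proper P.g) {y ξ : E m} (h : ξ ∈ subdiff P.g y) :
    y ∈ dom P.g := by
  obtain ⟨y', hy'⟩ := hp.2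
  intro htop
  have := h y'
  rw [htop, EReal.top_add_coe, ← hp.coe_toReal hy'] at this
  exact (EReal.coe_lt_top _).not_ge this

theorem primal_isFeasible {Lf lg : ℝ} (hS : P.Standing Lf lg) (hτ : 0 < τ) {z₀ zs : Z m n}
    (hz₀ : z₀.fst ∈ dom (conj P.g)) (hs : zs ∈ P.Omega τ x) :
    P.Feasible (P.primal τ x zs) :=
  ⟨primal_feasible hτ hS.proper hz₀ hs,
    mem_dom_of_subdiff hS.proper (primal_subdiff hτ hS.proper hS.lsc hS.convex hz₀ hs)⟩

/-- Decrease of the objective along an exact proximal step. -/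
theorem obj_primal_le {L lg : ℝ} (hS : P.Standing L lg) (hL : 0 < L) {z₀ zs : Z m n}
    (hz₀ : z₀.fst ∈ dom (conj P.g)) (hs : zs ∈ P.Omega (2 * L) x) {x' : E d}
    (hx' : P.Feasible x') :
    P.obj (P.primal (2 * L) x zs) + L * ‖P.primal (2 * L) x zs - x‖ ^ 2
      ≤ P.obj x' + 3 / 2 * L * ‖x' - x‖ ^ 2 := by
  have hτ : 0 < 2 * L := by positivity
  set xh := P.primal (2 * L) x zs with hxh
  have hfeas := primal_isFeasible hS hτ hz₀ hs
  have hsub := primal_subdiff hτ hS.proper hS.lsc hS.convex hz₀ hs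
    (mv P.Abar x' + P.bbar)
  rw [← hxh] at hfeas hsub
  rw [← hS.proper.coe_toReal hfeas.2, ← hS.proper.coe_toReal hx'.2, ← EReal.coe_add,
    EReal.coe_le_coe_iff, add_sub_add_right_eq_sub, ← mv_sub] at hsub
  have hA : mv P.A (x' - xh) = 0 := by
    rw [mv_sub, eq_neg_of_add_eq_zero_left hx'.1, eq_neg_of_add_eq_zero_left hfeas.1, sub_self]
  have h1 := P.inner_HT zs (x' - xh)
  rw [hA, inner_zero_right, add_zero, HT_eq_primal (x := x) hτ, ← hxh] at h1
  rw [← h1] at hsub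
  -- The expansion is at the competitor `x'`; replacing its gradient by the one at `x` costs half of
  -- each square by Young. With `τ = 2 L` the terms in `‖xh - x'‖²` then cancel exactly, leaving the
  -- factor `3 / 2`.
  have h2 := descent_lemma hS.diff hS.lip x' xh
  have h3 : ⟪gradient P.f0 x' - gradient P.f0 x, xh - x'⟫
      ≤ L / 2 * (‖x' - x‖ ^ 2 + ‖xh - x'‖ ^ 2) := by
    have e1 := real_inner_le_norm (gradient P.f0 x' - gradient P.f0 x) (xh - x')
    have e2 := mul_le_mul_of_nonneg_right (hS.lip x' x) (norm_nonneg (xh - x'))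
    have e3 : 0 ≤ L / 2 * (‖x' - x‖ - ‖xh - x'‖) ^ 2 := by positivity
    linarith
  have h4 : ‖x' - x‖ ^ 2 = ‖xh - x‖ ^ 2 - 2 * ⟪xh - x, xh - x'⟫ + ‖xh - x'‖ ^ 2 := by
    rw [← norm_sub_sq_real]; congr 2; abel
  have h5 : ⟪-(gradient P.f0 x + (2 * L) • (xh - x)), x' - xh⟫
      = ⟪gradient P.f0 x, xh - x'⟫ + 2 * L * ⟪xh - x, xh - x'⟫ := by
    rw [← neg_sub xh x', inner_neg_neg, inner_add_left, real_inner_smul_left]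
  rw [h5] at hsub
  rw [inner_sub_left] at h3
  have h6 := congrArg (L * ·) h4
  simp only [obj]
  linarith

/-- With the multiplier from the dual solution the residual is a gradient difference, of size `L ‖xh
- x‖`, minus the proximal term, of size `2 L ‖xh - x‖`. -/
theorem primal_isKKT {L lg : ℝ} (hS : P.Standing L lg) (hL : 0 < L) {z₀ zs : Z m n}
    (hz₀ : z₀.fst ∈ dom (conj P.g)) (hs : zs ∈ P.Omega (2 * L) x) {ε : ℝ}
    (hx : 3 * L * ‖P.primal (2 * L) x zs - x‖ ≤ ε) : P.IsKKT ε (P.primal (2 * L) x zs) := by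
  have hτ : 0 < 2 * L := by positivity
  have hε : 0 ≤ ε := le_trans (by positivity) hx
  set xh := P.primal (2 * L) x zs with hxh
  refine ⟨zs.snd, ?_, ?_⟩
  · refine (Metric.infEDist_le_edist_of_mem (Set.mem_image_of_mem _
      (primal_subdiff hτ hS.proper hS.lsc hS.convex hz₀ hs))).trans ?_
    rw [edist_dist, dist_zero_left]
    refine ENNReal.ofReal_le_ofReal (le_trans ?_ hx)
    have h1 : gradient P.f0 xh + mv P.A.transpose zs.snd + mv P.Abar.transpose zs.fst
        = (gradient P.f0 xh - gradient P.f0 x) - (2 * L) • (xh - x) := by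
      have h2 : mv P.Abar.transpose zs.fst + mv P.A.transpose zs.snd
        = -(gradient P.f0 x + (2 * L) • (xh - x)) := HT_eq_primal hτ zs
      rw [add_assoc, add_comm (mv P.A.transpose zs.snd), h2]; abel
    rw [h1]
    refine (norm_sub_le _ _).trans ?_
    rw [norm_smul, Real.norm_of_nonneg hτ.le]
    linarith [hS.lip xh x]
  · rw [hxh, primal_feasible hτ hS.proper hz₀ hs, norm_zero]
    exact hε

end Problem

/-! ### Inexact outer iteration and the KKT guarantee -/

namespace Input

variable {d m n : ℕ} {I : Input d m n}

variable (I) in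
/-- Every inner call returns a point within the prescribed tolerance of the dual solution set. -/
def InnerAccurate (S : Schedule d) : Prop :=
  ∀ k, (I.iter S (k + 1)).z.fst ∈ dom (conj I.g) ∧
    ∃ zs ∈ I.Omega I.τ (I.iter S k).x, ‖(I.iter S (k + 1)).z - zs‖ ≤ S.μ k (I.iter S k).x

theorem Valid.feasible_x0 (hV : I.Valid) : I.Feasible I.x0 := by
  refine ⟨hV.feasible, fun htop => hV.finite ?_⟩
  rw [Problem.F0, Problem.F, htop, EReal.coe_add_top]

theorem Valid.Δ_eq (hV : I.Valid) : I.Δ = I.obj I.x0 - (⨅ x, I.F0 x).toReal := by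
  rw [Δ, Problem.F0_eq_obj hV.standing.proper hV.feasible_x0.2, EReal.toReal_coe]

theorem Valid.Δ_nonneg (hV : I.Valid) : 0 ≤ I.Δ := by
  rw [hV.Δ_eq]
  linarith [Problem.iInf_toReal_le_obj hV.standing.proper hV.standing.bddBelow hV.feasible_x0.2]

theorem Valid.obj_ge (hV : I.Valid) {x : E d} (hx : I.Feasible x) : I.obj I.x0 - I.Δ ≤ I.obj x := by
  rw [hV.Δ_eq]
  linarith [Problem.iInf_toReal_le_obj hV.standing.proper hV.standing.bddBelow hx.2]

theorem iter_succ_x (hτ : 0 < I.τ) (S : Schedule d) (k : ℕ) :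
    (I.iter S (k + 1)).x = I.primal I.τ (I.iter S k).x (I.iter S (k + 1)).z := by
  have h : (I.iter S (k + 1)).x = (I.iter S k).x - (1 / I.τ) • (I.HT (I.iter S (k + 1)).z
      + gradient I.f0 (I.iter S k).x) := rfl
  rw [h, Problem.primal, Problem.shift, smul_add, smul_add, smul_sub, smul_smul _ I.τ,
    one_div_mul_cancel hτ.ne', one_smul]
  abel

/-- The exact solutions of the subproblems, and the decrease of the objective along them. -/
theorem InnerAccurate.exact_points (hV : I.Valid) (hL : 0 < I.Lf) {S : Schedule d}
    (hS : I.InnerAccurate S) : ∃ xh : ℕ → E d, xh 0 = I.x0 ∧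
      (∀ k, ∃ zs ∈ I.Omega I.τ (I.iter S k).x, xh (k + 1) = I.primal I.τ (I.iter S k).x zs) ∧
      (∀ k, ‖xh (k + 1) - (I.iter S (k + 1)).x‖
        ≤ specNorm I.H / I.τ * S.μ k (I.iter S k).x) ∧
      (∀ k, I.Feasible (xh k)) ∧
      ∀ K, I.obj (xh K) + ∑ k ∈ Finset.range K, I.Lf * ‖xh (k + 1) - (I.iter S k).x‖ ^ 2
        ≤ I.obj I.x0 + ∑ k ∈ Finset.range K, 3 / 2 * I.Lf * ‖xh k - (I.iter S k).x‖ ^ 2 := by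
  have hτ : 0 < I.τ := by unfold τ; positivity
  choose hdom zs hzs hμ using hS
  set xh : ℕ → E d := fun k => Nat.casesOn k I.x0 fun j => I.primal I.τ (I.iter S j).x (zs j)
    with hxh
  have hsucc : ∀ k, xh (k + 1) = I.primal I.τ (I.iter S k).x (zs k) := fun k => rfl
  have hfeas : ∀ k, I.Feasible (xh k) := fun k => by
    cases k with
    | zero => exact hV.feasible_x0
    | succ k => exact Problem.primal_isFeasible hV.standing hτ hV.zini_dom (hzs k)
  refine ⟨xh, rfl, fun k => ⟨zs k, hzs k, rfl⟩, fun k => ?_, hfeas, fun K => ?_⟩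
  · rw [hsucc, iter_succ_x hτ]
    refine (Problem.norm_primal_sub hτ _ _).trans (mul_le_mul_of_nonneg_left ?_
      (div_nonneg (specNorm_nonneg _) hτ.le))
    rw [norm_sub_rev]
    exact hμ k
  · induction K with
    | zero => simp [xh]
    | succ K ih =>
      rw [Finset.sum_range_succ, Finset.sum_range_succ]
      -- The competitor is the previous exact point, so the objective values telescope.
      have := Problem.obj_primal_le hV.standing hL hV.zini_dom (hzs K) (hfeas K)
      change I.obj (xh (K + 1)) + I.Lf * ‖xh (K + 1) - (I.iter S K).x‖ ^ 2 ≤ _ at this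
      linarith

theorem error_le (hL : 0 < I.Lf) {μ ε c : ℝ} (hH : 0 < specNorm I.H)
    (hμ : μ ≤ c * (ε / (6 * specNorm I.H))) : specNorm I.H / I.τ * μ ≤ c * (ε / (12 * I.Lf)) := by
  have hτ : 0 < I.τ := by unfold τ; positivity
  calc specNorm I.H / I.τ * μ ≤ specNorm I.H / I.τ * (c * (ε / (6 * specNorm I.H))) := by gcongr
    _ = c * (ε / (12 * I.Lf)) := by unfold τ; field_simp; ring

/-- Only two features of the tolerance matter: one keeps exact points within `ε / (12 L_f)` of the
iterates, the other within `δ`. The nearby KKT point is the exact solution of the selected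
subproblem. -/
theorem InnerAccurate.finds (hV : I.Valid) (hL : 0 < I.Lf) (hH : 0 < specNorm I.H)
    {S : Schedule d} (hS : I.InnerAccurate S) {ε δ : ℝ} (hε : 0 < ε) (hδ : 0 < δ)
    (h1 : ∀ k, S.μ k (I.iter S k).x ≤ ε / (6 * specNorm I.H))
    (h2 : ∀ k, S.μ k (I.iter S k).x ≤ I.τ * δ / specNorm I.H) : I.Finds S ε δ := by
  have hτ : 0 < I.τ := by unfold τ; positivity
  obtain ⟨xh, h0, hprim, herr, hfeas, hsum⟩ := hS.exact_points hV hL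
  have he : ∀ k, ‖xh (k + 1) - (I.iter S (k + 1)).x‖ ≤ ε / (12 * I.Lf) := fun k =>
    (herr k).trans (by simpa using error_le (c := 1) hL hH (by simpa using h1 k))
  have he0 : ∀ k, ‖xh k - (I.iter S k).x‖ ≤ ε / (12 * I.Lf) := fun k => by
    cases k with
    | zero => rw [h0, iter, sub_self, norm_zero]; positivity
    | succ k => exact he k
  have hd : ∀ k, ‖xh (k + 1) - (I.iter S (k + 1)).x‖ ≤ δ := fun k => by
    refine (herr k).trans ?_
    calc specNorm I.H / I.τ * S.μ k (I.iter S k).x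
        ≤ specNorm I.H / I.τ * (I.τ * δ / specNorm I.H) := by
          gcongr
          exact h2 k
      _ = δ := by field_simp
  refine ⟨fun k => ?_, fun hK => ?_, fun k' hk' hmin => ?_⟩
  · obtain ⟨hdom, zs, hzs, hμ⟩ := hS k
    refine ⟨hdom, (Metric.infEDist_le_edist_of_mem hzs).trans ?_⟩
    rw [edist_dist, dist_eq_norm]
    exact ENNReal.ofReal_le_ofReal hμ
  -- With no iterations prescribed, `x⁰` is already optimal; the first exact step then cannot
  -- decrease the objective, hence has length zero, and `x⁰` is its own exact point.
  · have hΔ : I.Δ ≤ 0 := by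
      rw [outer, Nat.ceil_eq_zero] at hK
      by_contra hcon
      push Not at hcon
      have : 0 < 120 * I.Lf * I.Δ / ε ^ 2 := by positivity
      linarith
    have h3 := hsum 1
    have h4 := hV.obj_ge (hfeas 1)
    obtain ⟨zs, hzs, hx⟩ := hprim 0
    simp only [Finset.sum_range_one, zero_add, h0, iter, sub_self, norm_zero] at h3 hzs hx
    have h5 : I.Lf * ‖xh 1 - I.x0‖ ^ 2 ≤ 0 := by linarith
    have h6 : ‖xh 1 - I.x0‖ = 0 := by
      by_contra hcon
      have : 0 < I.Lf * ‖xh 1 - I.x0‖ ^ 2 := by positivity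
      linarith
    refine ⟨xh 1, ?_, by rw [norm_sub_rev, h6]; exact hδ.le⟩
    rw [hx] at h6 ⊢
    exact Problem.primal_isKKT hV.standing hL hV.zini_dom hzs
      (by rw [show I.primal (2 * I.Lf) I.x0 zs = I.primal I.τ I.x0 zs from rfl, h6]; linarith)
  · obtain ⟨zs, hzs, hx⟩ := hprim k'
    refine ⟨xh (k' + 1), ?_, by rw [norm_sub_rev]; exact hd k'⟩
    -- If the selected exact step were longer than `ε / (3 L_f)`, minimality and two errors of `ε /
    -- (12 L_f)` would make every exact step at least `ε / (6 L_f)`. Summed descent then contradicts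
    -- `1 / 36 > 1 / 96 + 1 / 120`.
    have key : ‖xh (k' + 1) - (I.iter S k').x‖ ≤ ε / (3 * I.Lf) := by
      by_contra hcon
      push Not at hcon
      set K := I.outer ε with hKdef
      have ht : ∀ k ∈ Finset.range K, I.Lf * (ε / (6 * I.Lf)) ^ 2
          ≤ I.Lf * ‖xh (k + 1) - (I.iter S k).x‖ ^ 2 := fun k hk => by
        have e1 := hmin k (Finset.mem_range.1 hk)
        have e2 : ‖(I.iter S (k + 1)).x - (I.iter S k).x‖
            ≤ ‖xh (k + 1) - (I.iter S k).x‖ + ‖xh (k + 1) - (I.iter S (k + 1)).x‖ := by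
          rw [norm_sub_rev (xh (k + 1)) (I.iter S (k + 1)).x]
          refine le_trans (le_of_eq ?_) (norm_add_le _ _)
          congr 1; abel
        have e3 : ‖xh (k' + 1) - (I.iter S k').x‖
            ≤ ‖xh (k' + 1) - (I.iter S (k' + 1)).x‖
              + ‖(I.iter S (k' + 1)).x - (I.iter S k').x‖ := by
          refine le_trans (le_of_eq ?_) (norm_add_le _ _)
          congr 1; abel
        have e4 : ε / (3 * I.Lf) = ε / (6 * I.Lf) + ε / (12 * I.Lf) + ε / (12 * I.Lf) := by
          field_simp; norm_num
        have e5 : ε / (6 * I.Lf) ≤ ‖xh (k + 1) - (I.iter S k).x‖ := by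
          linarith [he k, he k']
        gcongr
      have hs1 := Finset.sum_le_sum ht
      rw [Finset.sum_const, Finset.card_range, nsmul_eq_mul] at hs1
      have hs2 : ∑ k ∈ Finset.range K, 3 / 2 * I.Lf * ‖xh k - (I.iter S k).x‖ ^ 2
          ≤ ∑ k ∈ Finset.range K, 3 / 2 * I.Lf * (ε / (12 * I.Lf)) ^ 2 :=
        Finset.sum_le_sum fun k _ => by
          have := he0 k
          gcongr
      rw [Finset.sum_const, Finset.card_range, nsmul_eq_mul] at hs2
      have h3 := hsum K
      have h4 := hV.obj_ge (hfeas K)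
      have h5 : 120 * I.Lf * I.Δ / ε ^ 2 ≤ K := Nat.le_ceil _
      rw [div_le_iff₀ (by positivity)] at h5
      have hK0 : (0 : ℝ) < K := by exact_mod_cast (Nat.zero_le k').trans_lt hk'
      have h6 : (K : ℝ) * (I.Lf * (ε / (6 * I.Lf)) ^ 2)
          ≤ I.Δ + K * (3 / 2 * I.Lf * (ε / (12 * I.Lf)) ^ 2) := by linarith
      have h7 : I.Lf * ((K : ℝ) * (I.Lf * (ε / (6 * I.Lf)) ^ 2)) = K * ε ^ 2 / 36 := by
        field_simp; ring
      have h8 : I.Lf * ((K : ℝ) * (3 / 2 * I.Lf * (ε / (12 * I.Lf)) ^ 2)) = K * ε ^ 2 / 96 := by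
        field_simp; ring
      have h9 := mul_le_mul_of_nonneg_left h6 hL.le
      rw [mul_add, h7, h8] at h9
      have h10 : 0 < (K : ℝ) * ε ^ 2 := by positivity
      linarith
    rw [hx] at key ⊢
    refine Problem.primal_isKKT hV.standing hL hV.zini_dom hzs ?_
    rw [le_div_iff₀ (by positivity)] at key
    change 3 * I.Lf * ‖I.primal I.τ _ zs - _‖ ≤ ε
    linarith

end Input

/-! ### Tolerances, and polynomial bounds on iterates and gaps -/

namespace Input

variable {d m n : ℕ} {I : Input d m n}

variable (I) in
/-- The schedule for a growth modulus `ρ` and tolerances `w_k μ̄_k`. -/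
noncomputable def schedOf (ρ : E d → ℝ) (w : ℕ → ℝ) (ε δ : ℝ) : Schedule d where
  μ k x := w k * I.muBar ε δ x
  rounds k x := I.roundsFor (ρ x) (w k * I.muBar ε δ x) x
  steps _ x := ⌈2 * √(2 * I.LD I.τ / ρ x)⌉₊

theorem τ_pos (hL : 0 < I.Lf) : 0 < I.τ := by unfold τ; positivity

theorem Valid.LD_pos (hV : I.Valid) (hL : 0 < I.Lf) (hn : 0 < n) : 0 < I.LD I.τ :=
  div_pos (I.lamMax_H_pos hn hV.standing.rank) (τ_pos hL)

theorem Valid.specNorm_H_pos (hV : I.Valid) (hn : 0 < n) : 0 < specNorm I.H :=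
  I.toProblem.specNorm_H_pos hn hV.standing.rank

theorem Valid.B1_pos (hV : I.Valid) (hL : 0 < I.Lf) : 0 < I.B1 := by
  have h1 := specNorm_nonneg I.Abar
  have h2 := specNorm_nonneg I.A
  have h3 := specNorm_nonneg I.H
  have h4 := τ_pos hL
  have h5 := hV.σ_pos
  unfold B1
  positivity

theorem pinvNorm_nonneg : 0 ≤ I.pinvNorm := specNorm_nonneg _

theorem B2_pos : 0 < I.B2 := by
  have h1 := pinvNorm_nonneg (I := I)
  have h2 := specNorm_nonneg I.H
  unfold B2
  positivity

theorem Valid.B3_nonneg (hV : I.Valid) (x : E d) : 0 ≤ I.B3 x := by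
  have h1 := pinvNorm_nonneg (I := I)
  have h2 := specNorm_nonneg I.Abar
  have h3 := hV.standing.lg_pos
  unfold B3
  positivity

theorem Valid.B4_nonneg (hV : I.Valid) (hL : 0 < I.Lf) (x : E d) : 0 ≤ I.B4 x := by
  have h1 := hV.B3_nonneg x
  have h2 := specNorm_nonneg I.H
  have h3 := hV.standing.lg_pos
  have h4 := τ_pos hL
  unfold B4
  positivity

theorem muBar_le_eps (ε δ : ℝ) (x : E d) : I.muBar ε δ x ≤ ε / (6 * specNorm I.H) :=
  (min_le_right _ _).trans ((min_le_right _ _).trans (min_le_left _ _))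

theorem muBar_le_delta (ε δ : ℝ) (x : E d) : I.muBar ε δ x ≤ I.τ * δ / specNorm I.H :=
  (min_le_right _ _).trans (min_le_left _ _)

theorem Valid.norm_gradient_le (hV : I.Valid) (x : E d) :
    ‖gradient I.f0 x‖ ≤ ‖gradient I.f0 0‖ + I.Lf * ‖x‖ := by
  have h1 := hV.standing.lip x 0
  rw [sub_zero] at h1
  have h2 := norm_add_le (gradient I.f0 x - gradient I.f0 0) (gradient I.f0 0)
  rw [sub_add_cancel] at h2
  linarith

theorem exists_mul_le_min {X : Type*} {T : Set X} {f g m : X → ℝ} (hm : ∀ p ∈ T, 0 ≤ m p)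
    (hf : ∃ c > 0, ∀ p ∈ T, c * m p ≤ f p) (hg : ∃ c > 0, ∀ p ∈ T, c * m p ≤ g p) :
    ∃ c > 0, ∀ p ∈ T, c * m p ≤ min (f p) (g p) := by
  obtain ⟨c, hc, hf⟩ := hf
  obtain ⟨c', hc', hg⟩ := hg
  refine ⟨min c c', lt_min hc hc', fun p hp => le_min ?_ ?_⟩
  · exact (mul_le_mul_of_nonneg_right (min_le_left _ _) (hm p hp)).trans (hf p hp)
  · exact (mul_le_mul_of_nonneg_right (min_le_right _ _) (hm p hp)).trans (hg p hp)

/-- The tolerance is bounded below by a polynomial in the accuracies, as long as the iterate is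
polynomially bounded. -/
theorem Valid.exists_le_muBar (hV : I.Valid) (hL : 0 < I.Lf) (hn : 0 < n) {R : ℝ} (hR : 0 ≤ R) :
    ∃ c > 0, ∀ (x : E d) (ε δ : ℝ), 0 < ε → ε < 1 → 0 < δ → ‖x‖ ≤ R / ε ^ 2 →
      c * (min δ 1 * ε ^ 4) ≤ I.muBar ε δ x := by
  have hH := hV.specNorm_H_pos hn
  have hB1 := hV.B1_pos hL
  have hB2 := B2_pos (I := I)
  have hτ := τ_pos hL
  have hσ := hV.σ_pos
  have hlg := hV.standing.lg_pos
  have hAb := specNorm_nonneg I.Abar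
  have ha := pinvNorm_nonneg (I := I)
  -- The minimum in the tolerance is bounded term by term against one monomial, uniformly over this
  -- set. The power `4` is forced by the term containing the gradient, which may itself grow like
  -- `ε⁻²`.
  set T : Set (E d × ℝ × ℝ) :=
    {p | 0 < p.2.1 ∧ p.2.1 < 1 ∧ 0 < p.2.2 ∧ ‖p.1‖ ≤ R / p.2.1 ^ 2} with hT
  suffices H : ∃ c > 0, ∀ p ∈ T, c * (min p.2.2 1 * p.2.1 ^ 4) ≤ I.muBar p.2.1 p.2.2 p.1 by
    obtain ⟨c, hc, h⟩ := H
    exact ⟨c, hc, fun x ε δ h1 h2 h3 h4 => h (x, ε, δ) ⟨h1, h2, h3, h4⟩⟩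
  have hm : ∀ p ∈ T, 0 ≤ min p.2.2 1 * p.2.1 ^ 4 := fun p hp =>
    mul_nonneg (le_min hp.2.2.1.le zero_le_one) (pow_nonneg hp.1.le 4)
  have hm4 : ∀ p ∈ T, min p.2.2 1 * p.2.1 ^ 4 ≤ p.2.1 ^ 4 := fun p hp =>
    mul_le_of_le_one_left (pow_nonneg hp.1.le 4) (min_le_right _ _)
  have hm2 : ∀ p ∈ T, min p.2.2 1 * p.2.1 ^ 4 ≤ p.2.1 ^ 2 := fun p hp =>
    (hm4 p hp).trans (pow_le_pow_of_le_one hp.1.le hp.2.1.le (by norm_num))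
  have hm1 : ∀ p ∈ T, min p.2.2 1 * p.2.1 ^ 4 ≤ p.2.1 := fun p hp =>
    (hm4 p hp).trans (pow_le_of_le_one hp.1.le hp.2.1.le (by norm_num))
  have hδ : ∀ p ∈ T, min p.2.2 1 * p.2.1 ^ 4 ≤ p.2.2 := fun p hp =>
    (mul_le_of_le_one_right (le_min hp.2.2.1.le zero_le_one)
      (pow_le_one₀ hp.1.le hp.2.1.le)).trans (min_le_left _ _)
  have hlin : ∀ A : ℝ, 0 < A → ∃ c > 0, ∀ p ∈ T, c * (min p.2.2 1 * p.2.1 ^ 4) ≤ p.2.1 / A :=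
    fun A hA => ⟨1 / A, by positivity, fun p hp => by
      rw [one_div_mul_eq_div]; exact div_le_div_of_nonneg_right (hm1 p hp) hA.le⟩
  unfold muBar
  refine exists_mul_le_min hm ⟨1 / (480 * I.B1 * I.lg * I.Lf), by positivity, fun p hp => ?_⟩ <|
    exists_mul_le_min hm ⟨I.τ / specNorm I.H, by positivity, fun p hp => ?_⟩ <|
    exists_mul_le_min hm (hlin _ (by positivity)) <|
    exists_mul_le_min hm (hlin _ (by positivity)) <|
    exists_mul_le_min hm (hlin _ (by positivity)) <|
    exists_mul_le_min hm ?_ ?_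
  · rw [one_div_mul_eq_div]; exact div_le_div_of_nonneg_right (hm2 p hp) (by positivity)
  · rw [div_mul_eq_mul_div]
    have := hδ p hp
    gcongr
  · set G := ‖gradient I.f0 0‖ + I.Lf * R with hG
    set c3 := I.pinvNorm * (G + specNorm I.Abar * I.lg) with hc3
    set c4 := 1 / I.τ * (G + specNorm I.H * (I.lg + c3)) with hc4
    set K := c3 + I.σ * specNorm I.Abar * c4 + I.lg with hK
    have hG0 : 0 ≤ G := by positivity
    have hc30 : 0 ≤ c3 := by positivity
    have hc40 : 0 ≤ c4 := by positivity
    have hK0 : 0 < K := by positivity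
    refine ⟨1 / (12 * I.Lf * I.B1 * K), by positivity, fun p hp => ?_⟩
    obtain ⟨hε, hε1, -, hx⟩ := id hp
    set X := 1 / p.2.1 ^ 2 with hX
    have hX1 : 1 ≤ X := by
      rw [hX, le_div_iff₀ (by positivity), one_mul]; exact pow_le_one₀ hε.le hε1.le
    have hgx : ‖gradient I.f0 p.1‖ ≤ G * X := by
      have h1 := hV.norm_gradient_le p.1
      have h2 := mul_le_mul_of_nonneg_left hx hL.le
      have h3 : R / p.2.1 ^ 2 = R * X := by rw [hX]; ring
      rw [h3] at h2
      have h4 := le_mul_of_one_le_right (norm_nonneg (gradient I.f0 0)) hX1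
      rw [hG]; linarith
    have h3 : I.B3 p.1 ≤ c3 * X := by
      have h5 := le_mul_of_one_le_right (mul_nonneg hAb hlg.le) hX1
      have h6 := mul_le_mul_of_nonneg_left (add_le_add hgx h5) ha
      rw [B3, hc3]; linarith
    have h4 : I.B4 p.1 ≤ c4 * X := by
      have h5 := le_mul_of_one_le_right hlg.le hX1
      have h6 := mul_le_mul_of_nonneg_left (add_le_add h5 h3) hH.le
      have h7 := mul_le_mul_of_nonneg_left (add_le_add hgx h6) (one_div_pos.2 hτ).le
      rw [B4, hc4]; linarith
    have h5 : I.B3 p.1 + I.σ * specNorm I.Abar * I.B4 p.1 + I.lg ≤ K * X := by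
      have h6 := le_mul_of_one_le_right hlg.le hX1
      have h7 := mul_le_mul_of_nonneg_left h4 (mul_nonneg hσ.le hAb)
      rw [hK]; linarith
    have hpos : 0 < I.B3 p.1 + I.σ * specNorm I.Abar * I.B4 p.1 + I.lg := by
      have e1 := hV.B3_nonneg p.1
      have e2 := hV.B4_nonneg hL p.1
      positivity
    calc 1 / (12 * I.Lf * I.B1 * K) * (min p.2.2 1 * p.2.1 ^ 4)
        ≤ 1 / (12 * I.Lf * I.B1 * K) * p.2.1 ^ 4 := by
          have := hm4 p hp
          gcongr
      _ = p.2.1 ^ 2 / (12 * I.Lf * I.B1 * (K * X)) := by rw [hX]; field_simp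
      _ ≤ _ := by gcongr
  · set A := 12 * I.Lf * I.B1 * I.B2 * (1 + 1 / I.τ * I.σ * specNorm I.Abar * specNorm I.H)
    have hA : 0 < A := by positivity
    obtain ⟨c, hc, h⟩ := hlin (√A) (by positivity)
    refine ⟨c, hc, fun p hp => (h p hp).trans ?_⟩
    rw [Real.sqrt_div (sq_nonneg _), Real.sqrt_sq hp.1.le]

theorem Valid.muBar_pos (hV : I.Valid) (hL : 0 < I.Lf) (hn : 0 < n) {ε δ : ℝ} (hε : 0 < ε)
    (hε1 : ε < 1) (hδ : 0 < δ) (x : E d) : 0 < I.muBar ε δ x := by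
  obtain ⟨c, hc, h⟩ := hV.exists_le_muBar hL hn (R := ‖x‖) (norm_nonneg x)
  refine lt_of_lt_of_le ?_ (h x ε δ hε hε1 hδ ?_)
  · have : 0 < min δ 1 := lt_min hδ one_pos
    positivity
  · rw [le_div_iff₀ (by positivity)]
    exact mul_le_of_le_one_right (norm_nonneg x) (pow_le_one₀ hε.le hε1.le)

theorem le_two_pow_roundsFor {ρ μ : ℝ} {x : E d} (hρ : 0 < ρ) (hμ : 0 < μ) :
    2 * I.gap I.τ x I.zini ≤ 2 ^ I.roundsFor ρ μ x * (ρ * μ ^ 2) := by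
  rcases le_or_gt (I.gap I.τ x I.zini) 0 with hg | hg
  · have : 0 ≤ (2 : ℝ) ^ I.roundsFor ρ μ x * (ρ * μ ^ 2) := by positivity
    linarith
  · rw [← div_le_iff₀ (by positivity)]
    have h : Real.logb 2 (2 * I.gap I.τ x I.zini / (ρ * μ ^ 2)) ≤ (I.roundsFor ρ μ x : ℝ) :=
      Nat.le_ceil _
    rwa [Real.logb_le_iff_le_rpow one_lt_two (by positivity), Real.rpow_natCast] at h

theorem Adm.Lf_pos {ε : ℝ} (h : I.Adm ε) : 0 < I.Lf := by
  have h1 : 0 < √(3 * I.Lf) := h.1.trans (h.2.trans_le (min_le_left _ _))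
  have := Real.sqrt_pos.1 h1
  linarith

theorem Adm.lt_one {ε : ℝ} (h : I.Adm ε) : ε < 1 := h.2.trans_le (min_le_right _ _)

theorem Adm.sq_le {ε : ℝ} (h : I.Adm ε) : ε ^ 2 ≤ 3 * I.Lf := by
  have h1 : ε ≤ √(3 * I.Lf) := (h.2.trans_le (min_le_left _ _)).le
  exact (Real.le_sqrt h.1.le (by linarith [h.Lf_pos])).1 h1

variable {ρ : E d → ℝ} {w : ℕ → ℝ}

theorem innerAccurate_schedOf (hV : I.Valid) (hn : 0 < n) {ε δ : ℝ} (hε : I.Adm ε)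
    (hδ : 0 < δ) (hρ : ∀ x, 0 < ρ x) (hG : ∀ x, I.Growth I.τ x (ρ x) I.zini) (hw : ∀ k, 0 < w k) :
    I.InnerAccurate (I.schedOf ρ w ε δ) := fun k => by
  have hL := hε.Lf_pos
  have hμ : 0 < w k * I.muBar ε δ (I.iter (I.schedOf ρ w ε δ) k).x :=
    mul_pos (hw k) (hV.muBar_pos hL hn hε.1 hε.lt_one hδ _)
  exact (hG _).restartedAPG_dist_le (τ_pos hL) hV.standing.proper (hV.LD_pos hL hn) (hρ _)
    hV.zini_dom (Nat.le_ceil _) hμ.le (le_two_pow_roundsFor (hρ _) hμ)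

theorem finds_schedOf (hV : I.Valid) (hn : 0 < n) {ε δ : ℝ} (hε : I.Adm ε)
    (hδ : 0 < δ) (hρ : ∀ x, 0 < ρ x) (hG : ∀ x, I.Growth I.τ x (ρ x) I.zini)
    (hw : ∀ k, 0 < w k) (hw1 : ∀ k, w k ≤ 1) : I.Finds (I.schedOf ρ w ε δ) ε δ := by
  have hL := hε.Lf_pos
  have hle : ∀ k x, w k * I.muBar ε δ x ≤ I.muBar ε δ x := fun k x =>
    mul_le_of_le_one_left (hV.muBar_pos hL hn hε.1 hε.lt_one hδ x).le (hw1 k)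
  exact (innerAccurate_schedOf hV hn hε hδ hρ hG hw).finds hV hL (hV.specNorm_H_pos hn) hε.1 hδ
    (fun k => (hle k _).trans (muBar_le_eps _ _ _)) (fun k => (hle k _).trans (muBar_le_delta _ _ _))

theorem outer_mul_sq_le (hV : I.Valid) (hL : 0 < I.Lf) {ε : ℝ} (hε : 0 < ε) (hε1 : ε < 1) :
    (I.outer ε : ℝ) * ε ^ 2 ≤ 120 * I.Lf * I.Δ + 1 := by
  have hΔ := hV.Δ_nonneg
  have h1 : (I.outer ε : ℝ) < 120 * I.Lf * I.Δ / ε ^ 2 + 1 := Nat.ceil_lt_add_one (by positivity)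
  have h2 := mul_le_mul_of_nonneg_right h1.le (sq_nonneg ε)
  rw [add_mul, div_mul_cancel₀ _ (by positivity)] at h2
  have h3 : ε ^ 2 ≤ 1 := pow_le_one₀ hε.le hε1.le
  linarith

/-- The iterates grow at most polynomially in `1 / ε`. -/
theorem exists_norm_iter_le (hV : I.Valid) (hL : 0 < I.Lf) (hH : 0 < specNorm I.H) :
    ∃ R, 0 ≤ R ∧ ∀ (S : Schedule d) (ε : ℝ), 0 < ε → ε < 1 → I.InnerAccurate S →
      (∀ k, S.μ k (I.iter S k).x ≤ ε / (6 * specNorm I.H)) →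
      ∀ k ≤ I.outer ε, ‖(I.iter S k).x‖ ≤ R / ε ^ 2 := by
  have hΔ := hV.Δ_nonneg
  set κ := 120 * I.Lf * I.Δ + 1 with hκ
  have hκ0 : 0 < κ := by positivity
  set c := √((I.Δ + κ / (96 * I.Lf)) / I.Lf) + 1 / (12 * I.Lf) with hc
  have hc0 : 0 ≤ c := by positivity
  refine ⟨‖I.x0‖ + κ * c, by positivity, fun S ε hε hε1 hS hμ => ?_⟩
  obtain ⟨xh, h0, -, herr, hfeas, hsum⟩ := hS.exact_points hV hL
  have he : ∀ k, ‖xh (k + 1) - (I.iter S (k + 1)).x‖ ≤ ε / (12 * I.Lf) := fun k =>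
    (herr k).trans (by simpa using error_le (c := 1) hL hH (by simpa using hμ k))
  have he0 : ∀ k, ‖xh k - (I.iter S k).x‖ ≤ ε / (12 * I.Lf) := fun k => by
    cases k with
    | zero => rw [h0, iter, sub_self, norm_zero]; positivity
    | succ k => exact he k
  have hK := outer_mul_sq_le hV hL hε hε1
  rw [← hκ] at hK
  -- A single step is bounded by the whole telescoped sum, whose error part stays bounded because
  -- `outer ε * ε²` does.
  have hstep : ∀ k < I.outer ε, ‖(I.iter S (k + 1)).x - (I.iter S k).x‖ ≤ c := fun k hk => by
    have h1 : I.Lf * ‖xh (k + 1) - (I.iter S k).x‖ ^ 2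
        ≤ ∑ k ∈ Finset.range (I.outer ε), I.Lf * ‖xh (k + 1) - (I.iter S k).x‖ ^ 2 :=
      Finset.single_le_sum (f := fun k => I.Lf * ‖xh (k + 1) - (I.iter S k).x‖ ^ 2)
        (fun i _ => by positivity) (Finset.mem_range.2 hk)
    have h2 : ∑ k ∈ Finset.range (I.outer ε), 3 / 2 * I.Lf * ‖xh k - (I.iter S k).x‖ ^ 2
        ≤ ∑ k ∈ Finset.range (I.outer ε), 3 / 2 * I.Lf * (ε / (12 * I.Lf)) ^ 2 :=
      Finset.sum_le_sum fun k _ => by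
        have := he0 k
        gcongr
    rw [Finset.sum_const, Finset.card_range, nsmul_eq_mul] at h2
    have h3 := hsum (I.outer ε)
    have h4 := hV.obj_ge (hfeas (I.outer ε))
    have h5 : (I.outer ε : ℝ) * (3 / 2 * I.Lf * (ε / (12 * I.Lf)) ^ 2)
        = I.outer ε * ε ^ 2 / (96 * I.Lf) := by field_simp; ring
    have h6 : (I.outer ε : ℝ) * ε ^ 2 / (96 * I.Lf) ≤ κ / (96 * I.Lf) := by gcongr
    have h7 : ‖xh (k + 1) - (I.iter S k).x‖ ≤ √((I.Δ + κ / (96 * I.Lf)) / I.Lf) := by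
      refine Real.le_sqrt_of_sq_le ?_
      rw [le_div_iff₀ hL]
      linarith
    have h8 : ‖(I.iter S (k + 1)).x - (I.iter S k).x‖
        ≤ ‖xh (k + 1) - (I.iter S k).x‖ + ‖xh (k + 1) - (I.iter S (k + 1)).x‖ := by
      rw [norm_sub_rev (xh (k + 1)) (I.iter S (k + 1)).x]
      refine le_trans (le_of_eq ?_) (norm_add_le _ _)
      congr 1; abel
    have h9 : ε / (12 * I.Lf) ≤ 1 / (12 * I.Lf) := by gcongr
    have := he k
    rw [hc]; linarith
  have hlin : ∀ k ≤ I.outer ε, ‖(I.iter S k).x‖ ≤ ‖I.x0‖ + k * c := fun k hk => by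
    induction k with
    | zero => simp [iter]
    | succ k ih =>
      have h1 := ih (by omega)
      have h2 := hstep k (by omega)
      have h3 := norm_add_le ((I.iter S (k + 1)).x - (I.iter S k).x) (I.iter S k).x
      rw [sub_add_cancel] at h3
      push_cast
      linarith
  intro k hk
  rw [le_div_iff₀ (by positivity)]
  have h1 : (k : ℝ) ≤ I.outer ε := by exact_mod_cast hk
  have h2 : (k : ℝ) * ε ^ 2 ≤ κ := (mul_le_mul_of_nonneg_right h1 (sq_nonneg ε)).trans hK
  have h3 : ε ^ 2 ≤ 1 := pow_le_one₀ hε.le hε1.le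
  calc ‖(I.iter S k).x‖ * ε ^ 2 ≤ (‖I.x0‖ + k * c) * ε ^ 2 := by
        have := hlin k hk
        gcongr
    _ = ‖I.x0‖ * ε ^ 2 + (k * ε ^ 2) * c := by ring
    _ ≤ ‖I.x0‖ * 1 + κ * c := by gcongr
    _ = ‖I.x0‖ + κ * c := by ring

/-- The initial dual gap grows at most quadratically with the iterate. -/
theorem exists_gap_le (hV : I.Valid) (hL : 0 < I.Lf) :
    ∃ c > 0, ∀ (x : E d) (X : ℝ), (I.Omega I.τ x).Nonempty → 1 ≤ X → ‖x‖ ≤ X →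
      I.gap I.τ x I.zini ≤ c * X ^ 2 := by
  have hτ := τ_pos hL
  set g₀ := (I.g (mv I.Abar I.x0 + I.bbar)).toReal with hg₀
  set s := ‖gradient I.f0 0‖ + I.Lf + I.τ with hs
  set c₀ := |(conj I.g I.zini.fst).toReal| + |I.rhs I.zini| + I.τ / 2 * ‖I.x0‖ ^ 2 + |g₀| with hc₀
  have hs0 : 0 < s := by positivity
  have hc0 : 0 ≤ c₀ := by positivity
  refine ⟨c₀ + 1 / (2 * I.τ) * (‖I.HT I.zini‖ + s) ^ 2 + s * ‖I.x0‖, by positivity,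
    fun x X hne hX hx => ?_⟩
  obtain ⟨zs, hzs⟩ := hne
  have hX0 : 0 ≤ X := by linarith
  have hX2 : X ≤ X ^ 2 := by nlinarith
  have h1 := Problem.gap_eq hV.standing.proper hV.zini_dom hzs
  -- The feasible starting point bounds the dual optimum below, so the gap is at most quadratic in
  -- the shift and therefore in `X`.
  have h2 := Problem.Dr_lower_bound (x := x) hτ hV.standing.proper hV.feasible_x0.1
    hV.feasible_x0.2 (Problem.Omega_dom hV.standing.proper hV.zini_dom hzs)
  have hsh : ‖I.shift I.τ x‖ ≤ s * X := by
    have e1 : ‖I.shift I.τ x‖ ≤ ‖gradient I.f0 x‖ + I.τ * ‖x‖ := by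
      refine (norm_sub_le _ _).trans ?_
      rw [norm_smul, Real.norm_of_nonneg hτ.le]
    have e2 := hV.norm_gradient_le x
    have e3 : ‖gradient I.f0 0‖ ≤ ‖gradient I.f0 0‖ * X :=
      le_mul_of_one_le_right (norm_nonneg _) hX
    have e4 : I.Lf * ‖x‖ ≤ I.Lf * X := by gcongr
    have e5 : I.τ * ‖x‖ ≤ I.τ * X := by gcongr
    rw [hs]; linarith
  have h3 : ‖I.HT I.zini + I.shift I.τ x‖ ≤ (‖I.HT I.zini‖ + s) * X := by
    have e1 := norm_add_le (I.HT I.zini) (I.shift I.τ x)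
    have e2 := le_mul_of_one_le_right (norm_nonneg (I.HT I.zini)) hX
    linarith
  have h4 : 1 / (2 * I.τ) * ‖I.HT I.zini + I.shift I.τ x‖ ^ 2
      ≤ 1 / (2 * I.τ) * (‖I.HT I.zini‖ + s) ^ 2 * X ^ 2 := by
    rw [mul_assoc, ← mul_pow]; gcongr
  have h5 : ‖I.shift I.τ x‖ * ‖I.x0‖ ≤ s * ‖I.x0‖ * X ^ 2 := by
    calc ‖I.shift I.τ x‖ * ‖I.x0‖ ≤ s * X * ‖I.x0‖ := by gcongr
      _ = s * ‖I.x0‖ * X := by ring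
      _ ≤ s * ‖I.x0‖ * X ^ 2 := by gcongr
  have h6 : c₀ ≤ c₀ * X ^ 2 := le_mul_of_one_le_right hc0 (one_le_pow₀ hX)
  have h7 := le_abs_self (conj I.g I.zini.fst).toReal
  have h8 := le_abs_self (I.rhs I.zini)
  have h9 := le_abs_self g₀
  rw [h1, Problem.Dr, Problem.smooth]
  rw [← hg₀] at h2
  linarith

end Input

/-! ### Counting accelerated steps -/

namespace Input

variable {d m n : ℕ} {I : Input d m n} {ρ : E d → ℝ} {w : ℕ → ℝ}

/-- The hypothesis `1 ≤ a` lets the `+ 1` from rounding up be absorbed into `√a`. -/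
theorem steps_le {a Q : ℝ} (ha : 1 ≤ a) (hQ : √a ≤ Q) : (⌈2 * √(2 * a)⌉₊ : ℝ) ≤ 4 * Q := by
  have h1 : (⌈2 * √(2 * a)⌉₊ : ℝ) < 2 * √(2 * a) + 1 := Nat.ceil_lt_add_one (by positivity)
  have h2 : √(2 * a) ≤ 3 / 2 * √a := by
    rw [Real.sqrt_le_left (by positivity), mul_pow, Real.sq_sqrt (by linarith)]
    linarith
  have h3 : 1 ≤ √a := Real.one_le_sqrt.2 ha
  linarith

/-- The factor `2` replaces `1 / log 2`, since `2 log 2 ≥ 1`; `N` is the degree of polynomial growth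
of the argument. -/
theorem roundsFor_le {ρ μ : ℝ} {x : E d} {M η : ℝ} {N : ℕ} (hM : 1 ≤ M) (hη : 0 < η)
    (hη1 : η ≤ 1) (hpos : 0 < 2 * I.gap I.τ x I.zini / (ρ * μ ^ 2))
    (hle : 2 * I.gap I.τ x I.zini / (ρ * μ ^ 2) ≤ M / η ^ N) :
    (I.roundsFor ρ μ x : ℝ) ≤ 2 * N * Real.log (1 / η) + (2 * Real.log M + 1) := by
  have hlM : 0 ≤ Real.log M := Real.log_nonneg hM
  have hlη : 0 ≤ Real.log (1 / η) := Real.log_nonneg (by rw [le_div_iff₀ hη]; linarith)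
  have h1 : Real.log (2 * I.gap I.τ x I.zini / (ρ * μ ^ 2)) ≤ Real.log M + N * Real.log (1 / η) := by
    refine (Real.log_le_log hpos hle).trans (le_of_eq ?_)
    rw [Real.log_div (by positivity) (by positivity), Real.log_pow, one_div, Real.log_inv]
    ring
  have h2 : Real.logb 2 (2 * I.gap I.τ x I.zini / (ρ * μ ^ 2))
      ≤ 2 * (Real.log M + N * Real.log (1 / η)) := by
    rw [Real.logb, div_le_iff₀ (Real.log_pos one_lt_two)]
    have h3 : 1 ≤ 2 * Real.log 2 := by linarith [Real.log_two_gt_d9]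
    have h4 : 0 ≤ Real.log M + N * Real.log (1 / η) := by positivity
    nlinarith
  have h3 : (I.roundsFor ρ μ x : ℝ) ≤
      (⌈2 * (Real.log M + N * Real.log (1 / η))⌉₊ : ℝ) := by
    exact_mod_cast Nat.ceil_le_ceil h2
  have h4 := Nat.ceil_lt_add_one (a := 2 * (Real.log M + N * Real.log (1 / η))) (by positivity)
  linarith

theorem roundsFor_eq_zero {ρ μ : ℝ} {x : E d} (h : I.gap I.τ x I.zini = 0) :
    I.roundsFor ρ μ x = 0 := by
  simp [roundsFor, h]

/-- From a bound on the work per outer iteration to the overall complexity. -/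
theorem complexity_of_bound {Q B c M : ℝ} (hΔ : 0 ≤ I.Δ) (hQ : 0 ≤ Q) (hB : 0 < B) (hc : 1 ≤ c)
    (hM : 0 ≤ M) {N : ℝ → ℝ → ℕ}
    (hN : ∀ ε δ, I.Adm ε → 0 < δ →
      (N ε δ : ℝ) ≤ I.outer ε * (4 * Q * (c * Real.log (1 / (min δ 1 * ε)) + M))) :
    I.Complexity (1920 * c) Q B N := by
  have hη : ∀ ε δ, I.Adm ε → 0 < δ → 0 < min δ 1 * ε ∧ min δ 1 * ε ≤ ε := fun ε δ hε hδ =>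
    ⟨mul_pos (lt_min hδ one_pos) hε.1, mul_le_of_le_one_left hε.1.le (min_le_right _ _)⟩
  have hlog : ∀ ε δ, I.Adm ε → 0 < δ →
      Real.log (B / (min δ 1 * ε)) = Real.log B + Real.log (1 / (min δ 1 * ε)) := fun ε δ hε hδ => by
    rw [Real.log_div hB.ne' (hη ε δ hε hδ).1.ne', one_div, Real.log_inv]; ring
  have hl0 : ∀ ε δ, I.Adm ε → 0 < δ → 0 ≤ Real.log (1 / (min δ 1 * ε)) := fun ε δ hε hδ =>
    Real.log_nonneg (by
      rw [le_div_iff₀ (hη ε δ hε hδ).1]; linarith [(hη ε δ hε hδ).2, hε.lt_one])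
  have hbound : ∀ ε δ, I.Adm ε → 0 < δ → (N ε δ : ℝ)
      ≤ 480 * c * Q * (Real.log (1 / (min δ 1 * ε)) + M) * ⌈I.Lf * I.Δ / ε ^ 2⌉₊ := fun ε δ hε hδ => by
    have h1 : (I.outer ε : ℝ) ≤ 120 * ⌈I.Lf * I.Δ / ε ^ 2⌉₊ := by
      have : I.outer ε ≤ 120 * ⌈I.Lf * I.Δ / ε ^ 2⌉₊ := by
        rw [outer, Nat.ceil_le]
        push_cast
        have := Nat.le_ceil (I.Lf * I.Δ / ε ^ 2)
        calc 120 * I.Lf * I.Δ / ε ^ 2 = 120 * (I.Lf * I.Δ / ε ^ 2) := by ring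
          _ ≤ _ := by gcongr
      exact_mod_cast this
    have h0 := hl0 ε δ hε hδ
    have h2 : c * Real.log (1 / (min δ 1 * ε)) + M ≤ c * (Real.log (1 / (min δ 1 * ε)) + M) := by
      have := le_mul_of_one_le_left hM hc
      linarith
    calc (N ε δ : ℝ) ≤ I.outer ε * (4 * Q * (c * Real.log (1 / (min δ 1 * ε)) + M)) :=
          hN ε δ hε hδ
      _ ≤ (120 * ⌈I.Lf * I.Δ / ε ^ 2⌉₊) * (4 * Q * (c * (Real.log (1 / (min δ 1 * ε)) + M))) := by
          gcongr
      _ = _ := by ring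
  constructor
  -- The additive constant undoes the `log B` hidden in the stated logarithm.
  · refine ⟨M - Real.log B, fun ε δ hε hδ => (hbound ε δ hε hδ).trans ?_⟩
    rw [hlog ε δ hε hδ]
    have h0 := hl0 ε δ hε hδ
    rw [show Real.log B + Real.log (1 / (min δ 1 * ε)) + (M - Real.log B)
      = Real.log (1 / (min δ 1 * ε)) + M by ring]
    gcongr
    norm_num
  · rcases hΔ.eq_or_lt with hΔ0 | hΔ0
    · refine ⟨1, one_pos, fun ε δ hε _ hδ => ?_⟩
      have := hbound ε δ hε hδ
      simpa [← hΔ0] using this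
    · by_cases hL : 0 < I.Lf
      swap
      · exact ⟨1, one_pos, fun ε δ hε _ _ => absurd hε.Lf_pos hL⟩
      -- The first threshold makes `L_f Δ / ε² ≥ 1`, so rounding up costs a factor `2`; the second
      -- makes the logarithm outweigh `M` and `log B`, for another factor `2`.
      refine ⟨min (√(I.Lf * I.Δ)) (Real.exp (-(M + 2 * |Real.log B|))),
        lt_min (Real.sqrt_pos.2 (by positivity)) (Real.exp_pos _), fun ε δ hε hε0 hδ =>
        (hbound ε δ hε hδ).trans ?_⟩
      have h1 : ε ^ 2 ≤ I.Lf * I.Δ :=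
        (Real.le_sqrt hε.1.le (by positivity)).1 (hε0.trans_le (min_le_left _ _)).le
      have h2 : 1 ≤ I.Lf * I.Δ / ε ^ 2 := by
        have := pow_pos hε.1 2
        rwa [le_div_iff₀ this, one_mul]
      have h3 : (⌈I.Lf * I.Δ / ε ^ 2⌉₊ : ℝ) ≤ 2 * (I.Lf * I.Δ / ε ^ 2) := by
        have := Nat.ceil_lt_add_one (a := I.Lf * I.Δ / ε ^ 2) (by linarith)
        linarith
      have h4 : M + 2 * |Real.log B| ≤ Real.log (1 / (min δ 1 * ε)) := by
        have h5 := (hη ε δ hε hδ).2.trans (hε0.trans_le (min_le_right _ _)).le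
        have h6 := Real.log_le_log (hη ε δ hε hδ).1 h5
        rw [Real.log_exp] at h6
        rw [one_div, Real.log_inv]
        linarith
      rw [hlog ε δ hε hδ]
      have h7 : Real.log (1 / (min δ 1 * ε)) + M
          ≤ 2 * (Real.log B + Real.log (1 / (min δ 1 * ε))) := by
        linarith [neg_abs_le (Real.log B)]
      have h0 := hl0 ε δ hε hδ
      have h8 : 0 ≤ Real.log B + Real.log (1 / (min δ 1 * ε)) := by linarith
      calc 480 * c * Q * (Real.log (1 / (min δ 1 * ε)) + M) * ⌈I.Lf * I.Δ / ε ^ 2⌉₊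
          ≤ 480 * c * Q * (2 * (Real.log B + Real.log (1 / (min δ 1 * ε))))
            * (2 * (I.Lf * I.Δ / ε ^ 2)) := by gcongr
        _ = _ := by ring

/-- The lower bound on the weights covers both constant weights and the summable ones, so all three
cases share this count. -/
theorem complexity_schedOf (hV : I.Valid) (hn : 0 < n) (hρ : ∀ x, 0 < ρ x)
    (hG : ∀ x, I.Growth I.τ x (ρ x) I.zini) (hw : ∀ k : ℕ, 1 / ((k : ℝ) + 1) ^ 2 ≤ w k)
    (hw1 : ∀ k, w k ≤ 1) {Q B : ℝ} (hQ : 0 ≤ Q) (hB : 0 < B)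
    (hQρ : ∀ ε δ, I.Adm ε → 0 < δ → ∀ k < I.outer ε,
      √(I.LD I.τ / ρ (I.iter (I.schedOf ρ w ε δ) k).x) ≤ Q) :
    I.Complexity 76800 Q B (fun ε δ => I.total (I.schedOf ρ w ε δ) ε) := by
  -- Here `1920 = 120 · 4 · 4`, from the outer count, the steps per round and the two absorptions;
  -- `40 = 2 · 20`, with `20` the degree found below.
  rw [show (76800 : ℝ) = 1920 * 40 by norm_num]
  by_cases hL : 0 < I.Lf
  swap
  · exact ⟨⟨0, fun ε δ hε _ => absurd hε.Lf_pos hL⟩,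
      ⟨1, one_pos, fun ε δ hε _ _ => absurd hε.Lf_pos hL⟩⟩
  have hw0 : ∀ k, 0 < w k := fun k => lt_of_lt_of_le (by positivity) (hw k)
  have hLD := hV.LD_pos hL hn
  have hΔ := hV.Δ_nonneg
  obtain ⟨R, hR0, hR⟩ := exists_norm_iter_le hV hL (hV.specNorm_H_pos hn)
  obtain ⟨cm, hcm, hmu⟩ := hV.exists_le_muBar hL hn hR0
  obtain ⟨cg, hcg, hgap⟩ := exists_gap_le hV hL
  set κ := 120 * I.Lf * I.Δ + 1 with hκ
  have hκ0 : 0 < κ := by positivity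
  set M₀ := 2 * (cg * (R + 1) ^ 2) * (Q ^ 2 / I.LD I.τ) / (cm / κ ^ 2) ^ 2 with hM₀
  have hM₀0 : 0 ≤ M₀ := by positivity
  have hM1 : 1 ≤ max 1 M₀ := le_max_left _ _
  refine complexity_of_bound (M := 2 * Real.log (max 1 M₀) + 1) hΔ hQ hB (by norm_num)
    (by have := Real.log_nonneg hM1; positivity) fun ε δ hε hδ => ?_
  have hε0 := hε.1
  have hε1 := hε.lt_one
  have hη : 0 < min δ 1 * ε := mul_pos (lt_min hδ one_pos) hε0
  have hδ1 : min δ 1 ≤ 1 := min_le_right _ _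
  have hδ0 : 0 < min δ 1 := lt_min hδ one_pos
  have hη1 : min δ 1 * ε ≤ 1 := mul_le_one₀ hδ1 hε0.le hε1.le
  have hlη : 0 ≤ Real.log (1 / (min δ 1 * ε)) :=
    Real.log_nonneg (by rw [le_div_iff₀ hη]; linarith)
  have hlM := Real.log_nonneg hM1
  have hinner := innerAccurate_schedOf hV hn hε hδ hρ hG hw0
  have hmule : ∀ k x, w k * I.muBar ε δ x ≤ ε / (6 * specNorm I.H) := fun k x =>
    (mul_le_of_le_one_left (hV.muBar_pos hL hn hε0 hε1 hδ x).le (hw1 k)).trans (muBar_le_eps _ _ _)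
  have hx := hR (I.schedOf ρ w ε δ) ε hε0 hε1 hinner fun k => hmule k _
  have hterm : ∀ k ∈ Finset.range (I.outer ε),
      (((I.schedOf ρ w ε δ).rounds k (I.iter (I.schedOf ρ w ε δ) k).x
        * (I.schedOf ρ w ε δ).steps k (I.iter (I.schedOf ρ w ε δ) k).x : ℕ) : ℝ)
      ≤ 4 * Q * (40 * Real.log (1 / (min δ 1 * ε)) + (2 * Real.log (max 1 M₀) + 1)) := by
    intro k hk
    have hk := Finset.mem_range.1 hk
    have hxk := hx k hk.le
    have hQk := hQρ ε δ hε hδ k hk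
    set x := (I.iter (I.schedOf ρ w ε δ) k).x with hxdef
    change ((I.roundsFor (ρ x) (w k * I.muBar ε δ x) x * ⌈2 * √(2 * I.LD I.τ / ρ x)⌉₊ : ℕ) : ℝ) ≤ _
    push_cast
    obtain ⟨zs, hzs⟩ := (hG x).1
    -- A zero gap means no rounds at all. It must be split off, since `ρ ≤ L_𝒟` is available only
    -- for a positive gap.
    rcases (Problem.gap_nonneg hV.standing.proper hV.zini_dom hzs).eq_or_lt with hg0 | hg0
    · rw [roundsFor_eq_zero hg0.symm]
      simp only [Nat.cast_zero, zero_mul]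
      positivity
    have hρx := hρ x
    have hsteps : (⌈2 * √(2 * I.LD I.τ / ρ x)⌉₊ : ℝ) ≤ 4 * Q := by
      rw [mul_div_assoc]
      refine steps_le ?_ hQk
      rw [le_div_iff₀ hρx, one_mul]
      exact (hG x).le_LD (τ_pos hL) hV.standing.proper hV.zini_dom hn hV.standing.rank hg0 hρx
    have hμ0 : 0 < w k * I.muBar ε δ x := mul_pos (hw0 k) (hV.muBar_pos hL hn hε0 hε1 hδ x)
    have hwk : ε ^ 4 / κ ^ 2 ≤ w k := by
      refine le_trans ?_ (hw k)
      have h1 : ((k : ℝ) + 1) * ε ^ 2 ≤ κ := by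
        have h2 : (k : ℝ) + 1 ≤ I.outer ε := by exact_mod_cast hk
        exact (mul_le_mul_of_nonneg_right h2 (sq_nonneg ε)).trans (outer_mul_sq_le hV hL hε0 hε1)
      rw [div_le_div_iff₀ (by positivity) (by positivity), one_mul]
      calc ε ^ 4 * ((k : ℝ) + 1) ^ 2 = (((k : ℝ) + 1) * ε ^ 2) ^ 2 := by ring
        _ ≤ κ ^ 2 := by gcongr
    have hμ : cm / κ ^ 2 * (min δ 1 * ε ^ 8) ≤ w k * I.muBar ε δ x := by
      calc cm / κ ^ 2 * (min δ 1 * ε ^ 8) = ε ^ 4 / κ ^ 2 * (cm * (min δ 1 * ε ^ 4)) := by ring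
        _ ≤ w k * I.muBar ε δ x :=
          mul_le_mul hwk (hmu x ε δ hε0 hε1 hδ hxk) (by positivity) (hw0 k).le
    have hgk : I.gap I.τ x I.zini ≤ cg * (R + 1) ^ 2 / ε ^ 4 := by
      have h1 : 1 ≤ 1 / ε ^ 2 := by
        rw [le_div_iff₀ (by positivity), one_mul]; exact pow_le_one₀ hε0.le hε1.le
      have h2 : 1 ≤ (R + 1) / ε ^ 2 := by
        have : R / ε ^ 2 + 1 / ε ^ 2 = (R + 1) / ε ^ 2 := by ring
        have : 0 ≤ R / ε ^ 2 := by positivity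
        linarith
      have h3 : ‖x‖ ≤ (R + 1) / ε ^ 2 := hxk.trans (by gcongr; linarith)
      refine (hgap x _ ⟨zs, hzs⟩ h2 h3).trans (le_of_eq ?_)
      rw [div_pow, ← pow_mul, mul_div_assoc]
    have hρk : 1 / ρ x ≤ Q ^ 2 / I.LD I.τ := by
      rw [le_div_iff₀ hLD, one_div_mul_eq_div]
      exact (Real.sqrt_le_left hQ).1 hQk
    -- The degree is `4` from the initial gap plus `16` from the squared tolerance, whose weight and
    -- `μ̄` contribute `ε⁴` each; `1 / ρ` is bounded through `Q`.
    have hle : 2 * I.gap I.τ x I.zini / (ρ x * (w k * I.muBar ε δ x) ^ 2)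
        ≤ max 1 M₀ / (min δ 1 * ε) ^ 20 := by
      have e1 : (cm / κ ^ 2 * (min δ 1 * ε ^ 8)) ^ 2 ≤ (w k * I.muBar ε δ x) ^ 2 := by gcongr
      calc 2 * I.gap I.τ x I.zini / (ρ x * (w k * I.muBar ε δ x) ^ 2)
          = 2 * I.gap I.τ x I.zini * (1 / ρ x) / (w k * I.muBar ε δ x) ^ 2 := by field_simp
        _ ≤ 2 * (cg * (R + 1) ^ 2 / ε ^ 4) * (Q ^ 2 / I.LD I.τ)
            / (cm / κ ^ 2 * (min δ 1 * ε ^ 8)) ^ 2 := by gcongr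
        _ = M₀ / ((min δ 1) ^ 2 * ε ^ 20) := by rw [hM₀]; field_simp
        _ ≤ max 1 M₀ / (min δ 1 * ε) ^ 20 := by
          rw [mul_pow]
          have e2 : (min δ 1) ^ 20 ≤ (min δ 1) ^ 2 :=
            pow_le_pow_of_le_one hδ0.le hδ1 (by norm_num)
          gcongr
          exact le_max_right _ _
    have hrounds := roundsFor_le (I := I) (N := 20) hM1 hη hη1 (by positivity) hle
    calc (I.roundsFor (ρ x) (w k * I.muBar ε δ x) x : ℝ) * ⌈2 * √(2 * I.LD I.τ / ρ x)⌉₊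
        ≤ (2 * (20 : ℕ) * Real.log (1 / (min δ 1 * ε)) + (2 * Real.log (max 1 M₀) + 1)) * (4 * Q) :=
          mul_le_mul hrounds hsteps (Nat.cast_nonneg _) (by positivity)
      _ = _ := by push_cast; ring
  change ((∑ k ∈ Finset.range (I.outer ε), _ : ℕ) : ℝ) ≤ _
  rw [Nat.cast_sum]
  refine (Finset.sum_le_sum hterm).trans (le_of_eq ?_)
  rw [Finset.sum_const, Finset.card_range, nsmul_eq_mul]

end Input

/-! ### Compact level sets, degenerate inputs and the three cases -/

namespace Input

variable {d m n : ℕ} {I : Input d m n} {ρ : E d → ℝ} {w : ℕ → ℝ}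

/-- The right-hand side telescopes, with increments `2 / ((K + 1) (K + 2))` that dominate the
summands. -/
theorem sum_inv_sq_sq_le (K : ℕ) :
    ∑ k ∈ Finset.range K, (1 / ((k : ℝ) + 1) ^ 2) ^ 2 ≤ 2 - 2 / ((K : ℝ) + 1) := by
  induction K with
  | zero => simp
  | succ K ih =>
    rw [Finset.sum_range_succ]
    have h : (1 / ((K : ℝ) + 1) ^ 2) ^ 2 ≤ 2 / ((K : ℝ) + 1) - 2 / ((K : ℝ) + 1 + 1) := by
      have hK : (0 : ℝ) ≤ K := K.cast_nonneg
      have e : 2 / ((K : ℝ) + 1) - 2 / ((K : ℝ) + 1 + 1)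
          = 2 / (((K : ℝ) + 1) * ((K : ℝ) + 1 + 1)) := by field_simp; ring
      rw [e, div_pow, one_pow, ← pow_mul, div_le_div_iff₀ (by positivity) (by positivity)]
      have h1 : (1 : ℝ) ≤ K + 1 := by linarith
      have h2 : ((K : ℝ) + 1) ^ 1 ≤ ((K : ℝ) + 1) ^ (2 * 2) := pow_le_pow_right₀ h1 (by norm_num)
      have h3 : ((K : ℝ) + 1) ^ 2 ≤ ((K : ℝ) + 1) ^ (2 * 2) := pow_le_pow_right₀ h1 (by norm_num)
      linarith
    push_cast
    linarith

/-- With summable tolerances, the exact points stay in a level set of the objective. -/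
theorem exists_bounds_of_isCompact (hV : I.Valid) (hn : 0 < n) (hρ : ∀ x, 0 < ρ x)
    (hG : ∀ x, I.Growth I.τ x (ρ x) I.zini) (hw : ∀ k, w k = 1 / ((k : ℝ) + 1) ^ 2)
    (hc : IsCompact {q : E d × E m | I.F q.1 q.2 ≤ I.F I.x0 I.y0 + 1}) (hL : 0 < I.Lf) :
    ∃ B5 B6 : ℝ, ∀ ε δ, I.Adm ε → 0 < δ → ∀ k,
      ‖I.nu I.τ (I.iter (I.schedOf ρ w ε δ) k).x‖ ^ 2 ≤ B5 ∧
      I.gap I.τ (I.iter (I.schedOf ρ w ε δ) k).x I.zini ≤ B6 := by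
  have hτ := τ_pos hL
  obtain ⟨R, hR⟩ := hc.isBounded.exists_norm_le
  obtain ⟨c, hc0, hgap⟩ := exists_gap_le hV hL
  have hH := hV.specNorm_H_pos hn
  refine ⟨(I.τ * R) ^ 2, c * (max 1 (R + 1 / (12 * I.Lf))) ^ 2, fun ε δ hε hδ => ?_⟩
  have hε0 := hε.1
  have hw0 : ∀ k, 0 < w k := fun k => by rw [hw]; positivity
  have hw1 : ∀ k, w k ≤ 1 := fun k => by
    rw [hw, div_le_one (by positivity)]
    exact one_le_pow₀ (by linarith [(Nat.cast_nonneg k : (0 : ℝ) ≤ k)])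
  have hS := innerAccurate_schedOf hV hn hε hδ hρ hG hw0
  obtain ⟨xh, h0, hprim, herr, hfeas, hsum⟩ := hS.exact_points hV hL
  set S := I.schedOf ρ w ε δ
  have he : ∀ k, ‖xh (k + 1) - (I.iter S (k + 1)).x‖ ≤ w k * (ε / (12 * I.Lf)) := fun k =>
    (herr k).trans (error_le hL hH
      (mul_le_mul_of_nonneg_left (muBar_le_eps _ _ _) (hw0 k).le))
  have he1 : ∀ k, ‖xh k - (I.iter S k).x‖ ≤ 1 / (12 * I.Lf) := fun k => by
    cases k with
    | zero => rw [h0, iter, sub_self, norm_zero]; positivity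
    | succ k =>
      refine (he k).trans ((mul_le_of_le_one_left (by positivity) (hw1 k)).trans ?_)
      have := hε.lt_one.le
      gcongr
  -- The squared weights sum to at most `2`, so the total error is at most `ε² / (48 L_f)`, below
  -- `1` because `ε² ≤ 3 L_f`. This is what the slack `+ 1` in the level set pays for.
  have hsumle : ∀ K, ∑ k ∈ Finset.range K, 3 / 2 * I.Lf * ‖xh k - (I.iter S k).x‖ ^ 2 ≤ 1 := by
    intro K
    have h1 : ∑ k ∈ Finset.range K, 3 / 2 * I.Lf * ‖xh (k + 1) - (I.iter S (k + 1)).x‖ ^ 2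
        ≤ 3 / 2 * I.Lf * (ε / (12 * I.Lf)) ^ 2
          * ∑ k ∈ Finset.range K, (1 / ((k : ℝ) + 1) ^ 2) ^ 2 := by
      rw [Finset.mul_sum]
      refine Finset.sum_le_sum fun k _ => ?_
      have h2 := pow_le_pow_left₀ (norm_nonneg _) (he k) 2
      rw [mul_pow, hw] at h2
      calc _ ≤ 3 / 2 * I.Lf * ((1 / ((k : ℝ) + 1) ^ 2) ^ 2 * (ε / (12 * I.Lf)) ^ 2) := by gcongr
        _ = _ := by ring
    have h2 : ∑ k ∈ Finset.range K, (1 / ((k : ℝ) + 1) ^ 2) ^ 2 ≤ 2 := by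
      have := sum_inv_sq_sq_le K
      have h3 : 0 ≤ 2 / ((K : ℝ) + 1) := by positivity
      linarith
    have h3 : 3 / 2 * I.Lf * (ε / (12 * I.Lf)) ^ 2 * 2 ≤ 1 := by
      have e : 3 / 2 * I.Lf * (ε / (12 * I.Lf)) ^ 2 * 2 = ε ^ 2 / (48 * I.Lf) := by
        field_simp; ring
      rw [e, div_le_one (by positivity)]
      linarith [hε.sq_le]
    have h4 : ∑ k ∈ Finset.range K, 3 / 2 * I.Lf * ‖xh k - (I.iter S k).x‖ ^ 2
        ≤ ∑ k ∈ Finset.range (K + 1), 3 / 2 * I.Lf * ‖xh k - (I.iter S k).x‖ ^ 2 :=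
      Finset.sum_le_sum_of_subset_of_nonneg (Finset.range_mono (Nat.le_succ K))
        fun _ _ _ => by positivity
    rw [Finset.sum_range_succ' _ K, h0, iter, sub_self, norm_zero] at h4
    have h5 : 3 / 2 * I.Lf * (ε / (12 * I.Lf)) ^ 2
        * ∑ k ∈ Finset.range K, (1 / ((k : ℝ) + 1) ^ 2) ^ 2
        ≤ 3 / 2 * I.Lf * (ε / (12 * I.Lf)) ^ 2 * 2 := by gcongr
    linarith
  have hnorm : ∀ k, ‖xh k‖ ≤ R := fun k => by
    have hobj : I.obj (xh k) ≤ I.obj I.x0 + 1 := by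
      have h1 := hsum k
      have h2 := hsumle k
      have h3 : 0 ≤ ∑ i ∈ Finset.range k, I.Lf * ‖xh (i + 1) - (I.iter S i).x‖ ^ 2 :=
        Finset.sum_nonneg fun _ _ => by positivity
      linarith
    have hmem : (xh k, mv I.Abar (xh k) + I.bbar)
        ∈ {q : E d × E m | I.F q.1 q.2 ≤ I.F I.x0 I.y0 + 1} := by
      change I.F0 (xh k) ≤ I.F0 I.x0 + 1
      rw [Problem.F0_eq_obj hV.standing.proper (hfeas k).2,
        Problem.F0_eq_obj hV.standing.proper hV.feasible_x0.2, ← EReal.coe_one, ← EReal.coe_add,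
        EReal.coe_le_coe_iff]
      exact hobj
    exact (norm_fst_le _).trans (hR _ hmem)
  intro k
  obtain ⟨zs, hzs, hx⟩ := hprim k
  constructor
  -- `ν` is `-τ` times the next exact point, hence bounded on the level set.
  · have h1 : I.nu I.τ (I.iter S k).x = -(I.τ • xh (k + 1)) := by
      rw [Problem.nu_eq hτ hV.standing.proper hV.zini_dom hzs, hx, Problem.primal, smul_neg,
        smul_smul, mul_one_div_cancel hτ.ne', one_smul, neg_neg]
    rw [h1, norm_neg, norm_smul, Real.norm_of_nonneg hτ.le]
    have := hnorm (k + 1)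
    gcongr
  · refine hgap _ _ ⟨zs, hzs⟩ (le_max_left _ _) (le_trans ?_ (le_max_right _ _))
    have h1 := norm_sub_le (xh k) (xh k - (I.iter S k).x)
    rw [sub_sub_cancel] at h1
    linarith [hnorm k, he1 k]

/-- For the modulus `λ⁺_min / τ` the factor `τ` cancels in `L_𝒟 / ρ`, so the general step count
becomes `2 √2 κ(H)`. -/
theorem schedFull_eq (hL : 0 < I.Lf) : I.schedFull
    = I.schedOf (fun _ => lamMinPos I.H / I.τ) (fun _ => 1) := by
  have hτ := τ_pos hL
  funext ε δ
  simp only [schedFull, schedOf, one_mul, condNum, Problem.LD]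
  congr! 4
  rw [← mul_div_assoc', div_div_div_cancel_right₀ hτ.ne', Real.sqrt_mul zero_le_two, mul_assoc]

theorem sqrt_LD_div_lamMinPos (hL : 0 < I.Lf) :
    √(I.LD I.τ / (lamMinPos I.H / I.τ)) = condNum I.H := by
  rw [Problem.LD, div_div_div_cancel_right₀ (τ_pos hL).ne', condNum]

theorem complexity_of_Lf_nonpos (hL : ¬ 0 < I.Lf) (C c B : ℝ) (N : ℝ → ℝ → ℕ) :
    I.Complexity C c B N :=
  ⟨⟨0, fun _ _ hε _ => absurd hε.Lf_pos hL⟩, ⟨1, one_pos, fun _ _ hε _ _ => absurd hε.Lf_pos hL⟩⟩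

/-- The complexity bound in the degenerate case of an initial point that is always optimal. -/
theorem complexity_of_gap_nonpos (hV : I.Valid) (hL : 0 < I.Lf)
    (hO : ∀ x, (I.Omega I.τ x).Nonempty) {C c B : ℝ} (hB : B ≤ 0)
    (hgap : ∀ ε δ, I.Adm ε → 0 < δ → ∀ k < I.outer ε,
      I.gap I.τ (I.iter (I.schedOf ρ w ε δ) k).x I.zini ≤ B) :
    I.Complexity C c B (fun ε δ => I.total (I.schedOf ρ w ε δ) ε) := by
  have hg0 : ∀ x, 0 ≤ I.gap I.τ x I.zini := fun x => by
    obtain ⟨zs, hzs⟩ := hO x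
    exact Problem.gap_nonneg hV.standing.proper hV.zini_dom hzs
  have htot : ∀ ε δ, I.Adm ε → 0 < δ → I.total (I.schedOf ρ w ε δ) ε = 0 := fun ε δ hε hδ =>
    Finset.sum_eq_zero fun k hk => by
      have h1 := hgap ε δ hε hδ k (Finset.mem_range.1 hk)
      have h2 : (I.schedOf ρ w ε δ).rounds k (I.iter (I.schedOf ρ w ε δ) k).x = 0 :=
        roundsFor_eq_zero (le_antisymm (h1.trans hB) (hg0 _))
      rw [h2, zero_mul]
  -- `Real.log` is `0` at `0` but may have either sign at a negative `B`. Gaps are nonnegative, so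
  -- `B < 0` is possible only without outer iterations, where the other factor vanishes.
  have hy : B = 0 ∨ ∀ ε, I.Adm ε → I.Lf * I.Δ / ε ^ 2 = 0 := by
    rcases hB.eq_or_lt with h | h
    · exact Or.inl h
    · refine Or.inr fun ε hε => ?_
      have hK : I.outer ε = 0 := by
        by_contra hne
        exact ((hg0 _).trans (hgap ε 1 hε one_pos 0 (Nat.pos_of_ne_zero hne))).not_gt h
      rw [outer, Nat.ceil_eq_zero, mul_assoc, mul_div_assoc] at hK
      have hε0 := hε.1
      have hΔ := hV.Δ_nonneg
      have : 0 ≤ I.Lf * I.Δ / ε ^ 2 := by positivity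
      linarith
  constructor
  · refine ⟨0, fun ε δ hε hδ => ?_⟩
    simp only [htot ε δ hε hδ]
    rcases hy with h | h
    · simp [h]
    · simp [h ε hε]
  · refine ⟨1, one_pos, fun ε δ hε _ hδ => ?_⟩
    simp only [htot ε δ hε hδ]
    rcases hy with h | h
    · simp [h]
    · simp [h ε hε]

section Polyhedral

variable {p : ℕ} {C : Matrix (Fin p) (Fin m) ℝ} {r : E p} {θ : ℝ}

theorem growth_rho (hV : I.Valid) (hL : 0 < I.Lf) (hn : 0 < n) (hP : I.Polyhedral C r)
    (hθ : I.IsHoffman C θ) (x : E d) : I.Growth I.τ x (I.rho θ x) I.zini := by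
  have hθ0 := hθ.pos hn hV.standing.rank
  have hx := hV.feasible_x0
  unfold rho
  split_ifs with h
  · exact hP.growth_homogeneous x (τ_pos hL) hV.standing.proper hx.1 hx.2 hV.zini_dom hθ0 hθ h.1 h.2
  · exact hP.growth x (τ_pos hL) hV.standing.proper hx.1 hx.2 hV.zini_dom hθ0 hθ

theorem gap_zini_nonneg (hV : I.Valid) (hL : 0 < I.Lf) (hn : 0 < n) (hP : I.Polyhedral C r)
    (hθ : I.IsHoffman C θ) (x : E d) : 0 ≤ I.gap I.τ x I.zini := by
  obtain ⟨zs, hzs⟩ := (growth_rho hV hL hn hP hθ x).1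
  exact Problem.gap_nonneg hV.standing.proper hV.zini_dom hzs

theorem rho_pos (hV : I.Valid) (hL : 0 < I.Lf) (hn : 0 < n) (hP : I.Polyhedral C r)
    (hθ : I.IsHoffman C θ) (x : E d) : 0 < I.rho θ x := by
  have hθ0 := hθ.pos hn hV.standing.rank
  have hτ := τ_pos hL
  have hg := gap_zini_nonneg hV hL hn hP hθ x
  unfold rho
  split_ifs <;> positivity

/-- The bound covers both branches of `rho`, because (c) does not exclude zero right-hand sides. -/
theorem LD_div_rho_le (hV : I.Valid) (hL : 0 < I.Lf) (hn : 0 < n) (hP : I.Polyhedral C r)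
    (hθ : I.IsHoffman C θ) (x : E d) {B5 B6 : ℝ} (h5 : ‖I.nu I.τ x‖ ^ 2 ≤ B5)
    (h6 : I.gap I.τ x I.zini ≤ B6) : I.LD I.τ / I.rho θ x
      ≤ lamMax I.H * θ ^ 2 * (1 + B6 / I.τ + 2 * (B5 / I.τ ^ 2)) := by
  have hτ := τ_pos hL
  have hg := gap_zini_nonneg hV hL hn hP hθ x
  have hlam := I.lamMax_H_pos hn hV.standing.rank
  have hB5 : 0 ≤ B5 := (sq_nonneg _).trans h5
  have hB6 : 0 ≤ B6 := hg.trans h6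
  rw [Problem.LD]
  unfold rho
  split_ifs
  · calc lamMax I.H / I.τ / (θ ^ 2 * I.τ)⁻¹ = lamMax I.H * θ ^ 2 * 1 := by field_simp
      _ ≤ lamMax I.H * θ ^ 2 * (1 + B6 / I.τ + 2 * (B5 / I.τ ^ 2)) := by
        have : 0 ≤ B6 / I.τ + 2 * (B5 / I.τ ^ 2) := by positivity
        gcongr
        linarith
  · rw [norm_smul, Real.norm_of_nonneg (one_div_pos.2 hτ).le, mul_pow]
    calc lamMax I.H / I.τ / (θ ^ 2 * (I.τ + I.gap I.τ x I.zini
          + 2 * I.τ * ((1 / I.τ) ^ 2 * ‖I.nu I.τ x‖ ^ 2)))⁻¹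
        = lamMax I.H * θ ^ 2 * (1 + I.gap I.τ x I.zini / I.τ
          + 2 * (‖I.nu I.τ x‖ ^ 2 / I.τ ^ 2)) := by
          rw [div_inv_eq_mul]; field_simp
      _ ≤ _ := by gcongr

theorem sqrt_LD_div_rho (hL : 0 < I.Lf) (hb : I.bbar = 0) (hb' : I.b = 0) (x : E d) :
    √(I.LD I.τ / I.rho θ x) = √(lamMax I.H * θ ^ 2) := by
  have hτ := τ_pos hL
  rw [Problem.LD, rho, if_pos ⟨hb, hb'⟩]
  congr 1
  field_simp

end Polyhedral

theorem full_rank_case (hV : I.Valid) (hn : 0 < n) (hH : I.H.rank = m + n) :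
    (∀ ε δ, I.Adm ε → 0 < δ → I.Finds (I.schedFull ε δ) ε δ) ∧
      I.Complexity 76800 (condNum I.H) 1 (fun ε δ => I.total (I.schedFull ε δ) ε) := by
  by_cases hL : 0 < I.Lf
  swap
  · exact ⟨fun _ _ hε _ => absurd hε.Lf_pos hL, complexity_of_Lf_nonpos hL _ _ _ _⟩
  have hτ := τ_pos hL
  have hx := hV.feasible_x0
  have hG : ∀ x, I.Growth I.τ x (lamMinPos I.H / I.τ) I.zini := fun x =>
    Problem.growth_full_rank x hτ hV.standing.proper hx.1 hx.2 hV.zini_dom hn hH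
  have hρ : 0 < lamMinPos I.H / I.τ := div_pos (I.lamMinPos_H hn hH).1 hτ
  rw [schedFull_eq hL]
  refine ⟨fun ε δ hε hδ => finds_schedOf hV hn hε hδ (fun _ => hρ) hG (fun _ => one_pos)
    fun _ => le_rfl, complexity_schedOf hV hn (fun _ => hρ) hG (fun k => ?_) (fun _ => le_rfl)
    (Real.sqrt_nonneg _) one_pos fun _ _ _ _ _ _ => (sqrt_LD_div_lamMinPos hL).le⟩
  rw [div_le_one (by positivity)]
  exact one_le_pow₀ (by linarith [(Nat.cast_nonneg k : (0 : ℝ) ≤ k)])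

theorem homogeneous_case (hV : I.Valid) (hn : 0 < n) {p : ℕ} {C : Matrix (Fin p) (Fin m) ℝ}
    {r : E p} {θ : ℝ} (hP : I.Polyhedral C r) (hb : I.bbar = 0) (hb' : I.b = 0)
    (hθ : I.IsHoffmanSmall C θ) :
    (∀ ε δ, I.Adm ε → 0 < δ → I.Finds (I.schedPoly θ (fun _ => 1) ε δ) ε δ) ∧
      I.Complexity 76800 (√(lamMax I.H * θ ^ 2)) 1
        (fun ε δ => I.total (I.schedPoly θ (fun _ => 1) ε δ) ε) := by
  by_cases hL : 0 < I.Lf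
  swap
  · exact ⟨fun _ _ hε _ => absurd hε.Lf_pos hL, complexity_of_Lf_nonpos hL _ _ _ _⟩
  have hθ := hθ.isHoffman hb hb'
  have hG := growth_rho hV hL hn hP hθ
  have hρ := rho_pos hV hL hn hP hθ
  refine ⟨fun ε δ hε hδ => finds_schedOf hV hn hε hδ hρ hG (fun _ => one_pos)
    fun _ => le_rfl, complexity_schedOf hV hn hρ hG (fun k => ?_) (fun _ => le_rfl)
    (Real.sqrt_nonneg _) one_pos fun _ _ _ _ _ _ => (sqrt_LD_div_rho hL hb hb' _).le⟩
  rw [div_le_one (by positivity)]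
  exact one_le_pow₀ (by linarith [(Nat.cast_nonneg k : (0 : ℝ) ≤ k)])

theorem compact_case (hV : I.Valid) (hn : 0 < n) {p : ℕ} {C : Matrix (Fin p) (Fin m) ℝ}
    {r : E p} {θ : ℝ} {w : ℕ → ℝ} (hw : ∀ k, w k = 1 / ((k : ℝ) + 1) ^ 2)
    (hP : I.Polyhedral C r)
    (hc : IsCompact {q : E d × E m | I.F q.1 q.2 ≤ I.F I.x0 I.y0 + 1})
    (hθ : I.IsHoffman C θ) :
    (∀ ε δ, I.Adm ε → 0 < δ → I.Finds (I.schedPoly θ w ε δ) ε δ) ∧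
    (∃ B5 B6 : ℝ, ∀ ε δ, I.Adm ε → 0 < δ → ∀ k < I.outer ε,
      ‖I.nu I.τ (I.iter (I.schedPoly θ w ε δ) k).x‖ ^ 2 ≤ B5 ∧
      I.gap I.τ (I.iter (I.schedPoly θ w ε δ) k).x I.zini ≤ B6) ∧
    (∀ B5 B6 : ℝ, (∀ ε δ, I.Adm ε → 0 < δ → ∀ k < I.outer ε,
      ‖I.nu I.τ (I.iter (I.schedPoly θ w ε δ) k).x‖ ^ 2 ≤ B5 ∧
      I.gap I.τ (I.iter (I.schedPoly θ w ε δ) k).x I.zini ≤ B6) →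
      I.Complexity 76800 (√(lamMax I.H * θ ^ 2 * (1 + B6 / I.τ + 2 * (B5 / I.τ ^ 2)))) B6
        (fun ε δ => I.total (I.schedPoly θ w ε δ) ε)) := by
  by_cases hL : 0 < I.Lf
  swap
  · exact ⟨fun _ _ hε _ => absurd hε.Lf_pos hL, ⟨0, 0, fun _ _ hε _ => absurd hε.Lf_pos hL⟩,
      fun _ _ _ => complexity_of_Lf_nonpos hL _ _ _ _⟩
  have hG := growth_rho hV hL hn hP hθ
  have hρ := rho_pos hV hL hn hP hθ
  have hw0 : ∀ k, 0 < w k := fun k => by rw [hw]; positivity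
  have hw1 : ∀ k, w k ≤ 1 := fun k => by
    rw [hw, div_le_one (by positivity)]
    exact one_le_pow₀ (by linarith [(Nat.cast_nonneg k : (0 : ℝ) ≤ k)])
  refine ⟨fun ε δ hε hδ => finds_schedOf hV hn hε hδ hρ hG hw0 hw1, ?_, fun B5 B6 hB => ?_⟩
  · obtain ⟨B5, B6, hB⟩ := exists_bounds_of_isCompact hV hn hρ hG hw hc hL
    exact ⟨B5, B6, fun ε δ hε hδ k _ => hB ε δ hε hδ k⟩
  -- A nonpositive `B6` forces all relevant gaps to vanish and no inner work is done; otherwise `B6`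
  -- is a legitimate argument of the logarithm.
  · rcases le_or_gt B6 0 with h6 | h6
    · exact complexity_of_gap_nonpos hV hL (fun x => (hG x).1) h6
        fun ε δ hε hδ k hk => (hB ε δ hε hδ k hk).2
    · exact complexity_schedOf hV hn hρ hG (fun k => (hw k).ge) hw1 (Real.sqrt_nonneg _) h6
        fun ε δ hε hδ k hk => Real.sqrt_le_sqrt
          (LD_div_rho_le hV hL hn hP hθ _ (hB ε δ hε hδ k hk).1 (hB ε δ hε hδ k hk).2)

end Input

end PGRPD

theorem mainTheorem1 :
    ∃ C : ℝ, 0 < C ∧ ∀ (d m n : ℕ) (I : Input d m n), 0 < n → I.Valid →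
      -- (a) full row rank of the stacked matrix
      (I.H.rank = m + n →
        (∀ ε δ, I.Adm ε → 0 < δ → I.Finds (I.schedFull ε δ) ε δ) ∧
        I.Complexity C (condNum I.H) 1 (fun ε δ => I.total (I.schedFull ε δ) ε)) ∧
      -- (b) polyhedral regularizer, zero right-hand sides
      (∀ (p : ℕ) (Cm : Matrix (Fin p) (Fin m) ℝ) (r : E p) (θ : ℝ),
        I.Polyhedral Cm r → I.bbar = 0 → I.b = 0 → I.IsHoffmanSmall Cm θ →
        (∀ ε δ, I.Adm ε → 0 < δ → I.Finds (I.schedPoly θ (fun _ => 1) ε δ) ε δ) ∧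
        I.Complexity C (√(lamMax I.H * θ ^ 2)) 1
          (fun ε δ => I.total (I.schedPoly θ (fun _ => 1) ε δ) ε)) ∧
      -- (c) polyhedral regularizer, compact level set
      (∀ (p : ℕ) (Cm : Matrix (Fin p) (Fin m) ℝ) (r : E p) (θ : ℝ) (w : ℕ → ℝ),
        (∀ k, w k = 1 / ((k : ℝ) + 1) ^ 2) →
        I.Polyhedral Cm r →
        IsCompact {q : E d × E m | I.F q.1 q.2 ≤ I.F I.x0 I.y0 + 1} →
        I.IsHoffman Cm θ →
        (∀ ε δ, I.Adm ε → 0 < δ → I.Finds (I.schedPoly θ w ε δ) ε δ) ∧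
        (∃ B5 B6 : ℝ, ∀ ε δ, I.Adm ε → 0 < δ → ∀ k < I.outer ε,
          ‖I.nu I.τ (I.iter (I.schedPoly θ w ε δ) k).x‖ ^ 2 ≤ B5 ∧
          I.gap I.τ (I.iter (I.schedPoly θ w ε δ) k).x I.zini ≤ B6) ∧
        (∀ B5 B6 : ℝ, (∀ ε δ, I.Adm ε → 0 < δ → ∀ k < I.outer ε,
          ‖I.nu I.τ (I.iter (I.schedPoly θ w ε δ) k).x‖ ^ 2 ≤ B5 ∧
          I.gap I.τ (I.iter (I.schedPoly θ w ε δ) k).x I.zini ≤ B6) →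
          I.Complexity C (√(lamMax I.H * θ ^ 2 * (1 + B6 / I.τ + 2 * (B5 / I.τ ^ 2)))) B6
            (fun ε δ => I.total (I.schedPoly θ w ε δ) ε))) :=
  ⟨76800, by norm_num, fun _ _ _ _ hn hV => ⟨fun hH => Input.full_rank_case hV hn hH,
    fun _ _ _ _ hP hb hb' hθ => Input.homogeneous_case hV hn hP hb hb' hθ,
    fun _ _ _ _ _ hw hP hc hθ => Input.compact_case hV hn hw hP hc hθ⟩⟩
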